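/- **Master equation for the reduced state.** Let $d,N\ge 0$ and $\hbar=1$. Write $z=(x,\xi)\in\mathbb R^{2d}$ for the phase-space variables of a system $(S)$ and $u=(y,\eta)\in\mathbb R^{2N}$ for those of an environment $(E)$. Let $$H_S(t,z)=\tfrac12 z\cdot M_S(t)z,\qquad H_E(t,u)=\tfrac12u\cdot M_E(t)u,\qquad V(t,z,u)=z\cdot G(t)u,$$ where $M_S,M_E$ are real symmetric matrices and $G$ is a real $2d\times2N$ matrix, all depending continuously on $t\in\mathbb R$ (constant coefficients are a special case), and let $H=H_S+H_E+V$. With $J_S=\begin{pmatrix}0&1\\-1&0\end{pmatrix}$ in dimension $2d$, and $J_E$ likewise in dimension $2N$, let $\Phi_S^t,\Phi_E^t,\Phi^t$ be the linear Hamiltonian flows of $H_S,H_E,H$ starting from the identity at $t=0$ (for instance $\dot\Phi_S^t=J_SM_S(t)\Phi_S^t$, $\Phi_S^0=1$). In the decomposition $\mathbb R^{2d}\oplus\mathbb R^{2N}$ write $\Phi^t=\begin{pmatrix}\Phi^t_{ii}&\Phi^t_{ie}\\ \Phi^t_{ei}&\Phi^t_{ee}\end{pmatrix}$. Let $\Psi^t=\mathrm{diag}(\Phi_S^t,\Phi_E^t)^{-1}\Phi^t$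 be the interacting flow, with blocks $\Psi^t_{ii}$ etc., and let $t_c\in[0,+\infty]$ be the largest time such that $\Psi^t_{ii}$ is invertible for all $t\in[0,t_c[$. Let $U(t)$ be the unitary propagator on $L^2(\mathbb R^{d+N})$ of the Weyl quantization $\hat H(t)$: $U(0)=1$, $U(t)$ maps the Schwartz space to itself, and $i\partial_tU(t)\psi=\hat H(t)U(t)\psi$ in $L^2$ for Schwartz $\psi$. Let $\hat\rho_S(0)$ be a bounded operator on $L^2(\mathbb R^d)$ whose Weyl symbol $\rho_S(0)$ is an arbitrary Schwartz function on $\mathbb R^{2d}$ (in particular, any density operator with Schwartz symbol). Let $\hat\rho_E(0)$ be the operator on $L^2(\mathbb R^N)$ with Gaussian Weyl symbol $$\rho_E(u)=\det(\Gamma)^{-1/2}\exp\bigl(-\tfrac12(u-m_E)\cdot\Gamma^{-1}(u-m_E)\bigr),$$ with $m_E\in\mathbb R^{2N}$ and $\Gamma=\mathrm{Cov}_{\rho_E}$ positive definite (in particular, any Gaussian density operator). Put $\hat\rho(0)=\hat\rho_S(0)\otimes\hat\rho_E(0)$, $\hat\rho(t)=U(t)\hat\rho(0)U(t)^*$, and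 $\hat\rho_S(t)=\mathrm{tr}_E\,\hat\rho(t)$, where $\mathrm{tr}_E A$ is the trace-class operator on $L^2(\mathbb R^d)$ such that $\mathrm{tr}((\mathrm{tr}_EA)C)=\mathrm{tr}(A(C\otimes1))$ for all bounded $C$. Then $t_c>0$; for every $t\in\mathbb R$ the operator $\hat\rho_S(t)$ has a Weyl symbol $\rho_S(t,\cdot)$ in the Schwartz class, equal to the given $\rho_S(0)$ at $t=0$; and for every $t\in[0,t_c[$ the block $\Phi^t_{ii}$ is invertible and, for every $z\in\mathbb R^{2d}$, $\rho_S(\cdot,z)$ is differentiable at $t$ with $$\partial_t\rho_S(t,z)=\{H_S(t),\rho_S(t)\}(z)+(A(t)\nabla_z)\cdot\bigl(z\,\rho_S(t,z)\bigr)+(B(t)\nabla_z)\cdot\nabla_z\rho_S(t,z)+v(t)\cdot\nabla_z\rho_S(t,z),$$ where $\{f,g\}=\partial_xf\cdot\partial_\xi g-\partial_\xi f\cdot\partial_xg$, $(A\nabla)\cdot(zf)=\sum_{j,k}A_{jk}\partial_k(z_jf)$, $(B\nabla)\cdot\nabla f=\sum_{j,k}B_{jk}\partial_k\partial_jf$,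 and $$A(t)^{\top}=-J_SG(t)\Phi^t_{ei}(\Phi^t_{ii})^{-1},\qquad B(t)=\tfrac12\bigl(L(t)+L(t)^\top\bigr),$$ $$L(t)=J_SG(t)\bigl(\Phi^t_{ee}-\Phi^t_{ei}(\Phi^t_{ii})^{-1}\Phi^t_{ie}\bigr)\,\Gamma\,(\Phi^t_{ie})^{\top},$$ $$v(t)=-J_SG(t)\bigl(\Phi^t_{ee}-\Phi^t_{ei}(\Phi^t_{ii})^{-1}\Phi^t_{ie}\bigr)m_E.$$ -/

import Mathlib

open MeasureTheory Matrix
open scoped SchwartzMap LineDeriv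

noncomputable section

/-! ## Classical phase space -/

/-- The configuration space `ℝ^ι`.  It carries Lebesgue measure; the choice of norm on it plays no
role below (only Schwartz functions, derivatives and the measure are used). -/
abbrev Conf (ι : Type) : Type := ι → ℝ

/-- Indices of phase-space coordinates: `inl j` is the position `x_j`, `inr j` the momentum `ξ_j`. -/
abbrev PIdx (ι : Type) : Type := ι ⊕ ι

/-- The phase space with points `z = (x, ξ)`. -/
abbrev Phase (ι : Type) : Type := PIdx ι → ℝ

/-- The indices of the coordinates `(z, u)` of the phase space of the total system, with
`z` in the phase space of the system and `u` in that of the environment. -/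
abbrev TIdx (d N : ℕ) : Type := PIdx (Fin d) ⊕ PIdx (Fin N)

/-- The matrix `J = [[0, 1], [-1, 0]]`, so that Hamilton's equations read `ż = J ∇H(z)`. -/
def sympJ (ι : Type) [DecidableEq ι] : Matrix (PIdx ι) (PIdx ι) ℝ :=
  fromBlocks 0 1 (-1) 0

/-- `J = diag(J_S, J_E)`. -/
def totalJ (d N : ℕ) : Matrix (TIdx d N) (TIdx d N) ℝ :=
  fromBlocks (sympJ (Fin d)) 0 0 (sympJ (Fin N))

/-- The Hessian of `H(z,u) = ½ z·M_S z + ½ u·M_E u + z·G u`. -/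
def totalHessian {d N : ℕ} (MS : Matrix (PIdx (Fin d)) (PIdx (Fin d)) ℝ)
    (ME : Matrix (PIdx (Fin N)) (PIdx (Fin N)) ℝ)
    (G : Matrix (PIdx (Fin d)) (PIdx (Fin N)) ℝ) : Matrix (TIdx d N) (TIdx d N) ℝ :=
  fromBlocks MS G Gᵀ ME

/-- `Φ` is the flow, started at time `0`, of the quadratic Hamiltonian `½ X·M(t) X`:
the solution of `Φ̇ = J M(t) Φ`, `Φ(0) = 1`. -/
def IsHamiltonianFlow {κ : Type} [Fintype κ] [DecidableEq κ] (J : Matrix κ κ ℝ)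
    (M : ℝ → Matrix κ κ ℝ) (Φ : ℝ → Matrix κ κ ℝ) : Prop :=
  Φ 0 = 1 ∧ ∀ t i j, HasDerivAt (fun s => Φ s i j) ((J * M t * Φ t) i j) t

/-- The classical interacting flow `Ψ = Φ₀⁻¹ Φ` with `Φ₀ = diag(Φ_S, Φ_E)`. -/
def interactingFlow {d N : ℕ} (ΦS : ℝ → Matrix (PIdx (Fin d)) (PIdx (Fin d)) ℝ)
    (ΦE : ℝ → Matrix (PIdx (Fin N)) (PIdx (Fin N)) ℝ)
    (Φ : ℝ → Matrix (TIdx d N) (TIdx d N) ℝ) : ℝ → Matrix (TIdx d N) (TIdx d N) ℝ :=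
  fun t => (fromBlocks (ΦS t) 0 0 (ΦE t))⁻¹ * Φ t

/-- The largest `t_c ∈ [0, ∞]` such that `K t` is invertible for every `t ∈ [0, t_c[`. -/
def criticalTime {κ : Type} [Fintype κ] [DecidableEq κ] (K : ℝ → Matrix κ κ ℝ) : EReal :=
  sSup {T : EReal | ∀ t : ℝ, 0 ≤ t → (t : EReal) < T → IsUnit (K t)}

/-! ## Coefficients of the master equation -/

section Coefficients

variable {d N : ℕ} (Φ : Matrix (TIdx d N) (TIdx d N) ℝ)
  (G : Matrix (PIdx (Fin d)) (PIdx (Fin N)) ℝ)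

/-- `Φ_ee - Φ_ei Φ_ii⁻¹ Φ_ie`. -/
def schurBlock : Matrix (PIdx (Fin N)) (PIdx (Fin N)) ℝ :=
  Φ.toBlocks₂₂ - Φ.toBlocks₂₁ * (Φ.toBlocks₁₁)⁻¹ * Φ.toBlocks₁₂

/-- `A`, given by `Aᵀ = - J_S G Φ_ei Φ_ii⁻¹`. -/
def driftCoeff : Matrix (PIdx (Fin d)) (PIdx (Fin d)) ℝ :=
  (-(sympJ (Fin d) * G * Φ.toBlocks₂₁ * (Φ.toBlocks₁₁)⁻¹))ᵀ

/-- `L = J_S G (Φ_ee - Φ_ei Φ_ii⁻¹ Φ_ie) Γ Φ_ieᵀ`. -/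
def diffusionL (Γ : Matrix (PIdx (Fin N)) (PIdx (Fin N)) ℝ) :
    Matrix (PIdx (Fin d)) (PIdx (Fin d)) ℝ :=
  sympJ (Fin d) * G * schurBlock Φ * Γ * (Φ.toBlocks₁₂)ᵀ

/-- `B = (L + Lᵀ) / 2`. -/
def diffusionCoeff (Γ : Matrix (PIdx (Fin N)) (PIdx (Fin N)) ℝ) :
    Matrix (PIdx (Fin d)) (PIdx (Fin d)) ℝ :=
  (1 / 2 : ℝ) • (diffusionL Φ G Γ + (diffusionL Φ G Γ)ᵀ)

/-- `v = - J_S G (Φ_ee - Φ_ei Φ_ii⁻¹ Φ_ie) m`. -/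
def transportCoeff (m : Phase (Fin N)) : Phase (Fin d) :=
  -((sympJ (Fin d) * G * schurBlock Φ) *ᵥ m)

end Coefficients

/-! ## Differential expressions on phase space -/

/-- The partial derivative `∂_k f`. -/
def pderivAt {κ : Type} [Fintype κ] [DecidableEq κ] (k : κ) (f : (κ → ℝ) → ℂ) (z : κ → ℝ) : ℂ :=
  fderiv ℝ f z (Pi.single k 1)

/-- The Poisson bracket `{f, g} = ∂_x f · ∂_ξ g - ∂_ξ f · ∂_x g`. -/
def poissonBracket {ι : Type} [Fintype ι] [DecidableEq ι] (f g : Phase ι → ℂ) (z : Phase ι) : ℂ :=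
  ∑ j : ι, (pderivAt (Sum.inl j) f z * pderivAt (Sum.inr j) g z
    - pderivAt (Sum.inr j) f z * pderivAt (Sum.inl j) g z)

/-- The quadratic Hamiltonian `½ z·M z`. -/
def quadHam {κ : Type} [Fintype κ] (M : Matrix κ κ ℝ) (z : κ → ℝ) : ℂ :=
  (((1 / 2 : ℝ) * (z ⬝ᵥ (M *ᵥ z)) : ℝ) : ℂ)

/-- `(A∇)·(z f) = ∑_{j,k} A_{jk} ∂_k (z_j f)`. -/
def driftTerm {κ : Type} [Fintype κ] [DecidableEq κ] (A : Matrix κ κ ℝ) (f : (κ → ℝ) → ℂ)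
    (z : κ → ℝ) : ℂ :=
  ∑ j, ∑ k, (A j k : ℂ) * pderivAt k (fun w => (w j : ℂ) * f w) z

/-- `(B∇)·∇f = ∑_{j,k} B_{jk} ∂_k ∂_j f`. -/
def diffusionTerm {κ : Type} [Fintype κ] [DecidableEq κ] (B : Matrix κ κ ℝ) (f : (κ → ℝ) → ℂ)
    (z : κ → ℝ) : ℂ :=
  ∑ j, ∑ k, (B j k : ℂ) * pderivAt k (pderivAt j f) z

/-- `v·∇f`. -/
def transportTerm {κ : Type} [Fintype κ] [DecidableEq κ] (v : κ → ℝ) (f : (κ → ℝ) → ℂ)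
    (z : κ → ℝ) : ℂ :=
  ∑ j, (v j : ℂ) * pderivAt j f z

/-! ## Hilbert spaces and Weyl symbols -/

/-- The Hilbert space `L²(ℝ^ι; ℂ)`. -/
abbrev L2 (ι : Type) [Fintype ι] : Type := Lp ℂ 2 (volume : Measure (Conf ι))

/-- The Weyl quantization (`ħ = 1`) of the symbol `a`, applied to `ψ`:
`(2π)^{-n} ∫∫ e^{i(x-y)·ξ} a((x+y)/2, ξ) ψ(y) dξ dy`. -/
def weylOp {ι : Type} [Fintype ι] (a : Phase ι → ℂ) (ψ : Conf ι → ℂ) (x : Conf ι) : ℂ :=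
  (((2 * Real.pi) ^ Fintype.card ι : ℝ) : ℂ)⁻¹ *
    ∫ y : Conf ι, ∫ ξ : Conf ι,
      Complex.exp (Complex.I * (((x - y) ⬝ᵥ ξ : ℝ) : ℂ)) *
        a (Sum.elim ((1 / 2 : ℝ) • (x + y)) ξ) * ψ y

/-- The bounded operator `T` has Weyl symbol `a`.  (Used for symbols of Schwartz class only;
Schwartz functions are dense in `L²`, so `a` determines `T`.) -/
def HasWeylSymbol {ι : Type} [Fintype ι] (T : L2 ι →L[ℂ] L2 ι) (a : Phase ι → ℂ) : Prop :=
  ∀ ψ : 𝓢(Conf ι, ℂ), (T (ψ.toLp 2 volume) : Conf ι → ℂ) =ᵐ[volume] weylOp a ψ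

/-- The Gaussian symbol `det(Γ)^{-1/2} exp(-½ (u-m)·Γ⁻¹(u-m))`, with covariance `Γ` and mean `m`. -/
def gaussianSymbol {κ : Type} [Fintype κ] [DecidableEq κ] (Γ : Matrix κ κ ℝ) (m : κ → ℝ)
    (u : κ → ℝ) : ℂ :=
  (((Real.sqrt Γ.det)⁻¹ * Real.exp (-(1 / 2) * ((u - m) ⬝ᵥ (Γ⁻¹ *ᵥ (u - m)))) : ℝ) : ℂ)

/-! ## Quadratic quantum dynamics -/

section Dynamics

variable {ι : Type} [Fintype ι]

/-- The position operator `ψ ↦ x_k ψ`. -/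
def positionOp (k : ι) (ψ : 𝓢(Conf ι, ℂ)) : 𝓢(Conf ι, ℂ) :=
  SchwartzMap.smulLeftCLM ℂ (fun x : Conf ι => x k) ψ

theorem positionOp_apply (k : ι) (ψ : 𝓢(Conf ι, ℂ)) (x : Conf ι) :
    positionOp k ψ x = (x k : ℂ) * ψ x := by
  have h : (fun x : Conf ι => x k).HasTemperateGrowth :=
    (ContinuousLinearMap.proj (R := ℝ) (φ := fun _ : ι => ℝ) k).hasTemperateGrowth
  rw [positionOp, SchwartzMap.smulLeftCLM_apply_apply h]
  simp

/-- The momentum operator `ψ ↦ -i ∂_k ψ`. -/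
def momentumOp [DecidableEq ι] (k : ι) (ψ : 𝓢(Conf ι, ℂ)) : 𝓢(Conf ι, ℂ) :=
  (-Complex.I) • ∂_{(Pi.single k 1 : Conf ι)} ψ

end Dynamics

/-- The quantizations of the coordinates `X = (z, u)`, `z = (x, ξ)`, `u = (y, η)`. -/
def canonicalOp {d N : ℕ} :
    TIdx d N → 𝓢(Conf (Fin d ⊕ Fin N), ℂ) → 𝓢(Conf (Fin d ⊕ Fin N), ℂ)
  | Sum.inl (Sum.inl j) => positionOp (Sum.inl j)
  | Sum.inl (Sum.inr j) => momentumOp (Sum.inl j)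
  | Sum.inr (Sum.inl k) => positionOp (Sum.inr k)
  | Sum.inr (Sum.inr k) => momentumOp (Sum.inr k)

/-- The Weyl quantization `½ ∑_{j,k} M_{jk} X̂_j X̂_k` of the quadratic form `½ X·M X`
(`M` symmetric, so the products are symmetrized), on the Schwartz space. -/
def quantumHam {d N : ℕ} (M : Matrix (TIdx d N) (TIdx d N) ℝ)
    (ψ : 𝓢(Conf (Fin d ⊕ Fin N), ℂ)) : 𝓢(Conf (Fin d ⊕ Fin N), ℂ) :=
  ∑ j, ∑ k, ((1 / 2 : ℂ) * (M j k : ℂ)) • canonicalOp j (canonicalOp k ψ)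

/-- `U t = U(t, 0)` is the unitary propagator of the Weyl quantization of `½ X·M(t) X`:
`U(0) = 1`, and for a Schwartz function `ψ` the curve `t ↦ U(t) ψ` consists of Schwartz functions
and solves `i ∂_t U(t) ψ = Ĥ(t) U(t) ψ` in `L²`.  For continuous `M` with symmetric values there is
exactly one such `U`. -/
structure IsPropagator {d N : ℕ} (M : ℝ → Matrix (TIdx d N) (TIdx d N) ℝ)
    (U : ℝ → (L2 (Fin d ⊕ Fin N) →L[ℂ] L2 (Fin d ⊕ Fin N))) : Prop where
  mem_unitary : ∀ t, U t ∈ unitary (L2 (Fin d ⊕ Fin N) →L[ℂ] L2 (Fin d ⊕ Fin N))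
  init : U 0 = 1
  schrodinger : ∀ ψ : 𝓢(Conf (Fin d ⊕ Fin N), ℂ), ∃ φ : ℝ → 𝓢(Conf (Fin d ⊕ Fin N), ℂ),
    ∀ t, U t (ψ.toLp 2 volume) = (φ t).toLp 2 volume ∧
      HasDerivAt (fun s => U s (ψ.toLp 2 volume))
        ((-Complex.I) • (quantumHam (M t) (φ t)).toLp 2 volume) t

/-! ## Tensor products, trace and partial trace -/

theorem memLp_tensor {ι κ : Type} [Fintype ι] [Fintype κ] (φ : L2 ι) (η : L2 κ) :
    MemLp (fun x : Conf (ι ⊕ κ) => φ (fun i => x (Sum.inl i)) * η (fun k => x (Sum.inr k))) 2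
      volume := by
  have hmp : MeasurePreserving (MeasurableEquiv.sumPiEquivProdPi (fun _ : ι ⊕ κ => ℝ)) volume
      volume := volume_measurePreserving_sumPiEquivProdPi (fun _ : ι ⊕ κ => ℝ)
  have hφ := Lp.memLp φ
  have hη := Lp.memLp η
  have key : MemLp (fun p : Conf ι × Conf κ => φ p.1 * η p.2) 2
      ((volume : Measure (Conf ι)).prod (volume : Measure (Conf κ))) := by
    have hm : AEStronglyMeasurable (fun p : Conf ι × Conf κ => φ p.1 * η p.2)
        ((volume : Measure (Conf ι)).prod (volume : Measure (Conf κ))) :=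
      hφ.1.comp_fst.mul hη.1.comp_snd
    rw [memLp_two_iff_integrable_sq_norm hm]
    have h1 := (memLp_two_iff_integrable_sq_norm hφ.1).1 hφ
    have h2 := (memLp_two_iff_integrable_sq_norm hη.1).1 hη
    simpa [mul_pow] using h1.mul_prod h2
  exact key.comp_measurePreserving hmp

/-- `φ ⊗ η ∈ L²(ℝ^{ι ⊕ κ})`, the function `(x, y) ↦ φ(x) η(y)`; this identifies `L²(ℝ^{ι ⊕ κ})` with
the Hilbert tensor product of `L²(ℝ^ι)` and `L²(ℝ^κ)`. -/
def tensorL2 {ι κ : Type} [Fintype ι] [Fintype κ] (φ : L2 ι) (η : L2 κ) : L2 (ι ⊕ κ) :=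
  (memLp_tensor φ η).toLp _

/-- `D = A ⊗ B`. -/
def IsTensorOp {ι κ : Type} [Fintype ι] [Fintype κ] (A : L2 ι →L[ℂ] L2 ι) (B : L2 κ →L[ℂ] L2 κ)
    (D : L2 (ι ⊕ κ) →L[ℂ] L2 (ι ⊕ κ)) : Prop :=
  ∀ φ η, D (tensorL2 φ η) = tensorL2 (A φ) (B η)

section Trace

variable {H : Type} [NormedAddCommGroup H] [InnerProductSpace ℂ H]

/-- Trace-class operators on a Hilbert space: `A = ∑_n |α_n⟩⟨β_n|` with
`∑_n ‖α_n‖ ‖β_n‖ < ∞`. -/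
def IsTraceClass (A : H →L[ℂ] H) : Prop :=
  ∃ α β : ℕ → H, Summable (fun n => ‖α n‖ * ‖β n‖) ∧
    ∀ ψ, HasSum (fun n => inner ℂ (β n) ψ • α n) (A ψ)

/-- `A` is trace class and its trace is `τ`. -/
def HasTrace (A : H →L[ℂ] H) (τ : ℂ) : Prop :=
  IsTraceClass A ∧
    ∀ (I : Type) (b : HilbertBasis I ℂ H), HasSum (fun i => inner ℂ (b i) (A (b i))) τ

end Trace

/-- `R = tr_E A`: the trace-class operator on the system with
`tr_S (R C) = tr (A (C ⊗ 1))` for every bounded operator `C` on the system. -/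
def IsPartialTrace {ι κ : Type} [Fintype ι] [Fintype κ] (A : L2 (ι ⊕ κ) →L[ℂ] L2 (ι ⊕ κ))
    (R : L2 ι →L[ℂ] L2 ι) : Prop :=
  IsTraceClass A ∧ IsTraceClass R ∧
    ∀ (C : L2 ι →L[ℂ] L2 ι) (D : L2 (ι ⊕ κ) →L[ℂ] L2 (ι ⊕ κ)), IsTensorOp C 1 D →
      ∃ τ : ℂ, HasTrace (R * C) τ ∧ HasTrace (A * D) τ

end

/-! The proof works with characteristic functions (Fourier transforms of Weyl symbols) instead of
the symbols themselves. For the Weyl operator W(Y) = exp(iY·X̂), a trace-class operator A has the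
continuous bounded characteristic function χ(Y) = tr(A W(Y)). The Moyal identity (`moyal`) gives,
weakly, A = (2π)^{-n} ∫ χ(Y) W(-Y) dY. Hence if χ is Schwartz, then A has the Schwartz Weyl symbol
(2π)^{-n} ∫ exp(-iY·z) χ(Y) dY (`IsTraceRep.hasWeylSymbol`).

In these terms all ingredients of the reduced state are explicit. A product state has characteristic
function f ⊗ g (`traceChar_eq_tensorChar`), and g is a Gaussian exponential. A quadratic Hamiltonian
acts on Weyl operators through its classical flow, U* W(y) U = W(Φᵀy)
(`IsQuadraticEvolution.inner_weylL2`). The partial trace is restriction to points (y, 0), because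
W(y) ⊗ 1 = W(y, 0) (`IsPartialTrace.traceChar_eq`). Therefore χ_S(t, y) = (f ⊗ g)(Φᵀ(y, 0)) =
f(Φ_iiᵀ y) g(Φ_ieᵀ y). Since Φ is invertible, y ↦ Φᵀ(y, 0) is injective, so χ_S(t) is Schwartz for
every t, even where Φ_ii is singular.

The equation comes from differentiating this formula in t. Put a = M_S J_S y and w = Gᵀ J_S y; then
the velocity of Φᵀ(y, 0) is -Φᵀ(a, w). When Φ_ii is invertible, its system component can be written
through Φ_iiᵀ applied to a + A y, and what is left is a purely environmental vector given by the
Schur complement Φ_ee - Φ_ei Φ_ii⁻¹ Φ_ie (`reducedMatrix_deriv_mulVec`). The first part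
differentiates χ_S along -(M_S J_S + A) y. The second differentiates only the Gaussian g, whose
logarithmic derivative is affine, so it multiplies χ_S by a linear and a quadratic form in y. The
inverse Fourier dictionary turns these three contributions into drift, transport and diffusion
(`piFTS_charGenerator`), and the M_S J_S part of the drift is the Poisson bracket
(`poissonBracket_quadHam`). Finally, Φ_ii and Ψ_ii differ by the invertible factor Φ_S, so Φ_ii is
invertible on [0, t_c[. -/

noncomputable section

open scoped FourierTransform ContDiff

/-! ## The Fourier transform on `κ → ℝ` -/

section FourierPi

variable {κ : Type} [Fintype κ]

/-- The Fourier transform `z ↦ ∫ exp(-i y·z) h(y) dy`. -/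
def piFT (h : (κ → ℝ) → ℂ) (z : κ → ℝ) : ℂ :=
  ∫ y : κ → ℝ, Complex.exp (-Complex.I * ((y ⬝ᵥ z : ℝ) : ℂ)) * h y

theorem norm_cexp_I_mul_ofReal (r : ℝ) : ‖Complex.exp (Complex.I * (r : ℂ))‖ = 1 := by
  rw [mul_comm, Complex.norm_exp_ofReal_mul_I]

theorem norm_cexp_neg_I_mul_ofReal (r : ℝ) : ‖Complex.exp (-Complex.I * (r : ℂ))‖ = 1 := by
  have := norm_cexp_I_mul_ofReal (-r)
  simpa using this

theorem inner_toLp_dot (x y : EuclideanSpace ℝ κ) :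
    inner ℝ x y = (WithLp.ofLp x) ⬝ᵥ (WithLp.ofLp y) := by
  simp [PiLp.inner_apply, dotProduct, mul_comm]

/-- The library transform lives on Euclidean space with kernel exp(-2πi⟨v, w⟩), whereas `piFT` lives
on the sup-normed product with kernel exp(-i y·z). The two spaces share their measure, so only the
rescaling of the frequency by 2π remains. -/
theorem fourier_comp_ofLp (h : (κ → ℝ) → ℂ) (w : EuclideanSpace ℝ κ) :
    𝓕 (fun v : EuclideanSpace ℝ κ => h (WithLp.ofLp v)) w
      = piFT h ((2 * Real.pi) • WithLp.ofLp w) := by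
  rw [Real.fourier_eq', piFT, ← (PiLp.volume_preserving_toLp κ).integral_comp
    (MeasurableEquiv.toLp 2 _).measurableEmbedding]
  refine integral_congr_ae (.of_forall fun v => ?_)
  simp only [inner_toLp_dot, smul_eq_mul, dotProduct_smul]
  congr 2
  push_cast
  ring

theorem integrable_comp_ofLp {h : (κ → ℝ) → ℂ} (hh : Integrable h) :
    Integrable (fun v : EuclideanSpace ℝ κ => h (WithLp.ofLp v)) :=
  (PiLp.volume_preserving_ofLp κ).integrable_comp_of_integrable hh

/-- Fourier inversion on `κ → ℝ`. -/
theorem piFT_inversion {h : (κ → ℝ) → ℂ} (hc : Continuous h) (hh : Integrable h)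
    (hF : Integrable (piFT h)) (v : κ → ℝ) :
    ∫ z : κ → ℝ, Complex.exp (Complex.I * ((z ⬝ᵥ v : ℝ) : ℂ)) * piFT h z
      = (((2 * Real.pi) ^ Fintype.card κ : ℝ) : ℂ) * h v := by
  have hpi : (2 * Real.pi) ≠ 0 := by positivity
  have h1 : (𝓕 (fun v : EuclideanSpace ℝ κ => h (WithLp.ofLp v)))
      = fun w => piFT h ((2 * Real.pi) • WithLp.ofLp w) := funext (fourier_comp_ofLp h)
  have h2 : Integrable (𝓕 (fun v : EuclideanSpace ℝ κ => h (WithLp.ofLp v))) := by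
    rw [h1]
    exact integrable_comp_ofLp (h := fun z => piFT h ((2 * Real.pi) • z)) (hF.comp_smul hpi)
  have h3 := congrFun (Continuous.fourierInv_fourier_eq (hc.comp (PiLp.continuous_ofLp 2 _))
    (integrable_comp_ofLp hh) h2) (WithLp.toLp 2 v)
  simp only [Function.comp_def] at h3
  rw [h1, Real.fourierInv_eq', ← (PiLp.volume_preserving_toLp κ).integral_comp
    (MeasurableEquiv.toLp 2 _).measurableEmbedding] at h3
  have h4 : ∀ y : κ → ℝ, Complex.exp (↑(2 * Real.pi *
      inner ℝ (WithLp.toLp 2 y : EuclideanSpace ℝ κ) (WithLp.toLp 2 v)) * Complex.I) •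
        piFT h ((2 * Real.pi) • y)
      = (fun z => Complex.exp (Complex.I * ((z ⬝ᵥ v : ℝ) : ℂ)) * piFT h z)
        ((2 * Real.pi) • y) := by
    intro y
    simp only [inner_toLp_dot, smul_eq_mul, smul_dotProduct]
    congr 2
    push_cast
    ring
  -- Undoing the frequency scaling produces the Jacobian (2π)^n of the inversion formula.
  have h5 := Measure.integral_comp_smul volume
    (fun z => Complex.exp (Complex.I * ((z ⬝ᵥ v : ℝ) : ℂ)) * piFT h z) (2 * Real.pi)
  rw [integral_congr_ae (.of_forall h4), h5] at h3
  rw [← h3]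
  simp only [Module.finrank_fintype_fun_eq_card, Complex.real_smul]
  rw [abs_of_pos (by positivity), ← mul_assoc, ← Complex.ofReal_mul, mul_inv_cancel₀ (by positivity)]
  simp

/-- The transform, being zero, is trivially integrable, so inversion applies. This uniqueness
statement later identifies the characteristic function of a product state pointwise. -/
theorem piFT_eq_zero {h : (κ → ℝ) → ℂ} (hc : Continuous h) (hh : Integrable h)
    (hF : ∀ z, piFT h z = 0) : h = 0 := by
  ext v
  have hz : piFT h = 0 := funext hF
  have := piFT_inversion hc hh (by rw [hz]; exact integrable_zero _ _ _) v
  simp only [hz, Pi.zero_apply, mul_zero, integral_zero] at this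
  have h2 : (((2 * Real.pi) ^ Fintype.card κ : ℝ) : ℂ) ≠ 0 := by
    exact_mod_cast (by positivity : ((2 * Real.pi) ^ Fintype.card κ : ℝ) ≠ 0)
  simpa [h2] using this.symm

/-- Scaling by `2π`. -/
def scaleCLE (κ : Type) [Fintype κ] : (κ → ℝ) ≃L[ℝ] EuclideanSpace ℝ κ :=
  -- The unit is inverted: the map is z ↦ z / 2π, which compensates the 2π in the kernel of the
  -- Euclidean transform.
  (ContinuousLinearEquiv.smulLeft (R₁ := ℝ) (Units.mk0 (2 * Real.pi) (by positivity) : ℝˣ)⁻¹).trans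
    (EuclideanSpace.equiv κ ℝ).symm

theorem ofLp_scaleCLE (z : κ → ℝ) :
    WithLp.ofLp (scaleCLE κ z) = (2 * Real.pi)⁻¹ • z := rfl

/-- The Fourier transform on Schwartz functions. -/
def piFTS (f : 𝓢(κ → ℝ, ℂ)) : 𝓢(κ → ℝ, ℂ) :=
  SchwartzMap.compCLMOfContinuousLinearEquiv ℂ (scaleCLE κ)
    (𝓕 (SchwartzMap.compCLMOfContinuousLinearEquiv ℂ (EuclideanSpace.equiv κ ℝ) f))

theorem piFTS_apply (f : 𝓢(κ → ℝ, ℂ)) (z : κ → ℝ) : piFTS f z = piFT f z := by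
  simp only [piFTS, SchwartzMap.compCLMOfContinuousLinearEquiv_apply, Function.comp_apply,
    SchwartzMap.fourier_coe]
  refine (fourier_comp_ofLp f _).trans ?_
  rw [ofLp_scaleCLE, smul_smul, mul_inv_cancel₀ (by positivity), one_smul]

/-- Allows an arbitrary Schwartz symbol to be presented as the transform of a Schwartz
characteristic function. -/
theorem piFTS_surjective (a : 𝓢(κ → ℝ, ℂ)) : ∃ f : 𝓢(κ → ℝ, ℂ), piFTS f = a := by
  refine ⟨SchwartzMap.compCLMOfContinuousLinearEquiv ℂ (EuclideanSpace.equiv κ ℝ).symm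
    (𝓕⁻ (SchwartzMap.compCLMOfContinuousLinearEquiv ℂ (scaleCLE κ).symm a)), ?_⟩
  have h1 : ∀ g : 𝓢(EuclideanSpace ℝ κ, ℂ),
      SchwartzMap.compCLMOfContinuousLinearEquiv ℂ (EuclideanSpace.equiv κ ℝ)
      (SchwartzMap.compCLMOfContinuousLinearEquiv ℂ (EuclideanSpace.equiv κ ℝ).symm g) = g := by
    intro g
    ext x
    simp
  rw [piFTS, h1, FourierTransform.fourier_fourierInv_eq]
  ext x
  simp

theorem piFTS_smul (c : ℂ) (f : 𝓢(κ → ℝ, ℂ)) : piFTS (c • f) = c • piFTS f := by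
  simp only [piFTS, map_smul, FourierTransform.fourier_smul]

theorem piFTS_add (f g : 𝓢(κ → ℝ, ℂ)) : piFTS (f + g) = piFTS f + piFTS g := by
  simp only [piFTS, map_add, FourierTransform.fourier_add]

/-- The Fourier transform as a linear map. -/
def piFTSₗ (κ : Type) [Fintype κ] : 𝓢(κ → ℝ, ℂ) →ₗ[ℂ] 𝓢(κ → ℝ, ℂ) where
  toFun := piFTS
  map_add' := piFTS_add
  map_smul' := piFTS_smul

theorem piFTS_sum {α : Type*} (s : Finset α) (f : α → 𝓢(κ → ℝ, ℂ)) :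
    piFTS (∑ i ∈ s, f i) = ∑ i ∈ s, piFTS (f i) := map_sum (piFTSₗ κ) f s

variable [DecidableEq κ]

theorem lineDeriv_piFTS (f : 𝓢(κ → ℝ, ℂ)) (k : κ) :
    ∂_{(Pi.single k 1 : κ → ℝ)} (piFTS f) = piFTS ((-Complex.I) • positionOp k f) := by
  rw [piFTS, SchwartzMap.lineDerivOp_compCLMOfContinuousLinearEquiv,
    SchwartzMap.lineDerivOp_fourier_eq, piFTS]
  congr 2
  ext x
  have ht : (fun v : EuclideanSpace ℝ κ => inner ℝ v (scaleCLE κ (Pi.single k 1))).HasTemperateGrowth := by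
    fun_prop
  have hpi : (Real.pi : ℂ) ≠ 0 := by exact_mod_cast Real.pi_ne_zero
  simp only [_root_.smul_apply, SchwartzMap.smulLeftCLM_apply_apply ht,
    SchwartzMap.compCLMOfContinuousLinearEquiv_apply, Function.comp_apply, positionOp_apply, map_smul]
  rw [inner_toLp_dot, ofLp_scaleCLE, dotProduct_smul, dotProduct_single]
  simp
  field_simp

theorem positionOp_piFTS (f : 𝓢(κ → ℝ, ℂ)) (k : κ) :
    positionOp k (piFTS f) = piFTS (momentumOp k f) := by
  have h : piFTS (∂_{(Pi.single k 1 : κ → ℝ)} f) = Complex.I • positionOp k (piFTS f) := by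
    rw [piFTS]
    have h1 := SchwartzMap.lineDerivOp_compCLMOfContinuousLinearEquiv ℂ
      ((EuclideanSpace.equiv κ ℝ).symm (Pi.single k 1)) (EuclideanSpace.equiv κ ℝ) f
    rw [ContinuousLinearEquiv.apply_symm_apply] at h1
    rw [← h1, SchwartzMap.fourier_lineDerivOp_eq]
    ext z
    have ht : (fun v : EuclideanSpace ℝ κ => inner ℝ v
        ((EuclideanSpace.equiv κ ℝ).symm (Pi.single k 1))).HasTemperateGrowth := by
      fun_prop
    have hpi : (Real.pi : ℂ) ≠ 0 := by exact_mod_cast Real.pi_ne_zero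
    simp only [_root_.smul_apply, SchwartzMap.smulLeftCLM_apply_apply ht,
      SchwartzMap.compCLMOfContinuousLinearEquiv_apply, Function.comp_apply, positionOp_apply,
      map_smul]
    rw [inner_toLp_dot, ofLp_scaleCLE, show WithLp.ofLp ((EuclideanSpace.equiv κ ℝ).symm (Pi.single k (1 : ℝ))) = Pi.single k 1 from rfl,
      dotProduct_single]
    simp only [piFTS, SchwartzMap.compCLMOfContinuousLinearEquiv_apply, Function.comp_apply]
    simp
    field_simp
  rw [momentumOp, piFTS_smul, h, smul_smul]
  simp

end FourierPi

/-! ## Tensor products of Schwartz functions -/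

section Tensor

variable {α β : Type}

/-- Restriction of coordinates along `e : α → β`. -/
def restrictCLM (e : α → β) : (β → ℝ) →L[ℝ] (α → ℝ) :=
  ContinuousLinearMap.pi fun i => ContinuousLinearMap.proj (e i)

@[simp] theorem restrictCLM_apply (e : α → β) (x : β → ℝ) (i : α) :
    restrictCLM e x i = x (e i) := rfl

variable [Fintype α] [Fintype β]

theorem norm_restrictCLM_le (e : α → β) : ‖restrictCLM e‖ ≤ 1 := by
  refine ContinuousLinearMap.opNorm_le_bound _ zero_le_one fun x => ?_
  rw [one_mul, pi_norm_le_iff_of_nonneg (norm_nonneg _)]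
  exact fun i => norm_le_pi_norm x (e i)

theorem norm_iteratedFDeriv_comp_restrict_le (f : 𝓢(α → ℝ, ℂ)) (e : α → β) (n : ℕ) (x : β → ℝ) :
    ‖iteratedFDeriv ℝ n (fun x => f (restrictCLM e x)) x‖
      ≤ ‖iteratedFDeriv ℝ n f (restrictCLM e x)‖ := by
  have h := ContinuousLinearMap.iteratedFDeriv_comp_right (restrictCLM e) (f.smooth n) x
    (i := n) le_rfl
  change ‖iteratedFDeriv ℝ n (f ∘ restrictCLM e) x‖ ≤ _
  rw [h]
  refine (ContinuousMultilinearMap.norm_compContinuousLinearMap_le _ _).trans ?_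
  refine mul_le_of_le_one_right (norm_nonneg _) ?_
  exact Finset.prod_le_one (fun _ _ => norm_nonneg _) fun _ _ => norm_restrictCLM_le e

theorem norm_sum_pi_le (x : α ⊕ β → ℝ) :
    ‖x‖ ≤ max ‖restrictCLM (Sum.inl : α → α ⊕ β) x‖ ‖restrictCLM (Sum.inr : β → α ⊕ β) x‖ := by
  rw [pi_norm_le_iff_of_nonneg (le_max_of_le_left (norm_nonneg _))]
  rintro (i | i)
  · exact le_max_of_le_left (norm_le_pi_norm (restrictCLM (Sum.inl : α → α ⊕ β) x) i)
  · exact le_max_of_le_right (norm_le_pi_norm (restrictCLM (Sum.inr : β → α ⊕ β) x) i)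

/-- The tensor product `(x, y) ↦ f(x) g(y)` of Schwartz functions. -/
def tensorS (f : 𝓢(α → ℝ, ℂ)) (g : 𝓢(β → ℝ, ℂ)) : 𝓢(α ⊕ β → ℝ, ℂ) where
  toFun x := f (restrictCLM Sum.inl x) * g (restrictCLM Sum.inr x)
  smooth' := ((f.smooth ⊤).comp (restrictCLM (Sum.inl : α → α ⊕ β)).contDiff).mul
    ((g.smooth ⊤).comp (restrictCLM (Sum.inr : β → α ⊕ β)).contDiff)
  decay' k n := by
    choose C hC using fun i => f.decay k i
    choose C' hC' using fun i => g.decay k i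
    choose D hD using fun i => f.decay 0 i
    choose D' hD' using fun i => g.decay 0 i
    refine ⟨∑ i ∈ Finset.range (n + 1), (n.choose i : ℝ) * (C i * D' (n - i) + D i * C' (n - i)),
      fun x => ?_⟩
    have h1 := norm_iteratedFDeriv_mul_le (𝕜 := ℝ) (N := n)
      ((f.smooth n).comp (restrictCLM (Sum.inl : α → α ⊕ β)).contDiff)
      ((g.smooth n).comp (restrictCLM (Sum.inr : β → α ⊕ β)).contDiff) x (n := n) le_rfl
    refine (mul_le_mul_of_nonneg_left h1 (by positivity)).trans ?_
    rw [Finset.mul_sum]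
    refine Finset.sum_le_sum fun i _ => ?_
    have a1 := norm_iteratedFDeriv_comp_restrict_le f (Sum.inl : α → α ⊕ β) i x
    have a2 := norm_iteratedFDeriv_comp_restrict_le g (Sum.inr : β → α ⊕ β) (n - i) x
    have b1 := (hC i).2 (restrictCLM (Sum.inl : α → α ⊕ β) x)
    have b2 := (hC' (n - i)).2 (restrictCLM (Sum.inr : β → α ⊕ β) x)
    have b3 := (hD i).2 (restrictCLM (Sum.inl : α → α ⊕ β) x)
    have b4 := (hD' (n - i)).2 (restrictCLM (Sum.inr : β → α ⊕ β) x)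
    simp only [pow_zero, one_mul] at b3 b4
    -- In the sup norm the weight of the pair is the larger of the two weights, hence at most their
    -- sum; each summand is then absorbed by the decay of one factor while the other factor is
    -- merely bounded.
    have hx : ‖x‖ ^ k ≤ ‖restrictCLM (Sum.inl : α → α ⊕ β) x‖ ^ k
        + ‖restrictCLM (Sum.inr : β → α ⊕ β) x‖ ^ k := by
      refine (pow_le_pow_left₀ (norm_nonneg _) (norm_sum_pi_le x) k).trans ?_
      rcases max_cases ‖restrictCLM (Sum.inl : α → α ⊕ β) x‖
        ‖restrictCLM (Sum.inr : β → α ⊕ β) x‖ with h | h <;> rw [h.1]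
      · exact le_add_of_nonneg_right (by positivity)
      · exact le_add_of_nonneg_left (by positivity)
    set u := ‖restrictCLM (Sum.inl : α → α ⊕ β) x‖
    set v := ‖restrictCLM (Sum.inr : β → α ⊕ β) x‖
    set P := ‖iteratedFDeriv ℝ i f (restrictCLM (Sum.inl : α → α ⊕ β) x)‖
    set Q := ‖iteratedFDeriv ℝ (n - i) g (restrictCLM (Sum.inr : β → α ⊕ β) x)‖
    have hP : 0 ≤ P := norm_nonneg _
    have hQ : 0 ≤ Q := norm_nonneg _
    calc ‖x‖ ^ k * ((n.choose i : ℝ) * ‖iteratedFDeriv ℝ i (⇑f ∘ restrictCLM Sum.inl) x‖ *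
          ‖iteratedFDeriv ℝ (n - i) (⇑g ∘ restrictCLM Sum.inr) x‖)
        ≤ (u ^ k + v ^ k) * ((n.choose i : ℝ) * P * Q) := by
          gcongr
          exacts [a1, a2]
      _ = (n.choose i : ℝ) * ((u ^ k * P) * Q + P * (v ^ k * Q)) := by ring
      _ ≤ _ := by
        gcongr
        · exact (hC i).1.le
        · exact (hD i).1.le

theorem tensorS_apply (f : 𝓢(α → ℝ, ℂ)) (g : 𝓢(β → ℝ, ℂ)) (x : α ⊕ β → ℝ) :
    tensorS f g x = f (fun i => x (Sum.inl i)) * g (fun i => x (Sum.inr i)) := rfl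

end Tensor

/-! ## Exponentials of functions of temperate growth -/

section Exp

variable {E : Type*} [NormedAddCommGroup E] [NormedSpace ℝ E]

/-- The real iterated derivative is the complex one with scalars restricted, which preserves the
norm, and every complex derivative of exp is exp. -/
theorem norm_iteratedFDeriv_cexp (n : ℕ) (z : ℂ) :
    ‖iteratedFDeriv ℝ n Complex.exp z‖ = Real.exp z.re := by
  have h : ContDiffAt ℂ n Complex.exp z := Complex.contDiff_exp.contDiffAt
  have h2 := h.restrictScalars_iteratedFDeriv (𝕜 := ℝ)
  rw [← h2, Function.comp_apply, ContinuousMultilinearMap.norm_restrictScalars,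
    norm_iteratedFDeriv_eq_norm_iteratedDeriv]
  have h3 := congrFun (iteratedDeriv_cexp_const_mul n 1) z
  simp only [one_mul, one_pow] at h3
  rw [h3, Complex.norm_exp]

/-- By the Faà di Bruno estimate, the n-th derivative of exp ∘ f is exp(Re f) times polynomial
growth. With f purely imaginary this gives temperate growth, and with Re f ≤ -c|x|² it gives
Schwartz decay. -/
theorem Function.HasTemperateGrowth.norm_iteratedFDeriv_cexp_le {f : E → ℂ}
    (hf : f.HasTemperateGrowth) (n : ℕ) :
    ∃ (k : ℕ) (C : ℝ), 0 ≤ C ∧ ∀ x, ‖iteratedFDeriv ℝ n (fun x => Complex.exp (f x)) x‖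
      ≤ C * (1 + ‖x‖) ^ k * Real.exp (f x).re := by
  obtain ⟨k, C, hC, h⟩ := hf.norm_iteratedFDeriv_le_uniform n
  refine ⟨k * n, n.factorial * (C + 1) ^ n, by positivity, fun x => ?_⟩
  -- The composition estimate requires an i-th power on the right. Taking C + 1 instead of C makes
  -- the base at least 1, so its first power is below its i-th power.
  have hD : ∀ i : ℕ, 1 ≤ i → i ≤ n → ‖iteratedFDeriv ℝ i f x‖ ≤ ((C + 1) * (1 + ‖x‖) ^ k) ^ i := by
    intro i hi hin
    refine (h i hin x).trans ?_
    have h1 : 1 ≤ (C + 1) * (1 + ‖x‖) ^ k :=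
      one_le_mul_of_one_le_of_one_le (by linarith) (one_le_pow₀ (by linarith [norm_nonneg x]))
    refine le_trans ?_ (le_self_pow₀ h1 (by omega))
    gcongr
    linarith
  have := norm_iteratedFDeriv_comp_le (𝕜 := ℝ) (N := n) (g := Complex.exp) (f := f)
    Complex.contDiff_exp (hf.1.of_le (by exact_mod_cast le_top)) le_rfl x
    (fun i _ => (norm_iteratedFDeriv_cexp i (f x)).le) hD
  refine this.trans (le_of_eq ?_)
  rw [mul_pow, ← pow_mul]
  ring

theorem hasTemperateGrowth_cexp_I_mul {f : E → ℝ} (hf : f.HasTemperateGrowth) :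
    (fun x => Complex.exp (Complex.I * (f x : ℂ))).HasTemperateGrowth := by
  have hg : (fun x => Complex.I * (f x : ℂ)).HasTemperateGrowth := by
    have := Function.Complex.hasTemperateGrowth_ofReal.comp hf
    exact (Function.HasTemperateGrowth.const Complex.I).mul this
  refine ⟨Complex.contDiff_exp.comp hg.1, fun n => ?_⟩
  obtain ⟨k, C, -, h⟩ := hg.norm_iteratedFDeriv_cexp_le n
  refine ⟨k, C, fun x => (h x).trans ?_⟩
  simp

/-- From 1 + r ≤ exp r one gets (1 + r)^k ≤ exp(kr), and completing the square gives kr - cr² ≤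
k²/(4c). -/
theorem one_add_pow_mul_exp_neg_sq_le (k : ℕ) {c r : ℝ} (hc : 0 < c) (hr : 0 ≤ r) :
    (1 + r) ^ k * Real.exp (-(c * r ^ 2)) ≤ Real.exp (k ^ 2 / (4 * c)) := by
  have h1 : (1 + r) ^ k ≤ Real.exp (k * r) := by
    rw [Real.exp_nat_mul]
    exact pow_le_pow_left₀ (by positivity) (by linarith [Real.add_one_le_exp r]) k
  refine (mul_le_mul_of_nonneg_right h1 (Real.exp_nonneg _)).trans ?_
  rw [← Real.exp_add, Real.exp_le_exp, le_div_iff₀ (by positivity)]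
  nlinarith [sq_nonneg (2 * c * r - k)]

/-- `exp ∘ f` is a Schwartz function if `f` has temperate growth and `Re f ≤ -c |x|²`. -/
def expS (f : E → ℂ) (hf : f.HasTemperateGrowth) {c : ℝ} (hc : 0 < c)
    (hre : ∀ x, (f x).re ≤ -(c * ‖x‖ ^ 2)) : 𝓢(E, ℂ) where
  toFun x := Complex.exp (f x)
  smooth' := Complex.contDiff_exp.comp hf.1
  decay' k n := by
    obtain ⟨l, C, hC, h⟩ := hf.norm_iteratedFDeriv_cexp_le n
    refine ⟨C * Real.exp ((k + l : ℕ) ^ 2 / (4 * c)), fun x => ?_⟩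
    calc ‖x‖ ^ k * ‖iteratedFDeriv ℝ n (fun x => Complex.exp (f x)) x‖
        ≤ (1 + ‖x‖) ^ k * (C * (1 + ‖x‖) ^ l * Real.exp (-(c * ‖x‖ ^ 2))) := by
          gcongr
          · linarith
          · refine (h x).trans ?_
            gcongr
            exact hre x
      _ = C * ((1 + ‖x‖) ^ (k + l) * Real.exp (-(c * ‖x‖ ^ 2))) := by ring
      _ ≤ _ := by
        gcongr
        exact one_add_pow_mul_exp_neg_sq_le _ hc (norm_nonneg x)

end Exp

/-! ## Gaussians -/

section Gaussian

variable {κ : Type} [Fintype κ]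

/-- The exponent of the characteristic function of a Gaussian. -/
def gaussExponent (Γ : Matrix κ κ ℝ) (m w : κ → ℝ) : ℂ :=
  Complex.I * ((w ⬝ᵥ m : ℝ) : ℂ) + (-(1 / 2 * (w ⬝ᵥ (Γ *ᵥ w))) : ℝ)

theorem hasTemperateGrowth_coord (i : κ) : (fun w : κ → ℝ => w i).HasTemperateGrowth :=
  (ContinuousLinearMap.proj (R := ℝ) (φ := fun _ : κ => ℝ) i).hasTemperateGrowth

theorem hasTemperateGrowth_dot (p : κ → ℝ) : (fun w : κ → ℝ => w ⬝ᵥ p).HasTemperateGrowth :=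
  Function.HasTemperateGrowth.sum fun i _ =>
    (hasTemperateGrowth_coord i).mul (Function.HasTemperateGrowth.const _)

theorem hasTemperateGrowth_gaussExponent (Γ : Matrix κ κ ℝ) (m : κ → ℝ) :
    (gaussExponent Γ m).HasTemperateGrowth := by
  have h2 : (fun w : κ → ℝ => w ⬝ᵥ (Γ *ᵥ w)).HasTemperateGrowth :=
    Function.HasTemperateGrowth.sum fun i _ => (hasTemperateGrowth_coord i).mul
      (Function.HasTemperateGrowth.sum fun j _ =>
        (Function.HasTemperateGrowth.const _).mul (hasTemperateGrowth_coord j))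
  have h3 : (fun w : κ → ℝ => (-(1 / 2 * (w ⬝ᵥ (Γ *ᵥ w))) : ℝ)).HasTemperateGrowth :=
    ((Function.HasTemperateGrowth.const (1 / 2 : ℝ)).mul h2).neg
  exact ((Function.HasTemperateGrowth.const Complex.I).mul
    (Function.Complex.hasTemperateGrowth_ofReal.comp (hasTemperateGrowth_dot m))).add
    (Function.Complex.hasTemperateGrowth_ofReal.comp h3)

variable [DecidableEq κ]

open scoped MatrixOrder in
theorem Matrix.PosDef.exists_transpose_mul_self {Γ : Matrix κ κ ℝ} (hΓ : Γ.PosDef) :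
    ∃ B : Matrix κ κ ℝ, Γ = Bᵀ * B ∧ B.det ≠ 0 := by
  obtain ⟨B, hB⟩ := CStarAlgebra.nonneg_iff_eq_star_mul_self.1 hΓ.posSemidef.nonneg
  rw [star_eq_conjTranspose, conjTranspose_eq_transpose_of_trivial] at hB
  refine ⟨B, hB, fun h => ?_⟩
  have := hΓ.det_pos
  rw [hB, det_mul, h, mul_zero] at this
  exact this.false

/-- Writing Γ = BᵀB, the form is the squared Euclidean length of Bw, which dominates the squared sup
norm of Bw, and w is recovered from Bw by the bounded map B⁻¹. -/
theorem Matrix.PosDef.exists_le_dotProduct_mulVec {Γ : Matrix κ κ ℝ} (hΓ : Γ.PosDef) :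
    ∃ c : ℝ, 0 < c ∧ ∀ w : κ → ℝ, c * ‖w‖ ^ 2 ≤ w ⬝ᵥ (Γ *ᵥ w) := by
  obtain ⟨B, rfl, hB⟩ := hΓ.exists_transpose_mul_self
  have hunit : IsUnit B.det := isUnit_iff_ne_zero.2 hB
  set L : (κ → ℝ) →L[ℝ] (κ → ℝ) := LinearMap.toContinuousLinearMap (Matrix.toLin' B⁻¹) with hL
  -- The summand 1 keeps the constant positive when ‖L‖ = 0, that is, in dimension zero.
  refine ⟨((‖L‖ + 1) ^ 2)⁻¹, by positivity, fun w => ?_⟩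
  have h1 : ‖w‖ ≤ (‖L‖ + 1) * ‖B *ᵥ w‖ := by
    have : L (B *ᵥ w) = w := by
      simp [hL, mulVec_mulVec, nonsing_inv_mul B hunit]
    calc ‖w‖ = ‖L (B *ᵥ w)‖ := by rw [this]
      _ ≤ ‖L‖ * ‖B *ᵥ w‖ := L.le_opNorm _
      _ ≤ _ := by gcongr; linarith
  have h2 : ‖B *ᵥ w‖ ^ 2 ≤ w ⬝ᵥ ((Bᵀ * B) *ᵥ w) := by
    rw [← mulVec_mulVec, dotProduct_mulVec, vecMul_transpose]
    have hs : ‖B *ᵥ w‖ ≤ Real.sqrt ((B *ᵥ w) ⬝ᵥ (B *ᵥ w)) := by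
      rw [pi_norm_le_iff_of_nonneg (Real.sqrt_nonneg _)]
      intro i
      rw [Real.norm_eq_abs]
      refine Real.abs_le_sqrt ?_
      rw [sq]
      exact Finset.single_le_sum (f := fun i => (B *ᵥ w) i * (B *ᵥ w) i)
        (fun i _ => mul_self_nonneg _) (Finset.mem_univ i)
    have h0 : 0 ≤ (B *ᵥ w) ⬝ᵥ (B *ᵥ w) := Finset.sum_nonneg fun i _ => mul_self_nonneg _
    calc ‖B *ᵥ w‖ ^ 2 ≤ Real.sqrt ((B *ᵥ w) ⬝ᵥ (B *ᵥ w)) ^ 2 := by gcongr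
      _ = _ := Real.sq_sqrt h0
  rw [inv_mul_le_iff₀ (by positivity)]
  calc ‖w‖ ^ 2 ≤ ((‖L‖ + 1) * ‖B *ᵥ w‖) ^ 2 := by gcongr
    _ = (‖L‖ + 1) ^ 2 * ‖B *ᵥ w‖ ^ 2 := by ring
    _ ≤ _ := by gcongr

/-- The characteristic function of a Gaussian. -/
def gaussCharS {Γ : Matrix κ κ ℝ} (hΓ : Γ.PosDef) (m : κ → ℝ) : 𝓢(κ → ℝ, ℂ) :=
  expS (gaussExponent Γ m) (hasTemperateGrowth_gaussExponent Γ m)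
    (c := hΓ.exists_le_dotProduct_mulVec.choose / 2)
    (half_pos hΓ.exists_le_dotProduct_mulVec.choose_spec.1) fun w => by
      have := hΓ.exists_le_dotProduct_mulVec.choose_spec.2 w
      simp only [gaussExponent, Complex.add_re, Complex.I_mul_re, Complex.ofReal_im,
        Complex.ofReal_re]
      linarith

theorem gaussCharS_apply {Γ : Matrix κ κ ℝ} (hΓ : Γ.PosDef) (m w : κ → ℝ) :
    gaussCharS hΓ m w = Complex.exp (gaussExponent Γ m w) := rfl

theorem integral_comp_mulVec {B : Matrix κ κ ℝ} (hB : B.det ≠ 0) (g : (κ → ℝ) → ℂ) :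
    ∫ y : κ → ℝ, g (B *ᵥ y) = ((|B.det|⁻¹ : ℝ) : ℂ) * ∫ w, g w := by
  have h := Real.map_matrix_volume_pi_eq_smul_volume_pi hB
  have hemb : MeasurableEmbedding (Matrix.toLin' B) := by
    have : IsUnit B.det := isUnit_iff_ne_zero.2 hB
    let e := (Matrix.toLinearEquiv' B (B.invertibleOfIsUnitDet this)).toContinuousLinearEquiv
    exact e.toHomeomorph.measurableEmbedding
  have h2 := hemb.integral_map (μ := volume) g
  simp only [Matrix.toLin'_apply] at h2
  rw [← h2, h, integral_smul_measure, ENNReal.toReal_ofReal (abs_nonneg _), abs_inv]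
  exact Complex.real_smul

/-- With Γ = BᵀB, the substitution v = By turns the integral into a standard Gaussian one with
linear term i s·v, where s = B⁻ᵀ(m - z). Its value contains exp(-|s|²/2), and |s|² = (z - m)·Γ⁻¹(z -
m), while the Jacobian is |det B| = √det Γ. -/
theorem piFT_gaussCharS {Γ : Matrix κ κ ℝ} (hΓ : Γ.PosDef) (m z : κ → ℝ) :
    piFT (gaussCharS hΓ m) z
      = ((2 * Real.pi : ℝ) : ℂ) ^ (Fintype.card κ / 2 : ℂ) * gaussianSymbol Γ m z := by
  obtain ⟨B, hBΓ, hB⟩ := hΓ.exists_transpose_mul_self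
  have hunit : IsUnit B.det := isUnit_iff_ne_zero.2 hB
  set s : κ → ℝ := B⁻¹ᵀ *ᵥ (m - z) with hs
  have hg : ∀ y : κ → ℝ, Complex.exp (-Complex.I * ((y ⬝ᵥ z : ℝ) : ℂ)) * gaussCharS hΓ m y
      = (fun v : κ → ℝ => Complex.exp (-(1 / 2 : ℂ) * ∑ i, (v i : ℂ) ^ 2
        + ∑ i, (Complex.I * (s i : ℂ)) * v i)) (B *ᵥ y) := by
    intro y
    rw [gaussCharS_apply, ← Complex.exp_add]
    simp only [gaussExponent]
    congr 1
    have e1 : y ⬝ᵥ (Γ *ᵥ y) = ∑ i, (B *ᵥ y) i ^ 2 := by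
      rw [hBΓ, ← mulVec_mulVec, dotProduct_mulVec, vecMul_transpose]
      simp [dotProduct, sq]
    have e2 : ∑ i, s i * (B *ᵥ y) i = y ⬝ᵥ (m - z) := by
      change s ⬝ᵥ (B *ᵥ y) = _
      rw [hs, dotProduct_mulVec, ← mulVec_transpose, mulVec_mulVec, ← transpose_mul,
        nonsing_inv_mul B hunit, transpose_one, one_mulVec, dotProduct_comm]
    have e3 : ∑ i, (Complex.I * (s i : ℂ)) * ((B *ᵥ y) i : ℂ)
        = Complex.I * ((y ⬝ᵥ (m - z) : ℝ) : ℂ) := by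
      rw [← e2]
      push_cast
      rw [Finset.mul_sum]
      exact Finset.sum_congr rfl fun i _ => by ring
    rw [e1, e3, dotProduct_sub]
    push_cast
    ring
  rw [piFT]
  refine ((integral_congr_ae (.of_forall hg)).trans (integral_comp_mulVec hB
    (fun v : κ → ℝ => Complex.exp (-(1 / 2 : ℂ) * ∑ i, (v i : ℂ) ^ 2
        + ∑ i, (Complex.I * (s i : ℂ)) * v i)))).trans ?_
  rw [GaussianFourier.integral_cexp_neg_mul_sum_add (by norm_num)]
  have hdet : Real.sqrt Γ.det = |B.det| := by
    rw [hBΓ, det_mul, det_transpose, ← sq, Real.sqrt_sq_eq_abs]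
  have hss : (∑ i, (Complex.I * (s i : ℂ)) ^ 2) / (4 * (1 / 2))
      = ((-(1 / 2) * ((z - m) ⬝ᵥ (Γ⁻¹ *ᵥ (z - m))) : ℝ) : ℂ) := by
    have e : (z - m) ⬝ᵥ (Γ⁻¹ *ᵥ (z - m)) = ∑ i, s i ^ 2 := by
      have : ∑ i, s i ^ 2 = s ⬝ᵥ s := by simp [dotProduct, sq]
      have hinv : Γ⁻¹ = B⁻¹ * B⁻¹ᵀ := by
        rw [hBΓ, Matrix.mul_inv_rev, transpose_nonsing_inv]
      rw [this, hs, hinv, ← mulVec_mulVec, dotProduct_mulVec (z - m), ← mulVec_transpose,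
        ← neg_sub z m, mulVec_neg, neg_dotProduct, dotProduct_neg, neg_neg]
    rw [e]
    push_cast
    simp only [mul_pow, Complex.I_sq]
    rw [← Finset.mul_sum]
    ring
  rw [hss, gaussianSymbol, hdet]
  push_cast
  rw [show (Real.pi : ℂ) / (1 / 2) = 2 * Real.pi by ring]
  ring

end Gaussian

/-! ## Weyl operators -/

section Weyl

variable {ι : Type} [Fintype ι]

/-- The component of `Y` paired with the positions. -/
abbrev cl (Y : Phase ι) : Conf ι := restrictCLM Sum.inl Y

/-- The component of `Y` paired with the momenta. -/
abbrev cr (Y : Phase ι) : Conf ι := restrictCLM Sum.inr Y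

/-- The phase of the Weyl operator `exp(i Y·X̂)`. -/
def weylPhase (Y : Phase ι) (x : Conf ι) : ℝ := x ⬝ᵥ cl Y + 1 / 2 * (cl Y ⬝ᵥ cr Y)

/-- The Weyl operator `exp(i Y·X̂)` on functions. -/
def weylFun (Y : Phase ι) (f : Conf ι → ℂ) (x : Conf ι) : ℂ :=
  Complex.exp (Complex.I * (weylPhase Y x : ℂ)) * f (x + cr Y)

theorem norm_weylFun (Y : Phase ι) (f : Conf ι → ℂ) (x : Conf ι) :
    ‖weylFun Y f x‖ = ‖f (x + cr Y)‖ := by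
  rw [weylFun, norm_mul, norm_cexp_I_mul_ofReal, one_mul]

theorem continuous_weylPhase : Continuous fun p : Phase ι × Conf ι => weylPhase p.1 p.2 := by
  unfold weylPhase
  simp only [dotProduct, restrictCLM_apply]
  fun_prop

theorem hasTemperateGrowth_weylPhase (Y : Phase ι) : (weylPhase Y).HasTemperateGrowth :=
  (hasTemperateGrowth_dot (cl Y)).add (Function.HasTemperateGrowth.const _)

/-- The Weyl operator on Schwartz functions. -/
def weylS (Y : Phase ι) : 𝓢(Conf ι, ℂ) →L[ℂ] 𝓢(Conf ι, ℂ) :=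
  (SchwartzMap.smulLeftCLM ℂ fun x => Complex.exp (Complex.I * (weylPhase Y x : ℂ))) ∘L
    (SchwartzMap.compSubConstCLM ℂ (-cr Y))

theorem weylS_apply (Y : Phase ι) (f : 𝓢(Conf ι, ℂ)) (x : Conf ι) :
    weylS Y f x = weylFun Y f x := by
  simp only [weylS, ContinuousLinearMap.comp_apply]
  rw [SchwartzMap.smulLeftCLM_apply_apply
    (hasTemperateGrowth_cexp_I_mul (hasTemperateGrowth_weylPhase Y))]
  simp [weylFun]

theorem measurePreserving_add_cr (Y : Phase ι) :
    MeasurePreserving (fun x : Conf ι => x + cr Y) volume volume :=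
  measurePreserving_add_right volume _

theorem aestronglyMeasurable_weylFun (Y : Phase ι) {f : Conf ι → ℂ}
    (hf : AEStronglyMeasurable f volume) : AEStronglyMeasurable (weylFun Y f) volume := by
  refine AEStronglyMeasurable.mul ?_ (hf.comp_measurePreserving (measurePreserving_add_cr Y))
  have : Continuous (weylPhase Y) := (hasTemperateGrowth_weylPhase Y).1.continuous
  exact (by fun_prop : Continuous fun x =>
    Complex.exp (Complex.I * (weylPhase Y x : ℂ))).aestronglyMeasurable

theorem eLpNorm_weylFun (Y : Phase ι) {f : Conf ι → ℂ} (hf : AEStronglyMeasurable f volume) :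
    eLpNorm (weylFun Y f) 2 volume = eLpNorm f 2 volume := by
  rw [eLpNorm_congr_norm_ae (g := f ∘ fun x => x + cr Y) (.of_forall fun x => norm_weylFun Y f x)]
  exact eLpNorm_comp_measurePreserving hf (measurePreserving_add_cr Y)

theorem memLp_weylFun (Y : Phase ι) {f : Conf ι → ℂ} (hf : MemLp f 2 volume) :
    MemLp (weylFun Y f) 2 volume :=
  ⟨aestronglyMeasurable_weylFun Y hf.1, by rw [eLpNorm_weylFun Y hf.1]; exact hf.2⟩

theorem weylFun_ae_congr (Y : Phase ι) {f g : Conf ι → ℂ} (h : f =ᵐ[volume] g) :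
    weylFun Y f =ᵐ[volume] weylFun Y g := by
  filter_upwards [(measurePreserving_add_cr Y).quasiMeasurePreserving.ae_eq_comp h] with x hx
  simp only [Function.comp_apply] at hx
  simp only [weylFun, hx]

/-- The Weyl operator as an isometry of `L²`. -/
def weylIsom (Y : Phase ι) : L2 ι →ₗᵢ[ℂ] L2 ι where
  toFun f := (memLp_weylFun Y (Lp.memLp f)).toLp _
  map_add' f g := by
    rw [← MemLp.toLp_add, MemLp.toLp_eq_toLp_iff]
    refine (weylFun_ae_congr Y (Lp.coeFn_add f g)).trans (.of_forall fun x => ?_)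
    simp [weylFun, mul_add]
  map_smul' c f := by
    rw [RingHom.id_apply, ← MemLp.toLp_const_smul, MemLp.toLp_eq_toLp_iff]
    refine (weylFun_ae_congr Y (Lp.coeFn_smul c f)).trans (.of_forall fun x => ?_)
    simp only [weylFun, Pi.smul_apply, smul_eq_mul]
    ring
  norm_map' f := by
    simp only [LinearMap.coe_mk, AddHom.coe_mk]
    rw [Lp.norm_toLp, eLpNorm_weylFun Y (Lp.memLp f).1, Lp.norm_def]

/-- The Weyl operator as a bounded operator on `L²`. -/
def weylL2 (Y : Phase ι) : L2 ι →L[ℂ] L2 ι := (weylIsom Y).toContinuousLinearMap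

theorem coeFn_weylL2 (Y : Phase ι) (f : L2 ι) : weylL2 Y f =ᵐ[volume] weylFun Y f :=
  MemLp.coeFn_toLp (memLp_weylFun Y (Lp.memLp f))

theorem norm_weylL2 (Y : Phase ι) (f : L2 ι) : ‖weylL2 Y f‖ = ‖f‖ := (weylIsom Y).norm_map f

theorem weylL2_toLp (Y : Phase ι) (f : 𝓢(Conf ι, ℂ)) :
    weylL2 Y (f.toLp 2 volume) = (weylS Y f).toLp 2 volume := by
  refine Lp.ext ?_
  refine (coeFn_weylL2 Y _).trans ?_
  refine (weylFun_ae_congr Y (f.coeFn_toLp 2 volume)).trans ?_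
  refine Filter.EventuallyEq.trans ?_ ((weylS Y f).coeFn_toLp 2 volume).symm
  exact .of_forall fun x => (weylS_apply Y f x).symm

/-- The adjoint of W(Y) is W(-Y): translate the integration variable, and note that the half-term ½
p·q in the phase is exactly what makes the phases at Y and -Y match. -/
theorem inner_weylL2_left (Y : Phase ι) (f g : L2 ι) :
    inner ℂ (weylL2 Y f) g = inner ℂ f (weylL2 (-Y) g) := by
  rw [L2.inner_def, L2.inner_def]
  have h1 : ∫ x, inner ℂ (weylL2 Y f x) (g x) = ∫ x, inner ℂ (weylFun Y f x) (g x) := by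
    refine integral_congr_ae ?_
    filter_upwards [coeFn_weylL2 Y f] with x hx
    rw [hx]
  have h2 : ∫ x, inner ℂ (f x) (weylL2 (-Y) g x) = ∫ x, inner ℂ (f x) (weylFun (-Y) g x) := by
    refine integral_congr_ae ?_
    filter_upwards [coeFn_weylL2 (-Y) g] with x hx
    rw [hx]
  rw [h1, h2, ← integral_add_right_eq_self (fun x => inner ℂ (f x) (weylFun (-Y) g x)) (cr Y)]
  refine integral_congr_ae (.of_forall fun x => ?_)
  have hc : x + cr Y + cr (-Y) = x := by simp [cr]
  simp only [weylFun, hc, RCLike.inner_apply, map_mul, ← Complex.exp_conj, Complex.conj_I,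
    Complex.conj_ofReal]
  have : Complex.I * (weylPhase (-Y) (x + cr Y) : ℂ) = -Complex.I * (weylPhase Y x : ℂ) := by
    have : weylPhase (-Y) (x + cr Y) = - weylPhase Y x := by
      simp only [weylPhase, map_neg, dotProduct_neg, add_dotProduct, neg_dotProduct]
      rw [dotProduct_comm (cr Y) (cl Y)]
      ring
    rw [this]
    push_cast
    ring
  rw [this]
  ring

theorem inner_weylL2_right (Y : Phase ι) (f g : L2 ι) :
    inner ℂ f (weylL2 Y g) = inner ℂ (weylL2 (-Y) f) g := by
  rw [inner_weylL2_left, neg_neg]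

/-- Conjugation of a Weyl operator by another one. -/
theorem weylS_conj (Z Y : Phase ι) (f : 𝓢(Conf ι, ℂ)) :
    weylS (-Z) (weylS (-Y) (weylS Z f))
      = Complex.exp (Complex.I * ((cl Y ⬝ᵥ cr Z - cr Y ⬝ᵥ cl Z : ℝ) : ℂ)) • weylS (-Y) f := by
  ext x
  simp only [weylS_apply, weylFun, _root_.smul_apply, smul_eq_mul]
  rw [← mul_assoc, ← mul_assoc, ← mul_assoc, ← Complex.exp_add, ← Complex.exp_add,
    ← Complex.exp_add]
  have hc : x + cr (-Z) + cr (-Y) + cr Z = x + cr (-Y) := by simp [cr]; abel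
  rw [hc]
  congr 2
  rw [← mul_add, ← mul_add, ← mul_add]
  congr 1
  rw [← Complex.ofReal_add, ← Complex.ofReal_add, ← Complex.ofReal_add]
  congr 1
  simp only [weylPhase, map_neg, dotProduct_neg, add_dotProduct, neg_dotProduct]
  rw [dotProduct_comm (cr Z) (cl Z), dotProduct_comm (cr Z) (cl Y)]
  ring

/-! ### Strong continuity -/

theorem inner_toLp_left (φ : 𝓢(Conf ι, ℂ)) (f : L2 ι) :
    inner ℂ (φ.toLp 2 volume) f = ∫ x, f x * (starRingEnd ℂ) (φ x) := by
  rw [L2.inner_def]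
  refine integral_congr_ae ?_
  filter_upwards [φ.coeFn_toLp 2 volume] with x hx
  rw [hx, RCLike.inner_apply]

theorem inner_toLp_toLp (φ ψ : 𝓢(Conf ι, ℂ)) :
    inner ℂ (φ.toLp 2 (volume : Measure (Conf ι))) (ψ.toLp 2 volume)
      = ∫ x, ψ x * (starRingEnd ℂ) (φ x) := by
  rw [inner_toLp_left]
  refine integral_congr_ae ?_
  filter_upwards [ψ.coeFn_toLp 2 volume] with x hx
  rw [hx]

theorem inner_toLp_weylL2 (φ ψ : 𝓢(Conf ι, ℂ)) (Y : Phase ι) :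
    inner ℂ (φ.toLp 2 volume) (weylL2 Y (ψ.toLp 2 volume))
      = ∫ x, weylFun Y ψ x * (starRingEnd ℂ) (φ x) := by
  rw [weylL2_toLp, inner_toLp_toLp]
  simp only [weylS_apply]

theorem continuous_inner_weylL2_schwartz (φ ψ : 𝓢(Conf ι, ℂ)) :
    Continuous fun Y : Phase ι =>
      inner ℂ (φ.toLp 2 volume) (weylL2 Y (ψ.toLp 2 volume)) := by
  simp only [inner_toLp_weylL2]
  refine continuous_of_dominated
    (bound := fun x => SchwartzMap.seminorm ℝ 0 0 ψ * ‖φ x‖) (fun Y => ?_) (fun Y => ?_) ?_ ?_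
  · exact (aestronglyMeasurable_weylFun Y ψ.continuous.aestronglyMeasurable).mul
      (Complex.continuous_conj.comp φ.continuous).aestronglyMeasurable
  · refine .of_forall fun x => ?_
    rw [norm_mul, norm_weylFun, RCLike.norm_conj]
    exact mul_le_mul_of_nonneg_right (ψ.norm_le_seminorm ℝ _) (norm_nonneg _)
  · exact φ.integrable.norm.const_mul _
  · refine .of_forall fun x => ?_
    unfold weylFun
    have h1 : Continuous fun Y : Phase ι => weylPhase Y x :=
      continuous_weylPhase.comp (by fun_prop : Continuous fun Y : Phase ι => (Y, x))
    have h2 : Continuous fun Y : Phase ι => ψ (x + cr Y) := ψ.continuous.comp (by fun_prop)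
    fun_prop

/-- Weak continuity together with constancy of the norm gives strong continuity, by expanding ‖W(Y)ψ
- W(Y₀)ψ‖². -/
theorem continuous_weylL2_schwartz (ψ : 𝓢(Conf ι, ℂ)) :
    Continuous fun Y : Phase ι => weylL2 Y (ψ.toLp 2 volume) := by
  rw [continuous_iff_continuousAt]
  intro Y₀
  rw [ContinuousAt, tendsto_iff_norm_sub_tendsto_zero]
  have h1 : ∀ Y : Phase ι, ‖weylL2 Y (ψ.toLp 2 volume) - weylL2 Y₀ (ψ.toLp 2 volume)‖ ^ 2
      = 2 * ‖ψ.toLp 2 volume‖ ^ 2 - 2 * RCLike.re (inner ℂ ((weylS Y₀ ψ).toLp 2 volume)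
        (weylL2 Y (ψ.toLp 2 volume))) := by
    intro Y
    rw [@norm_sub_sq ℂ, norm_weylL2, norm_weylL2, ← weylL2_toLp, ← inner_re_symm]
    ring
  have h2 : Filter.Tendsto (fun Y : Phase ι =>
      ‖weylL2 Y (ψ.toLp 2 volume) - weylL2 Y₀ (ψ.toLp 2 volume)‖ ^ 2) (nhds Y₀) (nhds 0) := by
    have h3 := ((continuous_inner_weylL2_schwartz (weylS Y₀ ψ) ψ).tendsto Y₀)
    have h4 := (((RCLike.continuous_re.tendsto _).comp h3).const_mul 2).const_sub
      (2 * ‖ψ.toLp 2 volume‖ ^ 2)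
    have h5 := h1 Y₀
    rw [sub_self, norm_zero] at h5
    rw [← h5] at h4
    refine (h4.congr fun Y => (h1 Y).symm).trans_eq ?_
    simp
  have h6 := h2.sqrt
  simpa using h6

theorem dense_toLp : DenseRange fun ψ : 𝓢(Conf ι, ℂ) => ψ.toLp 2 (volume : Measure (Conf ι)) :=
  SchwartzMap.denseRange_toLpCLM (by simp)

/-- The Weyl operators are isometries, so approximating f by Schwartz functions approximates the
orbit uniformly in Y. -/
theorem continuous_weylL2 (f : L2 ι) : Continuous fun Y : Phase ι => weylL2 Y f := by
  refine continuous_of_uniform_approx_of_continuous fun u hu => ?_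
  obtain ⟨ε, hε, h⟩ := Metric.mem_uniformity_dist.1 hu
  obtain ⟨ψ, hψ⟩ := dense_toLp.exists_dist_lt f hε
  refine ⟨fun Y => weylL2 Y (ψ.toLp 2 volume), continuous_weylL2_schwartz ψ, fun Y => h ?_⟩
  rw [dist_eq_norm, ← map_sub, norm_weylL2, ← dist_eq_norm]
  exact hψ

end Weyl

/-! ## Canonical operators -/

section Canonical

variable {ι : Type} [Fintype ι]

theorem inner_positionOp (k : ι) (φ ψ : 𝓢(Conf ι, ℂ)) :
    inner ℂ ((positionOp k φ).toLp 2 (volume : Measure (Conf ι))) (ψ.toLp 2 volume)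
      = inner ℂ (φ.toLp 2 volume) ((positionOp k ψ).toLp 2 volume) := by
  rw [inner_toLp_toLp, inner_toLp_toLp]
  refine integral_congr_ae (.of_forall fun x => ?_)
  simp only [positionOp_apply, map_mul, Complex.conj_ofReal]
  ring

theorem positionOp_weylS (k : ι) (Y : Phase ι) (f : 𝓢(Conf ι, ℂ)) :
    positionOp k (weylS Y f) = weylS Y (positionOp k f - (Y (Sum.inr k) : ℂ) • f) := by
  ext x
  simp only [positionOp_apply, weylS_apply, weylFun, _root_.sub_apply, _root_.smul_apply,
    smul_eq_mul, Pi.add_apply, restrictCLM_apply]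
  push_cast
  ring

theorem hasDerivAt_weylPhase_line (Y : Phase ι) (x m : Conf ι) :
    HasDerivAt (fun t : ℝ => weylPhase Y (x + t • m)) (m ⬝ᵥ cl Y) 0 := by
  simp only [weylPhase, add_dotProduct, smul_dotProduct, smul_eq_mul]
  have := (((hasDerivAt_id (0 : ℝ)).mul_const (m ⬝ᵥ cl Y)).const_add (x ⬝ᵥ cl Y)).add_const
    (1 / 2 * (cl Y ⬝ᵥ cr Y))
  simpa using this

theorem SchwartzMap.hasDerivAt_line (f : 𝓢(Conf ι, ℂ)) (x m : Conf ι) :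
    HasDerivAt (fun t : ℝ => f (x + t • m)) ((∂_{m} f) x) 0 := by
  have h := (f.hasFDerivAt x).hasLineDerivAt m
  rwa [← SchwartzMap.lineDerivOp_apply_eq_fderiv] at h

/-- The matrix coefficient `⟨φ, W(-Y) ψ⟩`. -/
def weylCoeff (φ ψ : 𝓢(Conf ι, ℂ)) (Y : Phase ι) : ℂ :=
  inner ℂ (φ.toLp 2 volume) (weylL2 (-Y) (ψ.toLp 2 volume))

theorem continuous_weylCoeff (φ ψ : 𝓢(Conf ι, ℂ)) : Continuous (weylCoeff φ ψ) :=
  (continuous_inner_weylL2_schwartz φ ψ).comp continuous_neg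

theorem norm_weylCoeff_le (φ ψ : 𝓢(Conf ι, ℂ)) (Y : Phase ι) :
    ‖weylCoeff φ ψ Y‖ ≤ ‖φ.toLp 2 (volume : Measure (Conf ι))‖ * ‖ψ.toLp 2 (volume : Measure (Conf ι))‖ := by
  refine (norm_inner_le_norm _ _).trans ?_
  rw [norm_weylL2]

variable [DecidableEq ι]

theorem inner_momentumOp (k : ι) (φ ψ : 𝓢(Conf ι, ℂ)) :
    inner ℂ ((momentumOp k φ).toLp 2 (volume : Measure (Conf ι))) (ψ.toLp 2 volume)
      = inner ℂ (φ.toLp 2 volume) ((momentumOp k ψ).toLp 2 volume) := by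
  rw [inner_toLp_toLp, inner_toLp_toLp]
  let L : ℂ →L[ℝ] ℂ →L[ℝ] ℂ := (ContinuousLinearMap.mul ℝ ℂ).comp
    (Complex.conjCLE : ℂ →L[ℝ] ℂ)
  have h := SchwartzMap.integral_bilinear_lineDerivOp_right_eq_neg_left φ ψ
    L (Pi.single k 1 : Conf ι) (μ := volume)
  have hL : ∀ a b : ℂ, L a b = (starRingEnd ℂ) a * b := fun a b => rfl
  simp only [hL] at h
  have e1 : ∀ x, ψ x * (starRingEnd ℂ) (momentumOp k φ x)
      = Complex.I * ((starRingEnd ℂ) ((∂_{(Pi.single k 1 : Conf ι)} φ) x) * ψ x) := by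
    intro x
    simp only [momentumOp, _root_.smul_apply, smul_eq_mul, map_mul, map_neg, Complex.conj_I]
    ring
  have e2 : ∀ x, momentumOp k ψ x * (starRingEnd ℂ) (φ x)
      = -Complex.I * ((starRingEnd ℂ) (φ x) * (∂_{(Pi.single k 1 : Conf ι)} ψ) x) := by
    intro x
    simp only [momentumOp, _root_.smul_apply, smul_eq_mul]
    ring
  rw [integral_congr_ae (.of_forall e1), integral_congr_ae (.of_forall e2), integral_const_mul,
    integral_const_mul, h]
  ring

/-- The operators `X̂ = (x̂, p̂)`. -/
def canOp : PIdx ι → 𝓢(Conf ι, ℂ) → 𝓢(Conf ι, ℂ)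
  | Sum.inl k => positionOp k
  | Sum.inr k => momentumOp k

theorem inner_canOp (j : PIdx ι) (φ ψ : 𝓢(Conf ι, ℂ)) :
    inner ℂ ((canOp j φ).toLp 2 (volume : Measure (Conf ι))) (ψ.toLp 2 volume)
      = inner ℂ (φ.toLp 2 volume) ((canOp j ψ).toLp 2 volume) := by
  rcases j with k | k
  exacts [inner_positionOp k φ ψ, inner_momentumOp k φ ψ]

/-- `canOp` as a linear map. -/
def canOpₗ (j : PIdx ι) : 𝓢(Conf ι, ℂ) →ₗ[ℂ] 𝓢(Conf ι, ℂ) where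
  toFun := canOp j
  map_add' f g := by
    rcases j with k | k
    · simp only [canOp, positionOp, map_add]
    · simp only [canOp, momentumOp, LineDeriv.lineDerivOp_add, smul_add]
  map_smul' c f := by
    rcases j with k | k
    · ext x
      simp only [canOp, positionOp_apply, _root_.smul_apply, smul_eq_mul, RingHom.id_apply]
      ring
    · simp only [canOp, momentumOp, LineDeriv.lineDerivOp_smul, RingHom.id_apply]
      exact smul_comm _ _ _

theorem canOp_sub (j : PIdx ι) (f g : 𝓢(Conf ι, ℂ)) : canOp j (f - g) = canOp j f - canOp j g :=
  map_sub (canOpₗ j) f g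

theorem canOp_smul (j : PIdx ι) (c : ℂ) (f : 𝓢(Conf ι, ℂ)) : canOp j (c • f) = c • canOp j f :=
  map_smul (canOpₗ j) c f

theorem momentumOp_weylS (k : ι) (Y : Phase ι) (f : 𝓢(Conf ι, ℂ)) :
    momentumOp k (weylS Y f) = weylS Y (momentumOp k f + (Y (Sum.inl k) : ℂ) • f) := by
  ext x
  set m : Conf ι := Pi.single k 1 with hm
  have h1 : HasDerivAt (fun t : ℝ => weylS Y f (x + t • m)) ((∂_{m} (weylS Y f)) x) 0 :=
    SchwartzMap.hasDerivAt_line _ _ _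
  have h2 := ((hasDerivAt_weylPhase_line Y x m).ofReal_comp.const_mul Complex.I).cexp.mul
    (SchwartzMap.hasDerivAt_line f (x + cr Y) m)
  have h3 : (fun t : ℝ => weylS Y f (x + t • m)) = (fun t : ℝ =>
      Complex.exp (Complex.I * (weylPhase Y (x + t • m) : ℂ)) * f (x + cr Y + t • m)) := by
    ext t
    rw [weylS_apply, weylFun, add_right_comm]
  rw [h3] at h1
  have h4 := h1.unique h2
  have hmd : m ⬝ᵥ cl Y = Y (Sum.inl k) := by simp [hm]
  simp only [momentumOp, weylS_apply, weylFun, _root_.add_apply, _root_.smul_apply, smul_eq_mul]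
  rw [h4, hmd]
  simp only [zero_smul, add_zero]
  linear_combination (-Complex.exp (Complex.I * ↑(weylPhase Y x)) * ↑(Y (Sum.inl k)) *
    f (x + cr Y)) * Complex.I_sq

theorem sympJ_mulVec_inl (Y : Phase ι) (k : ι) : (sympJ ι *ᵥ Y) (Sum.inl k) = Y (Sum.inr k) := by
  simp [sympJ, mulVec, dotProduct, Matrix.one_apply]

theorem sympJ_mulVec_inr (Y : Phase ι) (k : ι) : (sympJ ι *ᵥ Y) (Sum.inr k) = -Y (Sum.inl k) := by
  simp [sympJ, mulVec, dotProduct, Matrix.one_apply]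

/-- The canonical commutation relations in integrated form: conjugation by W(Y) shifts the vector X̂
by -JY. Both the decay of matrix coefficients and the evolution of Weyl operators follow from it. -/
theorem canOp_weylS (j : PIdx ι) (Y : Phase ι) (f : 𝓢(Conf ι, ℂ)) :
    canOp j (weylS Y f) = weylS Y (canOp j f - (((sympJ ι *ᵥ Y) j : ℝ) : ℂ) • f) := by
  rcases j with k | k
  · rw [sympJ_mulVec_inl]
    exact positionOp_weylS k Y f
  · rw [sympJ_mulVec_inr]
    simp only [canOp, momentumOp_weylS]
    congr 1
    simp

/-! ### Matrix coefficients of Weyl operators -/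

/-- Multiplication by a coordinate of JY is traded for canonical operators acting on the test
functions, which remain Schwartz. Iterating this gives rapid decay of the coefficient. -/
theorem sympJ_mul_weylCoeff (j : PIdx ι) (φ ψ : 𝓢(Conf ι, ℂ)) (Y : Phase ι) :
    (((sympJ ι *ᵥ Y) j : ℝ) : ℂ) * weylCoeff φ ψ Y
      = weylCoeff (canOp j φ) ψ Y - weylCoeff φ (canOp j ψ) Y := by
  have h := canOp_weylS j (-Y) ψ
  simp only [weylCoeff, weylL2_toLp]
  rw [inner_canOp, h, mulVec_neg, map_sub, map_smul]
  change _ = inner ℂ _ ((SchwartzMap.toLpCLM ℂ ℂ 2 volume) (_ - _)) - _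
  rw [map_sub, map_smul, inner_sub_right, inner_smul_right]
  simp

theorem norm_le_sum_sympJ (Y : Phase ι) : ‖Y‖ ≤ ∑ j, |(sympJ ι *ᵥ Y) j| := by
  rw [pi_norm_le_iff_of_nonneg (Finset.sum_nonneg fun _ _ => abs_nonneg _)]
  rintro (k | k)
  · refine le_trans ?_ (Finset.single_le_sum (f := fun j => |(sympJ ι *ᵥ Y) j|)
      (fun _ _ => abs_nonneg _) (Finset.mem_univ (Sum.inr k)))
    simp only [sympJ_mulVec_inr, abs_neg, Real.norm_eq_abs, le_refl]
  · refine le_trans ?_ (Finset.single_le_sum (f := fun j => |(sympJ ι *ᵥ Y) j|)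
      (fun _ _ => abs_nonneg _) (Finset.mem_univ (Sum.inl k)))
    simp only [sympJ_mulVec_inl, Real.norm_eq_abs, le_refl]

theorem exists_norm_pow_mul_weylCoeff_le (k : ℕ) :
    ∀ φ ψ : 𝓢(Conf ι, ℂ), ∃ C : ℝ, ∀ Y, ‖Y‖ ^ k * ‖weylCoeff φ ψ Y‖ ≤ C := by
  induction k with
  | zero =>
    intro φ ψ
    exact ⟨_, fun Y => by simpa using norm_weylCoeff_le φ ψ Y⟩
  | succ k ih =>
    intro φ ψ
    choose C hC using fun j => ih (canOp j φ) ψ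
    choose D hD using fun j => ih φ (canOp j ψ)
    refine ⟨∑ j, (C j + D j), fun Y => ?_⟩
    calc ‖Y‖ ^ (k + 1) * ‖weylCoeff φ ψ Y‖ = ‖Y‖ ^ k * (‖Y‖ * ‖weylCoeff φ ψ Y‖) := by ring
      _ ≤ ‖Y‖ ^ k * ((∑ j, |(sympJ ι *ᵥ Y) j|) * ‖weylCoeff φ ψ Y‖) := by
        gcongr
        exact norm_le_sum_sympJ Y
      _ = ∑ j, ‖Y‖ ^ k * ‖weylCoeff (canOp j φ) ψ Y - weylCoeff φ (canOp j ψ) Y‖ := by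
        rw [Finset.sum_mul, Finset.mul_sum]
        refine Finset.sum_congr rfl fun j _ => ?_
        rw [← sympJ_mul_weylCoeff, norm_mul, Complex.norm_real, Real.norm_eq_abs]
      _ ≤ _ := by
        refine Finset.sum_le_sum fun j _ => ?_
        refine (mul_le_mul_of_nonneg_left (norm_sub_le _ _) (by positivity)).trans ?_
        rw [mul_add]
        exact add_le_add (hC j Y) (hD j Y)

end Canonical

/-- Rapid decay beyond the integrable power of the phase-space measure. This is what makes the Moyal
integrals against merely bounded characteristic functions absolutely convergent. -/
theorem integrable_weylCoeff {ι : Type} [Fintype ι] (φ ψ : 𝓢(Conf ι, ℂ)) : Integrable (weylCoeff φ ψ) := by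
  classical
  obtain ⟨C₁, h₁⟩ := exists_norm_pow_mul_weylCoeff_le 0 φ ψ
  obtain ⟨C₂, h₂⟩ := exists_norm_pow_mul_weylCoeff_le
    (0 + (volume : Measure (Phase ι)).integrablePower) φ ψ
  have h := integrable_of_le_of_pow_mul_le (μ := (volume : Measure (Phase ι))) (k := 0)
    (by simpa using h₁) h₂ (continuous_weylCoeff φ ψ).aestronglyMeasurable
  simp only [pow_zero, one_mul] at h
  exact (integrable_norm_iff (continuous_weylCoeff φ ψ).aestronglyMeasurable).1 h

/-! ## Integration over products of coordinate spaces -/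

section SumPi

variable {α β : Type}

@[simp] theorem restrictCLM_inl_sumElim (a : α → ℝ) (b : β → ℝ) :
    restrictCLM (Sum.inl : α → α ⊕ β) (Sum.elim a b) = a := rfl

@[simp] theorem restrictCLM_inr_sumElim (a : α → ℝ) (b : β → ℝ) :
    restrictCLM (Sum.inr : β → α ⊕ β) (Sum.elim a b) = b := rfl

theorem measurableEmbedding_sumElim :
    MeasurableEmbedding (fun p : (α → ℝ) × (β → ℝ) => (Sum.elim p.1 p.2 : α ⊕ β → ℝ)) := by
  have h := (MeasurableEquiv.sumPiEquivProdPi (fun _ : α ⊕ β => ℝ)).symm.measurableEmbedding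
  convert h using 1
  ext p i
  rcases i with i | i <;> rfl

variable [Fintype α] [Fintype β]

theorem measurePreserving_restrict_prod :
    MeasurePreserving (fun Y : α ⊕ β → ℝ => (restrictCLM (Sum.inl : α → α ⊕ β) Y,
      restrictCLM (Sum.inr : β → α ⊕ β) Y)) volume
      ((volume : Measure (α → ℝ)).prod (volume : Measure (β → ℝ))) :=
  volume_measurePreserving_sumPiEquivProdPi (fun _ : α ⊕ β => ℝ)

theorem measurePreserving_sumElim :
    MeasurePreserving (fun p : (α → ℝ) × (β → ℝ) => (Sum.elim p.1 p.2 : α ⊕ β → ℝ))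
      ((volume : Measure (α → ℝ)).prod (volume : Measure (β → ℝ))) volume := by
  have h := (volume_measurePreserving_sumPiEquivProdPi (fun _ : α ⊕ β => ℝ)).symm
  have heq : ⇑(MeasurableEquiv.sumPiEquivProdPi (fun _ : α ⊕ β => ℝ)).symm
      = fun p : (α → ℝ) × (β → ℝ) => (Sum.elim p.1 p.2 : α ⊕ β → ℝ) := by
    funext p i
    rcases i with i | i <;> rfl
  rw [heq] at h
  exact h

theorem integrable_comp_sumElim {F : (α ⊕ β → ℝ) → ℂ} (hF : Integrable F) :
    Integrable (fun p : (α → ℝ) × (β → ℝ) => F (Sum.elim p.1 p.2))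
      ((volume : Measure (α → ℝ)).prod (volume : Measure (β → ℝ))) :=
  measurePreserving_sumElim.integrable_comp_of_integrable hF

theorem integral_eq_prod_sumElim (F : (α ⊕ β → ℝ) → ℂ) :
    ∫ Y, F Y = ∫ p : (α → ℝ) × (β → ℝ), F (Sum.elim p.1 p.2)
      ∂((volume : Measure (α → ℝ)).prod (volume : Measure (β → ℝ))) :=
  (measurePreserving_sumElim.integral_comp measurableEmbedding_sumElim F).symm

theorem integral_sumElim_symm {F : (α ⊕ β → ℝ) → ℂ} (hF : Integrable F) :
    ∫ Y, F Y = ∫ b : β → ℝ, ∫ a : α → ℝ, F (Sum.elim a b) := by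
  rw [integral_eq_prod_sumElim, integral_prod_symm _ (integrable_comp_sumElim hF)]

/-- A majorant depending on only some of the coordinates, uniform in the others: it dominates the
integrals over slices of phase space. -/
theorem SchwartzMap.exists_integrable_bound (f : 𝓢(β → ℝ, ℂ)) (e : α → β) :
    ∃ g : (α → ℝ) → ℝ, Integrable g ∧ ∀ x, ‖f x‖ ≤ g (restrictCLM e x) := by
  obtain ⟨C₁, -, h₁⟩ := f.decay 0 0
  obtain ⟨C₂, -, h₂⟩ := f.decay (volume : Measure (α → ℝ)).integrablePower 0
  simp only [norm_iteratedFDeriv_zero] at h₁ h₂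
  refine ⟨_, (Measure.integrable_pow_neg_integrablePower
    (volume : Measure (α → ℝ))).const_mul (2 ^ (volume : Measure (α → ℝ)).integrablePower * (C₁ + C₂)),
    fun x => ?_⟩
  have h := pow_mul_le_of_le_of_pow_mul_le (k := 0)
    (l := (volume : Measure (α → ℝ)).integrablePower)
    (norm_nonneg (restrictCLM e x)) (norm_nonneg (f x)) (C₁ := C₁) (C₂ := C₂)
    (by simpa using h₁ x) ?_
  · simpa using h
  · rw [zero_add]
    refine le_trans ?_ (h₂ x)
    gcongr
    simpa using (restrictCLM e).le_of_opNorm_le (norm_restrictCLM_le e) x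

end SumPi

/-! ## The Moyal identity -/

section Moyal

variable {ι : Type} [Fintype ι]

theorem integral_flip {a B : Conf ι → ℂ} (ha : Integrable a) (hB : Integrable B) :
    ∫ p, (∫ x, Complex.exp (Complex.I * ((x ⬝ᵥ p : ℝ) : ℂ)) * a x) * B p
      = ∫ x, a x * ∫ p, Complex.exp (Complex.I * ((p ⬝ᵥ x : ℝ) : ℂ)) * B p := by
  simp only [← integral_mul_const, ← integral_const_mul]
  rw [integral_integral_swap]
  · refine integral_congr_ae (.of_forall fun x => integral_congr_ae (.of_forall fun p => ?_))
    simp only [dotProduct_comm x p]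
    ring
  · have h := (hB.mul_prod ha)
    have hc : Continuous fun z : Conf ι × Conf ι =>
        Complex.exp (Complex.I * ((z.2 ⬝ᵥ z.1 : ℝ) : ℂ)) := by
      simp only [dotProduct]
      fun_prop
    have h2 := h.bdd_mul (c := 1) hc.aestronglyMeasurable
      (.of_forall fun z => (norm_cexp_I_mul_ofReal _).le)
    refine h2.congr (.of_forall fun z => ?_)
    simp only [Function.uncurry]
    ring

theorem integrable_mul_conj (f g : L2 ι) :
    Integrable fun x => f x * (starRingEnd ℂ) (g x) := by
  have := L2.integrable_inner (𝕜 := ℂ) g f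
  simpa only [RCLike.inner_apply] using this

theorem inner_weylL2_eq (f g : L2 ι) (Y : Phase ι) :
    inner ℂ g (weylL2 Y f) = Complex.exp (Complex.I * ((1 / 2 * (cl Y ⬝ᵥ cr Y) : ℝ) : ℂ)) *
      ∫ x, Complex.exp (Complex.I * ((x ⬝ᵥ cl Y : ℝ) : ℂ)) *
        (f (x + cr Y) * (starRingEnd ℂ) (g x)) := by
  rw [L2.inner_def, ← integral_const_mul]
  refine integral_congr_ae ?_
  filter_upwards [coeFn_weylL2 Y f] with x hx
  rw [hx, RCLike.inner_apply, weylFun, weylPhase]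
  push_cast
  rw [mul_add, Complex.exp_add]
  ring

/-- W(0, q) is pure translation, so the integrand is that of an L² inner product. -/
theorem integrable_translate_mul_conj (f g : L2 ι) (q : Conf ι) :
    Integrable fun x => f (x + q) * (starRingEnd ℂ) (g x) := by
  have h := integrable_mul_conj (weylL2 (Sum.elim 0 q) f) g
  refine h.congr ?_
  filter_upwards [coeFn_weylL2 (Sum.elim 0 q) f] with x hx
  rw [hx, weylFun, weylPhase]
  simp

/-- For fixed q the coefficient is a Fourier transform in p, up to a unimodular phase. In the Moyal
integral this phase is cancelled by the opposite one in `inner_weylL2_eq`. -/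
theorem weylCoeff_eq (φ ψ : 𝓢(Conf ι, ℂ)) (Y : Phase ι) :
    weylCoeff φ ψ Y = Complex.exp (-Complex.I * ((1 / 2 * (cl Y ⬝ᵥ cr Y) : ℝ) : ℂ)) *
      piFT (fun x => ψ x * (starRingEnd ℂ) (φ (x + cr Y))) (cl Y) := by
  rw [weylCoeff, inner_weylL2_right, neg_neg, weylL2_toLp, inner_toLp_toLp, piFT,
    ← integral_const_mul]
  refine integral_congr_ae (.of_forall fun x => ?_)
  simp only [weylS_apply, weylFun, map_mul, ← Complex.exp_conj, Complex.conj_I, Complex.conj_ofReal,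
    weylPhase]
  push_cast
  rw [mul_add, Complex.exp_add]
  ring

theorem integrable_schwartz_mul_conj_translate (φ ψ : 𝓢(Conf ι, ℂ)) (q : Conf ι) :
    Integrable fun x => ψ x * (starRingEnd ℂ) (φ (x + q)) := by
  have hc : Continuous fun x => (starRingEnd ℂ) (φ (x + q)) :=
    Complex.continuous_conj.comp (φ.continuous.comp (by fun_prop))
  have := ψ.integrable (μ := volume).bdd_mul (c := SchwartzMap.seminorm ℝ 0 0 φ)
    hc.aestronglyMeasurable
    (.of_forall fun x => by rw [RCLike.norm_conj]; exact φ.norm_le_seminorm ℝ _)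
  exact this.congr (.of_forall fun x => mul_comm _ _)

theorem integrable_inner_mul_weylCoeff (f g : L2 ι) (φ ψ : 𝓢(Conf ι, ℂ)) :
    Integrable fun Y => inner ℂ g (weylL2 Y f) * weylCoeff φ ψ Y := by
  refine (integrable_weylCoeff φ ψ).bdd_mul (c := ‖g‖ * ‖f‖)
    (continuous_const.inner (continuous_weylL2 f)).aestronglyMeasurable (.of_forall fun Y => ?_)
  refine (norm_inner_le_norm _ _).trans ?_
  rw [norm_weylL2]

/-- The p-integration in the Moyal identity: moving the Fourier kernel from one factor to the other
by Fubini, then Fourier inversion. The integrability hypothesis on the slice holds for almost every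
q. -/
theorem integral_inner_mul_weylCoeff_slice (f g : L2 ι) (φ ψ : 𝓢(Conf ι, ℂ)) (q : Conf ι)
    (hq : Integrable fun p => weylCoeff φ ψ (Sum.elim p q)) :
    ∫ p, inner ℂ g (weylL2 (Sum.elim p q) f) * weylCoeff φ ψ (Sum.elim p q)
      = (((2 * Real.pi) ^ Fintype.card ι : ℝ) : ℂ) *
        ∫ x, (f (x + q) * (starRingEnd ℂ) (g x)) * (ψ x * (starRingEnd ℂ) (φ (x + q))) := by
  set a : Conf ι → ℂ := fun x => f (x + q) * (starRingEnd ℂ) (g x) with ha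
  set h : Conf ι → ℂ := fun x => ψ x * (starRingEnd ℂ) (φ (x + q)) with hh
  have hexp : ∀ r : ℝ, Complex.exp (Complex.I * (r : ℂ)) * Complex.exp (-Complex.I * (r : ℂ)) = 1 := by
    intro r
    rw [← Complex.exp_add]
    simp
  have hhc : Continuous h :=
    ψ.continuous.mul (Complex.continuous_conj.comp (φ.continuous.comp (by fun_prop)))
  have hF : Integrable (piFT h) := by
    have hc : Continuous fun p : Conf ι =>
        Complex.exp (Complex.I * ((1 / 2 * (p ⬝ᵥ q) : ℝ) : ℂ)) := by
      simp only [dotProduct]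
      fun_prop
    refine (hq.bdd_mul (c := 1) hc.aestronglyMeasurable
      (.of_forall fun z => (norm_cexp_I_mul_ofReal _).le)).congr (.of_forall fun p => ?_)
    simp only [weylCoeff_eq, restrictCLM_inl_sumElim, restrictCLM_inr_sumElim]
    rw [← mul_assoc, hexp, one_mul]
  have e1 : ∀ p, inner ℂ g (weylL2 (Sum.elim p q) f) * weylCoeff φ ψ (Sum.elim p q)
      = (∫ x, Complex.exp (Complex.I * ((x ⬝ᵥ p : ℝ) : ℂ)) * a x) * piFT h p := by
    intro p
    rw [weylCoeff_eq, inner_weylL2_eq]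
    simp only [restrictCLM_inl_sumElim, restrictCLM_inr_sumElim]
    rw [mul_mul_mul_comm, hexp, one_mul]
  rw [integral_congr_ae (.of_forall e1), integral_flip (integrable_translate_mul_conj f g q) hF]
  simp only [piFT_inversion hhc (integrable_schwartz_mul_conj_translate φ ψ q) hF]
  rw [← integral_const_mul]
  exact integral_congr_ae (.of_forall fun x => by ring)

/-- The Moyal identity. -/
theorem moyal (f g : L2 ι) (φ ψ : 𝓢(Conf ι, ℂ)) :
    ∫ Y, inner ℂ g (weylL2 Y f) * weylCoeff φ ψ Y
      = (((2 * Real.pi) ^ Fintype.card ι : ℝ) : ℂ) *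
        (inner ℂ g (ψ.toLp 2 volume) * inner ℂ (φ.toLp 2 volume) f) := by
  rw [integral_sumElim_symm (integrable_inner_mul_weylCoeff f g φ ψ)]
  have h1 : ∀ᵐ q : Conf ι, Integrable fun p : Conf ι => weylCoeff φ ψ (Sum.elim p q) :=
    (integrable_comp_sumElim (integrable_weylCoeff φ ψ)).prod_left_ae
  have h2 : ∀ᵐ q : Conf ι, ∫ p, inner ℂ g (weylL2 (Sum.elim p q) f) * weylCoeff φ ψ (Sum.elim p q)
      = (((2 * Real.pi) ^ Fintype.card ι : ℝ) : ℂ) *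
        ∫ x, (f (x + q) * (starRingEnd ℂ) (g x)) * (ψ x * (starRingEnd ℂ) (φ (x + q))) := by
    filter_upwards [h1] with q hq
    exact integral_inner_mul_weylCoeff_slice f g φ ψ q hq
  rw [integral_congr_ae h2, integral_const_mul]
  congr 1
  set u : Conf ι → ℂ := fun x => ψ x * (starRingEnd ℂ) (g x) with hu
  set v : Conf ι → ℂ := fun x => f x * (starRingEnd ℂ) (φ x) with hv
  have hui : Integrable u := by
    refine (integrable_mul_conj (ψ.toLp 2 volume) g).congr ?_
    filter_upwards [ψ.coeFn_toLp 2 volume] with x hx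
    rw [hx]
  have hvi : Integrable v := by
    refine (integrable_mul_conj f (φ.toLp 2 volume)).congr ?_
    filter_upwards [φ.coeFn_toLp 2 volume] with x hx
    rw [hx]
  -- The shear (x, q) ↦ (x, x + q) preserves Lebesgue measure, so the remaining double integral over
  -- x and q separates into ∫u times ∫v.
  have huv : Integrable (fun z : Conf ι × Conf ι => u z.1 * v (z.1 + z.2))
      ((volume : Measure (Conf ι)).prod volume) :=
    (measurePreserving_prod_add (volume : Measure (Conf ι)) volume).integrable_comp_of_integrable
      (hui.mul_prod hvi)
  have e2 : ∀ q x, (f (x + q) * (starRingEnd ℂ) (g x)) * (ψ x * (starRingEnd ℂ) (φ (x + q)))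
      = u x * v (x + q) := fun q x => by simp only [hu, hv]; ring
  simp only [e2]
  rw [integral_integral_swap (f := fun q x => u x * v (x + q)) huv.swap]
  simp only [integral_const_mul, integral_add_left_eq_self v]
  rw [integral_mul_const, inner_toLp_left]
  congr 1
  rw [L2.inner_def]
  refine integral_congr_ae ?_
  filter_upwards [ψ.coeFn_toLp 2 volume] with x hx
  rw [hx, RCLike.inner_apply]

/-! ### Trace-class operators -/

/-- `A = ∑_n |α_n⟩⟨β_n|` with `∑_n ‖α_n‖ ‖β_n‖ < ∞`. -/
def IsTraceRep {H : Type} [NormedAddCommGroup H] [InnerProductSpace ℂ H] (A : H →L[ℂ] H)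
    (α β : ℕ → H) : Prop :=
  Summable (fun n => ‖α n‖ * ‖β n‖) ∧ ∀ ψ, HasSum (fun n => inner ℂ (β n) ψ • α n) (A ψ)

/-- The characteristic function `tr(A W(Y))` of `A = ∑_n |α_n⟩⟨β_n|`. -/
def traceChar (α β : ℕ → L2 ι) (Y : Phase ι) : ℂ := ∑' n, inner ℂ (β n) (weylL2 Y (α n))

theorem continuous_traceChar {α β : ℕ → L2 ι} (h : Summable fun n => ‖α n‖ * ‖β n‖) :
    Continuous (traceChar α β) := by
  refine continuous_tsum (u := fun n => ‖α n‖ * ‖β n‖)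
    (fun n => continuous_const.inner (continuous_weylL2 (α n))) h fun n Y => ?_
  refine (norm_inner_le_norm _ _).trans ?_
  rw [norm_weylL2, mul_comm]

theorem norm_traceChar_le {α β : ℕ → L2 ι} (h : Summable fun n => ‖α n‖ * ‖β n‖) (Y : Phase ι) :
    ‖traceChar α β Y‖ ≤ ∑' n, ‖α n‖ * ‖β n‖ := by
  refine tsum_of_norm_bounded h.hasSum fun n => ?_
  refine (norm_inner_le_norm _ _).trans ?_
  rw [norm_weylL2, mul_comm]

/-- Summing the Moyal identity over the rank-one terms recovers the matrix elements of A from its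
characteristic function; the interchange of sum and integral is paid for by ∑ ‖α_n‖ ‖β_n‖ < ∞. -/
theorem IsTraceRep.integral_traceChar_mul_weylCoeff {A : L2 ι →L[ℂ] L2 ι} {α β : ℕ → L2 ι}
    (h : IsTraceRep A α β) (φ ψ : 𝓢(Conf ι, ℂ)) :
    ∫ Y, traceChar α β Y * weylCoeff φ ψ Y
      = (((2 * Real.pi) ^ Fintype.card ι : ℝ) : ℂ) *
        inner ℂ (φ.toLp 2 volume) (A (ψ.toLp 2 volume)) := by
  have h1 : HasSum (fun n => (((2 * Real.pi) ^ Fintype.card ι : ℝ) : ℂ) *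
        (inner ℂ (β n) (ψ.toLp 2 volume) * inner ℂ (φ.toLp 2 volume) (α n)))
      ((((2 * Real.pi) ^ Fintype.card ι : ℝ) : ℂ) *
        inner ℂ (φ.toLp 2 volume) (A (ψ.toLp 2 volume))) := by
    refine HasSum.mul_left _ ?_
    have := (h.2 (ψ.toLp 2 volume)).mapL (innerSL ℂ (φ.toLp 2 (volume : Measure (Conf ι))))
    simpa only [innerSL_apply_apply, inner_smul_right] using this
  have h2 : Summable fun n => ∫ Y, ‖inner ℂ (β n) (weylL2 Y (α n)) * weylCoeff φ ψ Y‖ := by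
    refine Summable.of_nonneg_of_le (fun n => by positivity) (fun n => ?_)
      (h.1.mul_right (∫ Y, ‖weylCoeff φ ψ Y‖))
    rw [← integral_const_mul]
    refine integral_mono (integrable_inner_mul_weylCoeff (α n) (β n) φ ψ).norm
      ((integrable_weylCoeff φ ψ).norm.const_mul _) fun Y => ?_
    simp only [norm_mul]
    gcongr
    refine (norm_inner_le_norm _ _).trans ?_
    rw [norm_weylL2, mul_comm]
  have h3 := hasSum_integral_of_summable_integral_norm
    (fun n => integrable_inner_mul_weylCoeff (α n) (β n) φ ψ) h2
  simp only [moyal] at h3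
  rw [← h3.unique h1]
  refine integral_congr_ae (.of_forall fun Y => ?_)
  exact tsum_mul_right.symm

end Moyal

/-! ## Weyl quantization through the characteristic function -/

section Quantization

variable {ι : Type}

theorem continuous_sumElim_right (p : Conf ι) :
    Continuous fun q : Conf ι => (Sum.elim p q : Phase ι) := by
  refine continuous_pi fun i => ?_
  rcases i with i | i
  · exact continuous_const
  · exact continuous_apply i

theorem continuous_sumElim_left (q : Conf ι) :
    Continuous fun p : Conf ι => (Sum.elim p q : Phase ι) := by
  refine continuous_pi fun i => ?_
  rcases i with i | i
  · exact continuous_apply i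
  · exact continuous_const

variable [Fintype ι]

/-- `(2π)^n`. -/
def twoPiPow (ι : Type) [Fintype ι] : ℂ := (((2 * Real.pi) ^ Fintype.card ι : ℝ) : ℂ)

theorem twoPiPow_ne_zero (ι : Type) [Fintype ι] : twoPiPow ι ≠ 0 := by
  rw [twoPiPow]
  exact_mod_cast (by positivity : ((2 * Real.pi) ^ Fintype.card ι : ℝ) ≠ 0)

/-- The Weyl symbol with characteristic function `f`. -/
def symbolOfChar (f : 𝓢(Phase ι, ℂ)) : 𝓢(Phase ι, ℂ) := (twoPiPow ι)⁻¹ • piFTS f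

theorem symbolOfChar_apply (f : 𝓢(Phase ι, ℂ)) (z : Phase ι) :
    symbolOfChar f z = (twoPiPow ι)⁻¹ * piFT f z := by
  simp [symbolOfChar, piFTS_apply]

theorem symbolOfChar_surjective (a : 𝓢(Phase ι, ℂ)) : ∃ f, symbolOfChar f = a := by
  obtain ⟨f, hf⟩ := piFTS_surjective (twoPiPow ι • a)
  exact ⟨f, by rw [symbolOfChar, hf, smul_smul, inv_mul_cancel₀ (twoPiPow_ne_zero ι), one_smul]⟩

/-- The partial Fourier transform in the position variables. -/
def partialFT (f : 𝓢(Phase ι, ℂ)) (m q : Conf ι) : ℂ :=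
  ∫ p : Conf ι, Complex.exp (-Complex.I * ((p ⬝ᵥ m : ℝ) : ℂ)) * f (Sum.elim p q)

theorem continuous_cexp_neg_dot (m : Conf ι) :
    Continuous fun p : Conf ι => Complex.exp (-Complex.I * ((p ⬝ᵥ m : ℝ) : ℂ)) := by
  simp only [dotProduct]
  fun_prop

theorem continuous_partialFT (f : 𝓢(Phase ι, ℂ)) (m : Conf ι) : Continuous (partialFT f m) := by
  obtain ⟨g, hg, hfg⟩ := f.exists_integrable_bound (Sum.inl : ι → ι ⊕ ι)
  refine continuous_of_dominated (bound := g) (fun q => ?_) (fun q => .of_forall fun p => ?_) hg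
    (.of_forall fun p => ?_)
  · exact ((continuous_cexp_neg_dot m).mul
      (f.continuous.comp (continuous_sumElim_left q))).aestronglyMeasurable
  · rw [norm_mul, norm_cexp_neg_I_mul_ofReal, one_mul]
    exact hfg (Sum.elim p q)
  · exact continuous_const.mul (f.continuous.comp (continuous_sumElim_right p))

theorem integrable_char_mul (f : 𝓢(Phase ι, ℂ)) (m ξ : Conf ι) :
    Integrable fun Y : Phase ι =>
      Complex.exp (-Complex.I * ((Y ⬝ᵥ (Sum.elim m ξ : Phase ι) : ℝ) : ℂ)) * f Y := by
  refine f.integrable.bdd_mul (c := 1) ?_ (.of_forall fun Y => (norm_cexp_neg_I_mul_ofReal _).le)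
  have : Continuous fun Y : Phase ι =>
      Complex.exp (-Complex.I * ((Y ⬝ᵥ (Sum.elim m ξ : Phase ι) : ℝ) : ℂ)) := by
    simp only [dotProduct]
    fun_prop
  exact this.aestronglyMeasurable

theorem cexp_neg_dot_sumElim (p q m ξ : Conf ι) :
    Complex.exp (-Complex.I * (((Sum.elim p q : Phase ι) ⬝ᵥ (Sum.elim m ξ : Phase ι) : ℝ) : ℂ))
      = Complex.exp (-Complex.I * ((q ⬝ᵥ ξ : ℝ) : ℂ)) *
        Complex.exp (-Complex.I * ((p ⬝ᵥ m : ℝ) : ℂ)) := by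
  rw [← Complex.exp_add, sumElim_dotProduct_sumElim]
  congr 1
  push_cast
  ring

theorem piFT_partialFT (f : 𝓢(Phase ι, ℂ)) (m ξ : Conf ι) :
    piFT (partialFT f m) ξ = piFT f (Sum.elim m ξ) := by
  rw [piFT, piFT, integral_sumElim_symm (integrable_char_mul f m ξ)]
  refine integral_congr_ae (.of_forall fun q => ?_)
  simp only [partialFT, ← integral_const_mul, cexp_neg_dot_sumElim, mul_assoc]

theorem integrable_partialFT (f : 𝓢(Phase ι, ℂ)) (m : Conf ι) : Integrable (partialFT f m) := by
  have h := (integrable_comp_sumElim (integrable_char_mul f m 0)).integral_prod_right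
  refine h.congr (.of_forall fun q => ?_)
  simp only [partialFT, cexp_neg_dot_sumElim, dotProduct_zero, Complex.ofReal_zero, mul_zero,
    Complex.exp_zero, one_mul]

theorem integrable_piFT_slice (f : 𝓢(Phase ι, ℂ)) (m : Conf ι) :
    Integrable fun ξ : Conf ι => piFT f (Sum.elim m ξ) := by
  obtain ⟨g, hg, hfg⟩ := (piFTS f).exists_integrable_bound (Sum.inr : ι → ι ⊕ ι)
  simp only [← piFTS_apply]
  refine hg.mono' ((piFTS f).continuous.comp (continuous_sumElim_right m)).aestronglyMeasurable
    (.of_forall fun ξ => ?_)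
  exact hfg (Sum.elim m ξ)

theorem integrable_mul_weylFun (f : 𝓢(Phase ι, ℂ)) (ψ : 𝓢(Conf ι, ℂ)) (x : Conf ι) :
    Integrable fun Y : Phase ι => f Y * weylFun (-Y) ψ x := by
  have hc : Continuous fun Y : Phase ι => weylFun (-Y) ψ x := by
    unfold weylFun
    have h1 : Continuous fun Y : Phase ι => weylPhase (-Y) x :=
      continuous_weylPhase.comp (by fun_prop : Continuous fun Y : Phase ι => (-Y, x))
    have h2 : Continuous fun Y : Phase ι => ψ (x + cr (-Y)) := ψ.continuous.comp (by fun_prop)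
    fun_prop
  refine (f.integrable.bdd_mul (c := SchwartzMap.seminorm ℝ 0 0 ψ) hc.aestronglyMeasurable
    (.of_forall fun Y => ?_)).congr (.of_forall fun Y => mul_comm _ _)
  rw [norm_weylFun]
  exact ψ.norm_le_seminorm ℝ _

/-- For fixed y the ξ-integral is a Fourier inversion, leaving the partial transform of f at
midpoint (x + y)/2 and difference q = x - y. The midpoint phase is then the phase of W(-(p, q)) at
x, so the iterated Weyl integral becomes an absolutely convergent superposition of Weyl operators.
-/
theorem weylOp_symbolOfChar (f : 𝓢(Phase ι, ℂ)) (ψ : 𝓢(Conf ι, ℂ)) (x : Conf ι) :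
    weylOp (symbolOfChar f) ψ x = (twoPiPow ι)⁻¹ * ∫ Y, f Y * weylFun (-Y) ψ x := by
  have hinner : ∀ y : Conf ι, ∫ ξ : Conf ι,
      Complex.exp (Complex.I * (((x - y) ⬝ᵥ ξ : ℝ) : ℂ)) *
        symbolOfChar f (Sum.elim ((1 / 2 : ℝ) • (x + y)) ξ) * ψ y
      = partialFT f ((1 / 2 : ℝ) • (x + y)) (x - y) * ψ y := by
    intro y
    set m := (1 / 2 : ℝ) • (x + y)
    have hF : Integrable (piFT (partialFT f m)) :=
      (integrable_piFT_slice f m).congr (.of_forall fun ξ => (piFT_partialFT f m ξ).symm)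
    have h := piFT_inversion (continuous_partialFT f m) (integrable_partialFT f m) hF (x - y)
    rw [integral_mul_const]
    congr 1
    have e : ∀ ξ : Conf ι, Complex.exp (Complex.I * (((x - y) ⬝ᵥ ξ : ℝ) : ℂ)) *
        symbolOfChar f (Sum.elim m ξ) = (twoPiPow ι)⁻¹ *
        (Complex.exp (Complex.I * ((ξ ⬝ᵥ (x - y) : ℝ) : ℂ)) * piFT (partialFT f m) ξ) := by
      intro ξ
      rw [symbolOfChar_apply, piFT_partialFT, dotProduct_comm]
      ring
    rw [integral_congr_ae (.of_forall e), integral_const_mul, h, ← mul_assoc]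
    change (twoPiPow ι)⁻¹ * twoPiPow ι * _ = _
    rw [inv_mul_cancel₀ (twoPiPow_ne_zero ι), one_mul]
  rw [weylOp]
  change (twoPiPow ι)⁻¹ * _ = _
  congr 1
  rw [integral_congr_ae (.of_forall hinner), integral_sumElim_symm (integrable_mul_weylFun f ψ x),
    ← integral_sub_left_eq_self _ volume x]
  refine integral_congr_ae (.of_forall fun q => ?_)
  simp only [partialFT, ← integral_mul_const]
  refine integral_congr_ae (.of_forall fun p => ?_)
  have e1 : x - (x - q) = q := by abel
  have e2 : x + cr (-(Sum.elim p q : Phase ι)) = x - q := by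
    rw [show cr (-(Sum.elim p q : Phase ι)) = -q from rfl, sub_eq_add_neg]
  have e3 : weylPhase (-(Sum.elim p q : Phase ι)) x
      = -(p ⬝ᵥ ((1 / 2 : ℝ) • (x + (x - q)))) := by
    simp only [weylPhase, map_neg, restrictCLM_inl_sumElim, restrictCLM_inr_sumElim, dotProduct_neg,
      neg_dotProduct, dotProduct_smul, dotProduct_add, dotProduct_sub, smul_eq_mul,
      dotProduct_comm x p]
    ring
  simp only [e1, weylFun, e2, e3]
  push_cast
  rw [mul_neg, neg_mul]
  ring

theorem integrable_prod_weylFun (f : 𝓢(Phase ι, ℂ)) (φ ψ : 𝓢(Conf ι, ℂ)) :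
    Integrable (fun z : Conf ι × Phase ι =>
      f z.2 * weylFun (-z.2) ψ z.1 * (starRingEnd ℂ) (φ z.1))
      ((volume : Measure (Conf ι)).prod (volume : Measure (Phase ι))) := by
  have hc : Continuous fun z : Conf ι × Phase ι => weylFun (-z.2) ψ z.1 := by
    unfold weylFun
    have h1 : Continuous fun z : Conf ι × Phase ι => weylPhase (-z.2) z.1 :=
      continuous_weylPhase.comp (by fun_prop : Continuous fun z : Conf ι × Phase ι => (-z.2, z.1))
    have h2 : Continuous fun z : Conf ι × Phase ι => ψ (z.1 + cr (-z.2)) :=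
      ψ.continuous.comp (by fun_prop)
    fun_prop
  have hφ : Integrable fun x => (starRingEnd ℂ) (φ x) :=
    (Complex.conjCLE : ℂ →L[ℝ] ℂ).integrable_comp φ.integrable
  refine ((hφ.mul_prod f.integrable).bdd_mul (c := SchwartzMap.seminorm ℝ 0 0 ψ)
    hc.aestronglyMeasurable (.of_forall fun z => ?_)).congr (.of_forall fun z => ?_)
  · rw [norm_weylFun]
    exact ψ.norm_le_seminorm ℝ _
  · simp only []
    ring

theorem integral_weylOp_mul_conj (f : 𝓢(Phase ι, ℂ)) (φ ψ : 𝓢(Conf ι, ℂ)) :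
    ∫ x, weylOp (symbolOfChar f) ψ x * (starRingEnd ℂ) (φ x)
      = (twoPiPow ι)⁻¹ * ∫ Y, f Y * weylCoeff φ ψ Y := by
  simp only [weylOp_symbolOfChar, mul_assoc, integral_const_mul]
  congr 1
  simp only [← integral_mul_const]
  rw [integral_integral_swap (integrable_prod_weylFun f φ ψ)]
  refine integral_congr_ae (.of_forall fun Y => ?_)
  simp only [weylCoeff, inner_toLp_weylL2, ← integral_const_mul, mul_assoc]

theorem HasWeylSymbol.inner_eq {T : L2 ι →L[ℂ] L2 ι} {f : 𝓢(Phase ι, ℂ)}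
    (h : HasWeylSymbol T (symbolOfChar f)) (φ ψ : 𝓢(Conf ι, ℂ)) :
    inner ℂ (φ.toLp 2 volume) (T (ψ.toLp 2 volume))
      = (twoPiPow ι)⁻¹ * ∫ Y, f Y * weylCoeff φ ψ Y := by
  rw [← integral_weylOp_mul_conj, inner_toLp_left]
  refine integral_congr_ae ?_
  filter_upwards [h ψ] with x hx
  rw [hx]

theorem continuous_weylOp_symbolOfChar (f : 𝓢(Phase ι, ℂ)) (ψ : 𝓢(Conf ι, ℂ)) :
    Continuous (weylOp (symbolOfChar f) ψ) := by
  rw [funext (weylOp_symbolOfChar f ψ)]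
  refine continuous_const.mul ?_
  refine continuous_of_dominated (bound := fun Y => ‖f Y‖ * SchwartzMap.seminorm ℝ 0 0 ψ)
    (fun x => (integrable_mul_weylFun f ψ x).aestronglyMeasurable)
    (fun x => .of_forall fun Y => ?_) (f.integrable.norm.mul_const _) (.of_forall fun Y => ?_)
  · rw [norm_mul, norm_weylFun]
    exact mul_le_mul_of_nonneg_left (ψ.norm_le_seminorm ℝ _) (norm_nonneg _)
  · refine continuous_const.mul ?_
    rw [← funext (weylS_apply (-Y) ψ)]
    exact (weylS (-Y) ψ).continuous

/-- Matrix elements against compactly supported smooth functions determine a locally integrable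
function almost everywhere, which upgrades a weak identity to the pointwise one in `HasWeylSymbol`.
-/
theorem hasWeylSymbol_of_inner {T : L2 ι →L[ℂ] L2 ι} {f : 𝓢(Phase ι, ℂ)}
    (h : ∀ φ ψ : 𝓢(Conf ι, ℂ), inner ℂ (φ.toLp 2 volume) (T (ψ.toLp 2 volume))
      = (twoPiPow ι)⁻¹ * ∫ Y, f Y * weylCoeff φ ψ Y) :
    HasWeylSymbol T (symbolOfChar f) := by
  intro ψ
  refine ae_eq_of_integral_contDiff_smul_eq
    ((Lp.memLp (T (ψ.toLp 2 volume))).locallyIntegrable (by norm_num))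
    (continuous_weylOp_symbolOfChar f ψ).locallyIntegrable fun g hg hgc => ?_
  have hgc' : HasCompactSupport fun x => (g x : ℂ) := hgc.comp_left (g := Complex.ofReal) rfl
  have hg' : ContDiff ℝ ∞ fun x => (g x : ℂ) := Complex.ofRealCLM.contDiff.comp hg
  have h1 := h (hgc'.toSchwartzMap hg') ψ
  rw [← integral_weylOp_mul_conj, inner_toLp_left] at h1
  simp only [HasCompactSupport.toSchwartzMap_toFun, Complex.conj_ofReal] at h1
  simp only [Complex.real_smul]
  refine Eq.trans ?_ (h1.trans ?_)
  · exact integral_congr_ae (.of_forall fun x => mul_comm _ _)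
  · exact integral_congr_ae (.of_forall fun x => mul_comm _ _)

/-- A trace-class operator whose characteristic function is the Schwartz function `f` has a Weyl
symbol in the Schwartz class, the Fourier transform of `f`. -/
theorem IsTraceRep.hasWeylSymbol {T : L2 ι →L[ℂ] L2 ι} {α β : ℕ → L2 ι} (h : IsTraceRep T α β)
    {f : 𝓢(Phase ι, ℂ)} (hf : ∀ Y, traceChar α β Y = f Y) : HasWeylSymbol T (symbolOfChar f) := by
  refine hasWeylSymbol_of_inner fun φ ψ => ?_
  simp only [← hf, h.integral_traceChar_mul_weylCoeff φ ψ]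
  change _ = (twoPiPow ι)⁻¹ * (twoPiPow ι * _)
  rw [← mul_assoc, inv_mul_cancel₀ (twoPiPow_ne_zero ι), one_mul]

end Quantization

/-! ## Product states -/

section Product

variable {ι κ : Type}

/-- The system part of a phase-space point of the total system. -/
abbrev sysPart (Y : Phase (ι ⊕ κ)) : Phase ι := restrictCLM (Sum.map Sum.inl Sum.inl) Y

/-- The environment part of a phase-space point of the total system. -/
abbrev envPart (Y : Phase (ι ⊕ κ)) : Phase κ := restrictCLM (Sum.map Sum.inr Sum.inr) Y

/-- Regrouping of the phase-space coordinates of a composite system. -/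
def regroup (ι κ : Type) : PIdx ι ⊕ PIdx κ ≃ PIdx (ι ⊕ κ) := Equiv.sumSumSumComm ι ι κ κ

theorem restrict_inl_regroup (Y : Phase (ι ⊕ κ)) :
    restrictCLM Sum.inl (restrictCLM (regroup ι κ) Y) = sysPart Y := by
  ext i
  rcases i with i | i <;> rfl

theorem restrict_inr_regroup (Y : Phase (ι ⊕ κ)) :
    restrictCLM Sum.inr (restrictCLM (regroup ι κ) Y) = envPart Y := by
  ext i
  rcases i with i | i <;> rfl

variable [Fintype ι] [Fintype κ]

theorem dotProduct_sum_split (x y : ι ⊕ κ → ℝ) :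
    x ⬝ᵥ y = restrictCLM Sum.inl x ⬝ᵥ (restrictCLM Sum.inl y : ι → ℝ)
      + restrictCLM Sum.inr x ⬝ᵥ (restrictCLM Sum.inr y : κ → ℝ) := by
  simp [dotProduct, Fintype.sum_sum_type]

theorem weylPhase_sum (Y : Phase (ι ⊕ κ)) (x : Conf (ι ⊕ κ)) :
    weylPhase Y x = weylPhase (sysPart Y) (restrictCLM Sum.inl x)
      + weylPhase (envPart Y) (restrictCLM Sum.inr x) := by
  simp only [weylPhase]
  rw [dotProduct_sum_split x, dotProduct_sum_split (cl Y)]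
  have h1 : restrictCLM Sum.inl (cl Y) = cl (sysPart Y) := rfl
  have h2 : restrictCLM Sum.inr (cl Y) = cl (envPart Y) := rfl
  have h3 : restrictCLM Sum.inl (cr Y) = cr (sysPart Y) := rfl
  have h4 : restrictCLM Sum.inr (cr Y) = cr (envPart Y) := rfl
  rw [h1, h2, h3, h4]
  ring

theorem weylS_tensorS (Y : Phase (ι ⊕ κ)) (f : 𝓢(Conf ι, ℂ)) (g : 𝓢(Conf κ, ℂ)) :
    weylS Y (tensorS f g) = tensorS (weylS (sysPart Y) f) (weylS (envPart Y) g) := by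
  ext x
  simp only [weylS_apply, weylFun, tensorS_apply]
  rw [weylPhase_sum]
  push_cast
  rw [mul_add, Complex.exp_add]
  rw [mul_mul_mul_comm]
  rfl

theorem coeFn_tensorL2 (f : L2 ι) (g : L2 κ) :
    tensorL2 f g =ᵐ[volume] fun x : Conf (ι ⊕ κ) =>
      f (restrictCLM Sum.inl x) * g (restrictCLM Sum.inr x) :=
  MemLp.coeFn_toLp (memLp_tensor f g)

theorem ae_comp_inl {p : Conf ι → Prop} (h : ∀ᵐ x, p x) :
    ∀ᵐ x : Conf (ι ⊕ κ), p (restrictCLM Sum.inl x) :=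
  (measurePreserving_restrict_prod (α := ι) (β := κ)).quasiMeasurePreserving.ae
    (Measure.quasiMeasurePreserving_fst.ae h)

theorem ae_comp_inr {p : Conf κ → Prop} (h : ∀ᵐ x, p x) :
    ∀ᵐ x : Conf (ι ⊕ κ), p (restrictCLM Sum.inr x) :=
  (measurePreserving_restrict_prod (α := ι) (β := κ)).quasiMeasurePreserving.ae
    (Measure.quasiMeasurePreserving_snd.ae h)

theorem tensorL2_toLp (f : 𝓢(Conf ι, ℂ)) (g : 𝓢(Conf κ, ℂ)) :
    tensorL2 (f.toLp 2 volume) (g.toLp 2 volume) = (tensorS f g).toLp 2 volume := by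
  refine Lp.ext ?_
  filter_upwards [coeFn_tensorL2 (f.toLp 2 volume) (g.toLp 2 volume),
    (tensorS f g).coeFn_toLp 2 volume, ae_comp_inl (κ := κ) (f.coeFn_toLp 2 volume),
    ae_comp_inr (ι := ι) (g.coeFn_toLp 2 volume)] with x h1 h2 h3 h4
  rw [h1, h2, h3, h4]
  rfl

theorem inner_tensorL2 (a c : L2 ι) (b d : L2 κ) :
    inner ℂ (tensorL2 a b) (tensorL2 c d) = inner ℂ a c * inner ℂ b d := by
  rw [L2.inner_def, L2.inner_def, L2.inner_def, ← integral_prod_mul]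
  rw [← (measurePreserving_restrict_prod (α := ι) (β := κ)).integral_comp
    (MeasurableEquiv.sumPiEquivProdPi (fun _ : ι ⊕ κ => ℝ)).measurableEmbedding]
  refine integral_congr_ae ?_
  filter_upwards [coeFn_tensorL2 a b, coeFn_tensorL2 c d] with x h1 h2
  rw [h1, h2]
  simp only [RCLike.inner_apply, map_mul]
  ring

theorem weylL2_tensorL2 (Y : Phase (ι ⊕ κ)) (f : L2 ι) (g : L2 κ) :
    weylL2 Y (tensorL2 f g) = tensorL2 (weylL2 (sysPart Y) f) (weylL2 (envPart Y) g) := by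
  refine Lp.ext ?_
  filter_upwards [coeFn_weylL2 Y (tensorL2 f g), weylFun_ae_congr Y (coeFn_tensorL2 f g),
    coeFn_tensorL2 (weylL2 (sysPart Y) f) (weylL2 (envPart Y) g),
    ae_comp_inl (κ := κ) (coeFn_weylL2 (sysPart Y) f),
    ae_comp_inr (ι := ι) (coeFn_weylL2 (envPart Y) g)] with x h1 h2 h3 h4 h5
  rw [h1, h2, h3, h4, h5]
  simp only [weylFun]
  rw [weylPhase_sum]
  push_cast
  rw [mul_add, Complex.exp_add, mul_mul_mul_comm]
  rfl

theorem weylL2_zero (f : L2 ι) : weylL2 0 f = f := by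
  refine Lp.ext ?_
  filter_upwards [coeFn_weylL2 0 f] with x hx
  rw [hx, weylFun, weylPhase]
  simp

theorem weylCoeff_tensorS (φ₁ ψ₁ : 𝓢(Conf ι, ℂ)) (φ₂ ψ₂ : 𝓢(Conf κ, ℂ)) (Y : Phase (ι ⊕ κ)) :
    weylCoeff (tensorS φ₁ φ₂) (tensorS ψ₁ ψ₂) Y
      = weylCoeff φ₁ ψ₁ (sysPart Y) * weylCoeff φ₂ ψ₂ (envPart Y) := by
  simp only [weylCoeff, weylL2_toLp]
  rw [weylS_tensorS, ← tensorL2_toLp, ← tensorL2_toLp, inner_tensorL2,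
    show sysPart (-Y) = -sysPart Y from rfl, show envPart (-Y) = -envPart Y from rfl]

theorem integral_comp_regroup (F : (PIdx ι ⊕ PIdx κ → ℝ) → ℂ) :
    ∫ Y : Phase (ι ⊕ κ), F (restrictCLM (regroup ι κ) Y) = ∫ X, F X := by
  have h := volume_measurePreserving_piCongrLeft (fun _ : PIdx ι ⊕ PIdx κ => ℝ) (regroup ι κ).symm
  have h2 := h.integral_comp (MeasurableEquiv.measurableEmbedding _) F
  rw [← h2]
  refine integral_congr_ae (.of_forall fun Y => ?_)
  refine congrArg F (funext fun i => ?_)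
  obtain ⟨j, rfl⟩ := (regroup ι κ).symm.surjective i
  simp [MeasurableEquiv.coe_piCongrLeft]

/-- The tensor product of characteristic functions. -/
def tensorChar (f : 𝓢(Phase ι, ℂ)) (g : 𝓢(Phase κ, ℂ)) (Y : Phase (ι ⊕ κ)) : ℂ :=
  f (sysPart Y) * g (envPart Y)

theorem continuous_tensorChar (f : 𝓢(Phase ι, ℂ)) (g : 𝓢(Phase κ, ℂ)) :
    Continuous (tensorChar f g) :=
  (f.continuous.comp (by fun_prop)).mul (g.continuous.comp (by fun_prop))

theorem integral_tensorChar_mul (f : 𝓢(Phase ι, ℂ)) (g : 𝓢(Phase κ, ℂ))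
    (φ₁ ψ₁ : 𝓢(Conf ι, ℂ)) (φ₂ ψ₂ : 𝓢(Conf κ, ℂ)) :
    ∫ Y, tensorChar f g Y * weylCoeff (tensorS φ₁ φ₂) (tensorS ψ₁ ψ₂) Y
      = (∫ z, f z * weylCoeff φ₁ ψ₁ z) * ∫ u, g u * weylCoeff φ₂ ψ₂ u := by
  rw [← integral_prod_mul]
  have h := integral_comp_regroup (fun X : PIdx ι ⊕ PIdx κ → ℝ =>
    (f (restrictCLM Sum.inl X) * weylCoeff φ₁ ψ₁ (restrictCLM Sum.inl X)) *
    (g (restrictCLM Sum.inr X) * weylCoeff φ₂ ψ₂ (restrictCLM Sum.inr X)))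
  refine Eq.trans (integral_congr_ae (.of_forall fun Y => ?_))
    (h.trans (integral_eq_prod_sumElim _))
  simp only [restrict_inl_regroup, restrict_inr_regroup, tensorChar, weylCoeff_tensorS]
  ring

/-- Moving both test functions by the same Weyl operator multiplies the coefficient by a character
of Y. Integral identities valid for all test functions thereby become statements about Fourier
transforms. -/
theorem weylCoeff_conj (Z : Phase ι) (φ ψ : 𝓢(Conf ι, ℂ)) (Y : Phase ι) :
    weylCoeff (weylS Z φ) (weylS Z ψ) Y
      = Complex.exp (Complex.I * ((cl Y ⬝ᵥ cr Z - cr Y ⬝ᵥ cl Z : ℝ) : ℂ)) * weylCoeff φ ψ Y := by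
  have h : weylCoeff (weylS Z φ) (weylS Z ψ) Y = inner ℂ (φ.toLp 2 volume)
      ((weylS (-Z) (weylS (-Y) (weylS Z ψ))).toLp 2 volume) := by
    rw [weylCoeff, ← weylL2_toLp Z φ, inner_weylL2_left, weylL2_toLp, weylL2_toLp]
  rw [h, weylS_conj, weylCoeff, weylL2_toLp]
  change inner ℂ _ ((SchwartzMap.toLpCLM ℂ ℂ 2 volume) (_ • _)) = _
  rw [map_smul, inner_smul_right]
  rfl

/-- A Gaussian in the Schwartz space. -/
def stdGaussS (ι : Type) [Fintype ι] : 𝓢(Conf ι, ℂ) := by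
  classical exact gaussCharS (Matrix.PosDef.one : (1 : Matrix ι ι ℝ).PosDef) 0

theorem stdGaussS_ne_zero (ι : Type) [Fintype ι] (x : Conf ι) : stdGaussS ι x ≠ 0 :=
  Complex.exp_ne_zero _

/-- The characteristic function of a product state. -/
theorem traceChar_eq_tensorChar {RS : L2 ι →L[ℂ] L2 ι} {RE : L2 κ →L[ℂ] L2 κ}
    {R : L2 (ι ⊕ κ) →L[ℂ] L2 (ι ⊕ κ)} (hR : IsTensorOp RS RE R) {f : 𝓢(Phase ι, ℂ)}
    {g : 𝓢(Phase κ, ℂ)} (hS : HasWeylSymbol RS (symbolOfChar f))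
    (hE : HasWeylSymbol RE (symbolOfChar g)) {α β : ℕ → L2 (ι ⊕ κ)} (h : IsTraceRep R α β)
    (Y₀ : Phase (ι ⊕ κ)) : traceChar α β Y₀ = tensorChar f g Y₀ := by
  have hpow : twoPiPow (ι ⊕ κ) = twoPiPow ι * twoPiPow κ := by
    simp only [twoPiPow, Fintype.card_sum, pow_add]
    push_cast
    rfl
  have hcont : Continuous fun Y => traceChar α β Y - tensorChar f g Y :=
    (continuous_traceChar h.1).sub (continuous_tensorChar f g)
  have hbT : ∀ Y, ‖traceChar α β Y‖ ≤ ∑' n, ‖α n‖ * ‖β n‖ := norm_traceChar_le h.1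
  have hbF : ∀ Y, ‖tensorChar f g Y‖
      ≤ SchwartzMap.seminorm ℝ 0 0 f * SchwartzMap.seminorm ℝ 0 0 g := fun Y => by
    rw [tensorChar, norm_mul]
    exact mul_le_mul (f.norm_le_seminorm ℝ _) (g.norm_le_seminorm ℝ _) (norm_nonneg _)
      (apply_nonneg _ _)
  have hIT : ∀ φ ψ, Integrable fun Y => traceChar α β Y * weylCoeff φ ψ Y := fun φ ψ =>
    (integrable_weylCoeff φ ψ).bdd_mul (continuous_traceChar h.1).aestronglyMeasurable
      (.of_forall hbT)
  have hIF : ∀ φ ψ, Integrable fun Y => tensorChar f g Y * weylCoeff φ ψ Y := fun φ ψ =>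
    (integrable_weylCoeff φ ψ).bdd_mul (continuous_tensorChar f g).aestronglyMeasurable
      (.of_forall hbF)
  -- Both integrals equal (2π)^n times the matrix element of R between product functions: one by
  -- Moyal, the other because R, the Weyl operators and the measure all factorize.
  have hzero : ∀ (φ₁ ψ₁ : 𝓢(Conf ι, ℂ)) (φ₂ ψ₂ : 𝓢(Conf κ, ℂ)),
      ∫ Y, (traceChar α β Y - tensorChar f g Y) *
        weylCoeff (tensorS φ₁ φ₂) (tensorS ψ₁ ψ₂) Y = 0 := by
    intro φ₁ ψ₁ φ₂ ψ₂
    simp only [sub_mul]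
    rw [integral_sub (hIT _ _) (hIF _ _), integral_tensorChar_mul,
      h.integral_traceChar_mul_weylCoeff]
    change twoPiPow (ι ⊕ κ) * _ - _ = 0
    rw [← tensorL2_toLp, ← tensorL2_toLp, hR, inner_tensorL2, hS.inner_eq, hE.inner_eq, hpow]
    have h1 := twoPiPow_ne_zero ι
    have h2 := twoPiPow_ne_zero κ
    field_simp
    ring
  -- Translating the test functions by W(Z) inserts the character exp(-iY·z) under the integral, so
  -- the whole Fourier transform of the continuous integrand vanishes.
  have hvanish : ∀ (φ₁ ψ₁ : 𝓢(Conf ι, ℂ)) (φ₂ ψ₂ : 𝓢(Conf κ, ℂ)) (Y : Phase (ι ⊕ κ)),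
      (traceChar α β Y - tensorChar f g Y) *
        weylCoeff (tensorS φ₁ φ₂) (tensorS ψ₁ ψ₂) Y = 0 := by
    intro φ₁ ψ₁ φ₂ ψ₂
    have hI : Integrable fun Y => (traceChar α β Y - tensorChar f g Y) *
        weylCoeff (tensorS φ₁ φ₂) (tensorS ψ₁ ψ₂) Y := by
      simp only [sub_mul]
      exact (hIT _ _).sub (hIF _ _)
    refine congrFun (piFT_eq_zero (hcont.mul (continuous_weylCoeff _ _)) hI fun z => ?_)
    -- Z is Jz, chosen so that the symplectic pairing of Y with Z is -Y·z.
    set Z : Phase (ι ⊕ κ) := Sum.elim (cr z) (-(cl z)) with hZ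
    have := hzero (weylS (sysPart Z) φ₁) (weylS (sysPart Z) ψ₁) (weylS (envPart Z) φ₂)
      (weylS (envPart Z) ψ₂)
    simp only [← weylS_tensorS, weylCoeff_conj] at this
    rw [← this, piFT]
    refine integral_congr_ae (.of_forall fun Y => ?_)
    have e : cl Y ⬝ᵥ cr Z - cr Y ⬝ᵥ cl Z = -(Y ⬝ᵥ z) := by
      rw [dotProduct_sum_split Y z, show cr Z = -(cl z) from rfl, show cl Z = cr z from rfl,
        dotProduct_neg]
      ring
    beta_reduce
    rw [e]
    push_cast
    rw [mul_neg, neg_mul]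
    ring
  -- With first function W(-Y₀)ψ and second function ψ, the coefficient at Y₀ is ‖W(-Y₀)ψ‖², nonzero
  -- for the Gaussian ψ. So the difference vanishes at Y₀, and no density of product functions is
  -- needed.
  have hY := hvanish (weylS (sysPart (-Y₀)) (stdGaussS ι)) (stdGaussS ι)
    (weylS (envPart (-Y₀)) (stdGaussS κ)) (stdGaussS κ) Y₀
  rw [← weylS_tensorS, weylCoeff, weylL2_toLp] at hY
  rcases mul_eq_zero.1 hY with h0 | h0
  · exact sub_eq_zero.1 h0
  · exfalso
    rw [inner_self_eq_zero, ← weylL2_toLp, ← norm_eq_zero, norm_weylL2, norm_eq_zero] at h0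
    have h1 := SchwartzMap.injective_toLp 2 (volume : Measure (Conf (ι ⊕ κ)))
      (a₁ := tensorS (stdGaussS ι) (stdGaussS κ)) (a₂ := 0)
      (h0.trans (map_zero (SchwartzMap.toLpCLM ℂ ℂ 2 (volume : Measure (Conf (ι ⊕ κ))))).symm)
    have h2 := congrArg (fun F : 𝓢(Conf (ι ⊕ κ), ℂ) => F 0) h1
    simp only [tensorS_apply] at h2
    exact mul_ne_zero (stdGaussS_ne_zero ι _) (stdGaussS_ne_zero κ _) h2

end Product

/-! ## Differentiation of Weyl operators -/

section WeylDeriv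

variable {ι : Type} [Fintype ι]

theorem abs_dotProduct_le (x y : Conf ι) : |x ⬝ᵥ y| ≤ Fintype.card ι * (‖x‖ * ‖y‖) := by
  refine (Finset.abs_sum_le_sum_abs _ _).trans ?_
  calc ∑ i, |x i * y i| ≤ ∑ _i : ι, ‖x‖ * ‖y‖ := by
        refine Finset.sum_le_sum fun i _ => ?_
        rw [abs_mul]
        exact mul_le_mul (norm_le_pi_norm x i) (norm_le_pi_norm y i) (abs_nonneg _) (norm_nonneg _)
    _ = _ := by simp [Finset.sum_const]

theorem hasDerivAt_dotProduct {u v : ℝ → Conf ι} {u' v' : Conf ι} {t : ℝ}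
    (hu : HasDerivAt u u' t) (hv : HasDerivAt v v' t) :
    HasDerivAt (fun s => u s ⬝ᵥ v s) (u' ⬝ᵥ v t + u t ⬝ᵥ v') t := by
  simp only [dotProduct, ← Finset.sum_add_distrib]
  exact HasDerivAt.fun_sum fun i _ => ((hasDerivAt_pi.1 hu) i).mul ((hasDerivAt_pi.1 hv) i)

/-- The derivative of the phase of a Weyl operator. -/
def weylPhaseDeriv (Y Y' : Phase ι) (x : Conf ι) : ℝ :=
  x ⬝ᵥ cl Y' + 1 / 2 * (cl Y' ⬝ᵥ cr Y + cl Y ⬝ᵥ cr Y')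

/-- The derivative of `weylFun Y b x` in the direction `Y'`. -/
def weylFunDeriv (Y Y' : Phase ι) (b : 𝓢(Conf ι, ℂ)) (x : Conf ι) : ℂ :=
  Complex.exp (Complex.I * (weylPhase Y x : ℂ)) *
    (Complex.I * (weylPhaseDeriv Y Y' x : ℂ) * b (x + cr Y) + fderiv ℝ b (x + cr Y) (cr Y'))

theorem hasDerivAt_weylFun {Y : ℝ → Phase ι} {Y' : Phase ι} {t : ℝ} (hY : HasDerivAt Y Y' t)
    (b : 𝓢(Conf ι, ℂ)) (x : Conf ι) :
    HasDerivAt (fun s => weylFun (Y s) b x) (weylFunDeriv (Y t) Y' b x) t := by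
  have hl : HasDerivAt (fun s => cl (Y s)) (cl Y') t :=
    (restrictCLM (Sum.inl : ι → PIdx ι)).hasFDerivAt.comp_hasDerivAt t hY
  have hr : HasDerivAt (fun s => cr (Y s)) (cr Y') t :=
    (restrictCLM (Sum.inr : ι → PIdx ι)).hasFDerivAt.comp_hasDerivAt t hY
  have h1 : HasDerivAt (fun s => weylPhase (Y s) x) (weylPhaseDeriv (Y t) Y' x) t := by
    refine ((hasDerivAt_dotProduct (hasDerivAt_const t x) hl).fun_add
      ((hasDerivAt_dotProduct hl hr).const_mul (1 / 2))).congr_deriv ?_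
    rw [zero_dotProduct, zero_add, weylPhaseDeriv]
  have h2 : HasDerivAt (fun s => b (x + cr (Y s))) (fderiv ℝ b (x + cr (Y t)) (cr Y')) t :=
    (b.hasFDerivAt (x + cr (Y t))).comp_hasDerivAt t (hr.const_add x)
  refine ((h1.ofReal_comp.const_mul Complex.I).cexp.mul h2).congr_deriv ?_
  rw [weylFunDeriv]
  ring

theorem norm_weylFunDeriv_le (Y Y' : Phase ι) (b : 𝓢(Conf ι, ℂ)) (x : Conf ι) {R : ℝ}
    (hY : ‖Y‖ ≤ R) (hY' : ‖Y'‖ ≤ R) :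
    ‖weylFunDeriv Y Y' b x‖ ≤ (Fintype.card ι * (‖x‖ * R) + Fintype.card ι * (R * R)) *
      SchwartzMap.seminorm ℝ 0 0 b + SchwartzMap.seminorm ℝ 0 1 b * R := by
  have hR : 0 ≤ R := (norm_nonneg _).trans hY
  have hle : ∀ (e : ι → PIdx ι) (Z : Phase ι), ‖restrictCLM e Z‖ ≤ ‖Z‖ := fun e Z => by
    simpa using (restrictCLM e).le_of_opNorm_le (norm_restrictCLM_le e) Z
  have h1 : |weylPhaseDeriv Y Y' x| ≤ Fintype.card ι * (‖x‖ * R) + Fintype.card ι * (R * R) := by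
    have a1 : |x ⬝ᵥ cl Y'| ≤ Fintype.card ι * (‖x‖ * R) :=
      (abs_dotProduct_le _ _).trans (by gcongr; exact (hle _ _).trans hY')
    have a2 : |cl Y' ⬝ᵥ cr Y| ≤ Fintype.card ι * (R * R) :=
      (abs_dotProduct_le _ _).trans (by
        gcongr; exacts [(hle _ _).trans hY', (hle _ _).trans hY])
    have a3 : |cl Y ⬝ᵥ cr Y'| ≤ Fintype.card ι * (R * R) :=
      (abs_dotProduct_le _ _).trans (by
        gcongr; exacts [(hle _ _).trans hY, (hle _ _).trans hY'])
    rw [weylPhaseDeriv]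
    rw [abs_le] at a1 a2 a3 ⊢
    constructor <;> linarith [a1.1, a1.2, a2.1, a2.2, a3.1, a3.2]
  rw [weylFunDeriv, norm_mul, norm_cexp_I_mul_ofReal, one_mul]
  refine (norm_add_le _ _).trans (add_le_add ?_ ?_)
  · rw [norm_mul, norm_mul, Complex.norm_I, one_mul, Complex.norm_real, Real.norm_eq_abs]
    exact mul_le_mul h1 (b.norm_le_seminorm ℝ _) (norm_nonneg _) (by positivity)
  · refine ((fderiv ℝ b (x + cr Y)).le_opNorm _).trans ?_
    have := b.norm_iteratedFDeriv_le_seminorm ℝ 1 (x + cr Y)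
    rw [norm_iteratedFDeriv_one] at this
    exact mul_le_mul this ((hle _ _).trans hY') (norm_nonneg _) (apply_nonneg _ _)

theorem tendsto_weylL2_apply {Y : ℝ → Phase ι} {t : ℝ} (hY : ContinuousAt Y t) {b : ℝ → L2 ι}
    (hb : ContinuousAt b t) :
    Filter.Tendsto (fun s => weylL2 (Y s) (b s)) (nhds t) (nhds (weylL2 (Y t) (b t))) := by
  have h1 : Filter.Tendsto (fun s => weylL2 (Y s) (b t)) (nhds t) (nhds (weylL2 (Y t) (b t))) :=
    ((continuous_weylL2 (b t)).tendsto (Y t)).comp hY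
  have h2 : Filter.Tendsto (fun s => weylL2 (Y s) (b s - b t)) (nhds t) (nhds 0) := by
    rw [tendsto_zero_iff_norm_tendsto_zero]
    simp only [norm_weylL2]
    exact tendsto_iff_norm_sub_tendsto_zero.1 hb
  have h3 := h2.add h1
  simp only [← map_add, sub_add_cancel, zero_add] at h3
  exact h3

variable [DecidableEq ι]

/-- The Schwartz function `b'` such that `d/ds W(Y_s) b = W(Y_s) b'`. -/
def weylGen (Y Y' : Phase ι) (b : 𝓢(Conf ι, ℂ)) : 𝓢(Conf ι, ℂ) :=
  Complex.I • ∑ j, (Y' j : ℂ) • canOp j b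
    - (Complex.I * ((1 / 2 * (Y' ⬝ᵥ (sympJ ι *ᵥ Y)) : ℝ) : ℂ)) • b

theorem fderiv_eq_sum_lineDeriv (b : 𝓢(Conf ι, ℂ)) (x v : Conf ι) :
    fderiv ℝ b x v = ∑ j, (v j : ℂ) * (∂_{(Pi.single j 1 : Conf ι)} b) x := by
  conv_lhs => rw [pi_eq_sum_univ' v]
  rw [map_sum]
  refine Finset.sum_congr rfl fun j _ => ?_
  rw [map_smul, Complex.real_smul, SchwartzMap.lineDerivOp_apply_eq_fderiv]

/-- The operators Y·X̂ and Y'·X̂ do not commute, but their commutator is a scalar; the derivative of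
W(Y) is W(Y) applied to iY'·X̂ corrected by that scalar. This is how `weylGen` arises. -/
theorem weylFunDeriv_eq (Y Y' : Phase ι) (b : 𝓢(Conf ι, ℂ)) (x : Conf ι) :
    weylFunDeriv Y Y' b x = weylS Y (weylGen Y Y' b) x := by
  rw [weylS_apply, weylFun, weylFunDeriv]
  congr 1
  have hJ : Y' ⬝ᵥ (sympJ ι *ᵥ Y) = cl Y' ⬝ᵥ cr Y - cr Y' ⬝ᵥ cl Y := by
    rw [dotProduct_sum_split]
    have h1 : restrictCLM Sum.inl (sympJ ι *ᵥ Y) = cr Y := by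
      ext i
      exact sympJ_mulVec_inl Y i
    have h2 : restrictCLM Sum.inr (sympJ ι *ᵥ Y) = -cl Y := by
      ext i
      exact sympJ_mulVec_inr Y i
    rw [h1, h2, dotProduct_neg, ← sub_eq_add_neg]
  have hsum : (∑ j, (Y' j : ℂ) • canOp j b) (x + cr Y)
      = (((x + cr Y) ⬝ᵥ cl Y' : ℝ) : ℂ) * b (x + cr Y)
        - Complex.I * fderiv ℝ b (x + cr Y) (cr Y') := by
    rw [_root_.sum_apply, Fintype.sum_sum_type, fderiv_eq_sum_lineDeriv, dotProduct, Finset.mul_sum,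
      sub_eq_add_neg, ← Finset.sum_neg_distrib]
    push_cast
    rw [Finset.sum_mul]
    congr 1
    · refine Finset.sum_congr rfl fun i _ => ?_
      simp only [Pi.smul_apply, canOp, positionOp_apply, smul_eq_mul, restrictCLM_apply]
      ring
    · refine Finset.sum_congr rfl fun i _ => ?_
      simp only [_root_.smul_apply, Pi.smul_apply, canOp, momentumOp, smul_eq_mul, restrictCLM_apply]
      ring
  simp only [weylGen, _root_.sub_apply, _root_.smul_apply, smul_eq_mul]
  rw [hsum, hJ, weylPhaseDeriv, add_dotProduct, dotProduct_comm (cr Y) (cl Y'),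
    dotProduct_comm (cr Y') (cl Y)]
  push_cast
  linear_combination (fderiv ℝ b (x + cr Y) (cr Y')) * Complex.I_sq

/-- Differentiation under the integral: Y and Y' are bounded on the unit ball around t, and the
linear growth in x of the phase derivative is absorbed by the Schwartz function a. -/
theorem hasDerivAt_inner_weylL2 {Y Y' : ℝ → Phase ι} (hY : ∀ s, HasDerivAt Y (Y' s) s)
    (hY' : Continuous Y') (a b : 𝓢(Conf ι, ℂ)) (t : ℝ) :
    HasDerivAt (fun s => inner ℂ (a.toLp 2 volume) (weylL2 (Y s) (b.toLp 2 volume)))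
      (inner ℂ (a.toLp 2 volume)
        (weylL2 (Y t) ((weylGen (Y t) (Y' t) b).toLp 2 volume))) t := by
  have hYc : Continuous Y := continuous_iff_continuousAt.2 fun s => (hY s).continuousAt
  obtain ⟨R, hR⟩ : ∃ R : ℝ, ∀ s ∈ Metric.closedBall t 1, ‖Y s‖ ≤ R ∧ ‖Y' s‖ ≤ R := by
    obtain ⟨R, hR⟩ := (isCompact_closedBall t 1).exists_bound_of_continuousOn
      (hYc.prodMk hY').continuousOn
    exact ⟨R, fun s hs => ⟨(le_max_left _ _).trans (hR s hs), (le_max_right _ _).trans (hR s hs)⟩⟩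
  have hval : inner ℂ (a.toLp 2 volume)
        (weylL2 (Y t) ((weylGen (Y t) (Y' t) b).toLp 2 volume))
      = ∫ x, weylFunDeriv (Y t) (Y' t) b x * (starRingEnd ℂ) (a x) := by
    rw [inner_toLp_weylL2]
    simp only [weylFunDeriv_eq, weylS_apply]
  rw [hval]
  simp only [inner_toLp_weylL2]
  set bound : Conf ι → ℝ := fun x => ((Fintype.card ι * (‖x‖ * R) + Fintype.card ι * (R * R)) *
      SchwartzMap.seminorm ℝ 0 0 b + SchwartzMap.seminorm ℝ 0 1 b * R) * ‖a x‖ with hb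
  have hbound : Integrable bound := by
    have i1 := (a.integrable_pow_mul volume 1).const_mul
      (Fintype.card ι * R * SchwartzMap.seminorm ℝ 0 0 b)
    have i2 := (a.integrable (μ := volume)).norm.const_mul (Fintype.card ι * (R * R) *
      SchwartzMap.seminorm ℝ 0 0 b + SchwartzMap.seminorm ℝ 0 1 b * R)
    refine (i1.add i2).congr (.of_forall fun x => ?_)
    simp only [hb, Pi.add_apply, pow_one]
    ring
  have hmeas : ∀ Z : Phase ι, AEStronglyMeasurable
      (fun x => weylFun Z b x * (starRingEnd ℂ) (a x)) volume := fun Z =>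
    (aestronglyMeasurable_weylFun Z b.continuous.aestronglyMeasurable).mul
      (Complex.continuous_conj.comp a.continuous).aestronglyMeasurable
  refine (hasDerivAt_integral_of_dominated_loc_of_deriv_le (bound := bound)
    (F := fun s x => weylFun (Y s) b x * (starRingEnd ℂ) (a x))
    (F' := fun s x => weylFunDeriv (Y s) (Y' s) b x * (starRingEnd ℂ) (a x))
    (Metric.ball_mem_nhds t zero_lt_one) (.of_forall fun s => hmeas (Y s)) ?_ ?_ ?_ hbound ?_).2
  · refine Integrable.mono' ((a.integrable (μ := volume)).norm.const_mul
      (SchwartzMap.seminorm ℝ 0 0 b)) (hmeas (Y t)) (.of_forall fun x => ?_)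
    rw [norm_mul, norm_weylFun, RCLike.norm_conj]
    exact mul_le_mul_of_nonneg_right (b.norm_le_seminorm ℝ _) (norm_nonneg _)
  · simp only [weylFunDeriv_eq]
    exact ((weylS (Y t) (weylGen (Y t) (Y' t) b)).continuous.mul
      (Complex.continuous_conj.comp a.continuous)).aestronglyMeasurable
  · refine .of_forall fun x s hs => ?_
    obtain ⟨h1, h2⟩ := hR s (Metric.ball_subset_closedBall hs)
    rw [norm_mul, RCLike.norm_conj]
    exact mul_le_mul_of_nonneg_right (norm_weylFunDeriv_le _ _ b x h1 h2) (norm_nonneg _)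
  · exact .of_forall fun x s _ => (hasDerivAt_weylFun (hY s) b x).mul_const _

/-- A product rule although s ↦ W(Y_s) is only strongly continuous. The increment is split into
those of a, of b and of W, in this order; strong continuity handles the first two, and only the
third needs the vectors at time t to be Schwartz. -/
theorem hasDerivAt_inner_weylL2_apply {Y Y' : ℝ → Phase ι} (hY : ∀ s, HasDerivAt Y (Y' s) s)
    (hY' : Continuous Y') {a b : ℝ → L2 ι} {a' b' : L2 ι} {t : ℝ} (ha : HasDerivAt a a' t)
    (hb : HasDerivAt b b' t) {φ ψ : 𝓢(Conf ι, ℂ)} (hφ : a t = φ.toLp 2 volume)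
    (hψ : b t = ψ.toLp 2 volume) :
    HasDerivAt (fun s => inner ℂ (a s) (weylL2 (Y s) (b s)))
      (inner ℂ a' (weylL2 (Y t) (b t)) + inner ℂ (a t) (weylL2 (Y t) b')
        + inner ℂ (φ.toLp 2 volume)
          (weylL2 (Y t) ((weylGen (Y t) (Y' t) ψ).toLp 2 volume))) t := by
  rw [hasDerivAt_iff_tendsto_slope]
  have hYt : ContinuousAt Y t := (hY t).continuousAt
  have t1 : Filter.Tendsto (fun s => inner ℂ (slope a t s) (weylL2 (Y s) (b s)))
      (nhdsWithin t {t}ᶜ) (nhds (inner ℂ a' (weylL2 (Y t) (b t)))) :=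
    (hasDerivAt_iff_tendsto_slope.1 ha).inner
      ((tendsto_weylL2_apply hYt hb.continuousAt).mono_left nhdsWithin_le_nhds)
  have t2 : Filter.Tendsto (fun s => inner ℂ (weylL2 (-Y s) (a t)) (slope b t s))
      (nhdsWithin t {t}ᶜ) (nhds (inner ℂ (a t) (weylL2 (Y t) b'))) := by
    rw [inner_weylL2_right]
    exact ((tendsto_weylL2_apply (Y := fun s => -Y s) hYt.neg
      (continuousAt_const (y := a t))).mono_left nhdsWithin_le_nhds).inner
      (hasDerivAt_iff_tendsto_slope.1 hb)
  have t3 := hasDerivAt_iff_tendsto_slope.1 (hasDerivAt_inner_weylL2 hY hY' φ ψ t)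
  rw [← hφ, ← hψ] at t3
  rw [← hφ]
  refine ((t1.add t2).add t3).congr fun s => ?_
  simp only [slope, vsub_eq_sub, ← inner_weylL2_right]
  rw [← algebraMap_smul ℂ (s - t)⁻¹ (a s - a t), ← algebraMap_smul ℂ (s - t)⁻¹ (b s - b t)]
  simp only [map_smul, map_sub, inner_smul_left, inner_smul_right, inner_sub_left, inner_sub_right,
    Complex.real_smul, Complex.coe_algebraMap, Complex.conj_ofReal]
  ring

end WeylDeriv

/-! ## Linear Hamiltonian flows -/

section Flow

/-- Entrywise differentiability of a curve of matrices. -/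
def HasMatrixDerivAt {α β : Type} (A : ℝ → Matrix α β ℝ) (A' : Matrix α β ℝ) (t : ℝ) : Prop :=
  ∀ i j, HasDerivAt (fun s => A s i j) (A' i j) t

namespace HasMatrixDerivAt

variable {α β γ : Type} {A : ℝ → Matrix α β ℝ} {A' : Matrix α β ℝ} {t : ℝ}

theorem const (C : Matrix α β ℝ) (t : ℝ) : HasMatrixDerivAt (fun _ => C) 0 t :=
  fun i j => hasDerivAt_const t (C i j)

theorem transpose (hA : HasMatrixDerivAt A A' t) : HasMatrixDerivAt (fun s => (A s)ᵀ) A'ᵀ t :=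
  fun i j => hA j i

theorem mul [Fintype β] (hA : HasMatrixDerivAt A A' t) {B : ℝ → Matrix β γ ℝ} {B' : Matrix β γ ℝ}
    (hB : HasMatrixDerivAt B B' t) :
    HasMatrixDerivAt (fun s => A s * B s) (A' * B t + A t * B') t := fun i j => by
  simp only [mul_apply, Matrix.add_apply, ← Finset.sum_add_distrib]
  exact HasDerivAt.fun_sum fun k _ => (hA i k).mul (hB k j)

theorem mulVec [Fintype β] (hA : HasMatrixDerivAt A A' t) (y : β → ℝ) :
    HasDerivAt (fun s => A s *ᵥ y) (A' *ᵥ y) t :=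
  hasDerivAt_pi.2 fun i => HasDerivAt.fun_sum fun k _ => (hA i k).mul_const (y k)

theorem continuous {A' : ℝ → Matrix α β ℝ} (hA : ∀ t, HasMatrixDerivAt A (A' t) t) :
    Continuous A :=
  continuous_matrix fun i j => continuous_iff_continuousAt.2 fun t => (hA t i j).continuousAt

theorem eq_of_deriv_zero (hA : ∀ t, HasMatrixDerivAt A 0 t) (s t : ℝ) : A s = A t := by
  ext i j
  exact is_const_of_deriv_eq_zero (fun t => (hA t i j).differentiableAt)
    (fun t => (hA t i j).deriv) s t

end HasMatrixDerivAt

variable {κ : Type} [Fintype κ] [DecidableEq κ] {J : Matrix κ κ ℝ} {M Φ : ℝ → Matrix κ κ ℝ}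

theorem IsHamiltonianFlow.hasMatrixDerivAt (h : IsHamiltonianFlow J M Φ) (t : ℝ) :
    HasMatrixDerivAt Φ (J * M t * Φ t) t := h.2 t

theorem IsHamiltonianFlow.continuous (h : IsHamiltonianFlow J M Φ) : Continuous Φ :=
  HasMatrixDerivAt.continuous h.hasMatrixDerivAt

/-- The flow is symplectic: the derivative of ΦᵀJΦ vanishes because M is symmetric and J² = -1. -/
theorem IsHamiltonianFlow.transpose_mul_mul (h : IsHamiltonianFlow J M Φ) (hJ : J * J = -1)
    (hJt : Jᵀ = -J) (hM : ∀ t, (M t).IsSymm) (t : ℝ) : (Φ t)ᵀ * J * Φ t = J := by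
  have h0 : (Φ 0)ᵀ * J * Φ 0 = J := by rw [h.1]; simp
  refine (HasMatrixDerivAt.eq_of_deriv_zero (A := fun s => (Φ s)ᵀ * J * Φ s) (fun s => ?_)
    t 0).trans h0
  have h1 := ((h.hasMatrixDerivAt s).transpose.mul (HasMatrixDerivAt.const J s)).mul
    (h.hasMatrixDerivAt s)
  convert h1 using 1
  simp only [Matrix.transpose_mul, hJt, (hM s).eq, Matrix.mul_zero, add_zero]
  have e : (Φ s)ᵀ * J * (J * M s * Φ s) = -((Φ s)ᵀ * M s * Φ s) := by
    rw [Matrix.mul_assoc J, ← Matrix.mul_assoc _ J, Matrix.mul_assoc _ J J, hJ]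
    simp [Matrix.mul_assoc]
  have e2 : (Φ s)ᵀ * (M s * -J) * J * Φ s = (Φ s)ᵀ * M s * Φ s := by
    rw [Matrix.mul_neg, Matrix.mul_neg, ← Matrix.mul_assoc, Matrix.neg_mul, Matrix.mul_assoc _ J J,
      hJ]
    simp
  rw [e, e2, add_neg_cancel]

theorem IsHamiltonianFlow.mul_eq_one (h : IsHamiltonianFlow J M Φ) (hJ : J * J = -1)
    (hJt : Jᵀ = -J) (hM : ∀ t, (M t).IsSymm) (t : ℝ) : Φ t * (-(J * (Φ t)ᵀ * J)) = 1 := by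
  refine mul_eq_one_comm.1 ?_
  have := h.transpose_mul_mul hJ hJt hM t
  rw [Matrix.neg_mul, Matrix.mul_assoc J, Matrix.mul_assoc J, this, hJ, neg_neg]

theorem IsHamiltonianFlow.isUnit (h : IsHamiltonianFlow J M Φ) (hJ : J * J = -1)
    (hJt : Jᵀ = -J) (hM : ∀ t, (M t).IsSymm) (t : ℝ) : IsUnit (Φ t) :=
  IsUnit.of_mul_eq_one _ (h.mul_eq_one hJ hJt hM t)

theorem IsHamiltonianFlow.mul_mul_transpose (h : IsHamiltonianFlow J M Φ) (hJ : J * J = -1)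
    (hJt : Jᵀ = -J) (hM : ∀ t, (M t).IsSymm) (t : ℝ) : Φ t * J * (Φ t)ᵀ = J := by
  have := congrArg (· * J) (h.mul_eq_one hJ hJt hM t)
  simp only [Matrix.mul_neg, Matrix.neg_mul, Matrix.mul_assoc, hJ, Matrix.mul_one, neg_neg,
    Matrix.one_mul] at this
  rw [Matrix.mul_assoc, this]

theorem sympJ_mul_self (ι : Type) [Fintype ι] [DecidableEq ι] : sympJ ι * sympJ ι = -1 := by
  simp only [sympJ, fromBlocks_multiply]
  rw [← fromBlocks_one, fromBlocks_neg]
  simp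

theorem transpose_sympJ (ι : Type) [Fintype ι] [DecidableEq ι] : (sympJ ι)ᵀ = -sympJ ι := by
  simp [sympJ, fromBlocks_transpose, fromBlocks_neg]

/-- Relabelling the coordinates of a linear Hamiltonian flow. -/
theorem IsHamiltonianFlow.submatrix (h : IsHamiltonianFlow J M Φ) {σ : Type} [Fintype σ]
    [DecidableEq σ] (e : σ ≃ κ) :
    IsHamiltonianFlow (J.submatrix e e) (fun t => (M t).submatrix e e)
      (fun t => (Φ t).submatrix e e) := by
  refine ⟨by simp [h.1], fun t i j => ?_⟩
  rw [submatrix_mul_equiv, submatrix_mul_equiv]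
  exact h.2 t (e i) (e j)

/-- The total system is ordered as (x, ξ, y, η) classically but as positions before momenta in the
Weyl calculus; the relabelling carries one standard symplectic matrix to the other. -/
theorem totalJ_submatrix_regroup (d N : ℕ) :
    (totalJ d N).submatrix (regroup (Fin d) (Fin N)).symm (regroup (Fin d) (Fin N)).symm
      = sympJ (Fin d ⊕ Fin N) := by
  ext i j
  rcases i with (i | i) | (i | i) <;> rcases j with (j | j) | (j | j) <;>
    simp [totalJ, sympJ, regroup, Matrix.one_apply]

end Flow

/-! ## Quadratic Hamiltonians and Weyl operators -/

section Metaplectic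

variable {ι : Type} [Fintype ι]

theorem toLp_sub (f g : 𝓢(Conf ι, ℂ)) :
    (f - g).toLp 2 (volume : Measure (Conf ι)) = f.toLp 2 volume - g.toLp 2 volume :=
  map_sub (SchwartzMap.toLpCLM ℂ ℂ 2 (volume : Measure (Conf ι))) f g

theorem toLp_add (f g : 𝓢(Conf ι, ℂ)) :
    (f + g).toLp 2 (volume : Measure (Conf ι)) = f.toLp 2 volume + g.toLp 2 volume :=
  map_add (SchwartzMap.toLpCLM ℂ ℂ 2 (volume : Measure (Conf ι))) f g

theorem toLp_smul (c : ℂ) (f : 𝓢(Conf ι, ℂ)) :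
    (c • f).toLp 2 (volume : Measure (Conf ι)) = c • f.toLp 2 volume :=
  map_smul (SchwartzMap.toLpCLM ℂ ℂ 2 (volume : Measure (Conf ι))) c f

theorem toLp_sum {σ : Type} (s : Finset σ) (f : σ → 𝓢(Conf ι, ℂ)) :
    (∑ i ∈ s, f i).toLp 2 (volume : Measure (Conf ι)) = ∑ i ∈ s, (f i).toLp 2 volume :=
  map_sum (SchwartzMap.toLpCLM ℂ ℂ 2 (volume : Measure (Conf ι))) f s

variable [DecidableEq ι]

/-- The quantization of the quadratic form `½ X·M X`. -/
def hamOp (M : Matrix (PIdx ι) (PIdx ι) ℝ) (f : 𝓢(Conf ι, ℂ)) : 𝓢(Conf ι, ℂ) :=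
  ∑ j, ∑ k, ((1 / 2 : ℂ) * (M j k : ℂ)) • canOp j (canOp k f)

theorem canonicalOp_eq {d N : ℕ} (j : TIdx d N) : canonicalOp j = canOp (regroup _ _ j) := by
  rcases j with (j | j) | (j | j) <;> rfl

theorem quantumHam_eq {d N : ℕ} (M : Matrix (TIdx d N) (TIdx d N) ℝ)
    (f : 𝓢(Conf (Fin d ⊕ Fin N), ℂ)) :
    quantumHam M f
      = hamOp (M.submatrix (regroup (Fin d) (Fin N)).symm (regroup (Fin d) (Fin N)).symm) f := by
  rw [quantumHam, hamOp, ← (regroup (Fin d) (Fin N)).sum_comp]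
  refine Finset.sum_congr rfl fun j _ => ?_
  rw [← (regroup (Fin d) (Fin N)).sum_comp]
  refine Finset.sum_congr rfl fun k _ => ?_
  simp only [canonicalOp_eq, submatrix_apply, Equiv.symm_apply_apply]

theorem inner_hamOp {M : Matrix (PIdx ι) (PIdx ι) ℝ} (hM : M.IsSymm) (φ ψ : 𝓢(Conf ι, ℂ)) :
    inner ℂ ((hamOp M φ).toLp 2 (volume : Measure (Conf ι))) (ψ.toLp 2 volume)
      = inner ℂ (φ.toLp 2 volume) ((hamOp M ψ).toLp 2 volume) := by
  simp only [hamOp, toLp_sum, toLp_smul, sum_inner, inner_sum, inner_smul_left, inner_smul_right,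
    inner_canOp]
  rw [Finset.sum_comm]
  refine Finset.sum_congr rfl fun j _ => Finset.sum_congr rfl fun k _ => ?_
  rw [hM.apply, map_mul, Complex.conj_ofReal]
  simp only [one_div, map_inv₀, Complex.conj_ofNat]

/-- Conjugation shifts X̂ by -c with c = JY, so the quadratic form becomes ½(X̂ - c)·M(X̂ - c).
Symmetry of M merges the two cross terms. -/
theorem hamOp_weylS {M : Matrix (PIdx ι) (PIdx ι) ℝ} (hM : M.IsSymm) (Y : Phase ι)
    (f : 𝓢(Conf ι, ℂ)) :
    hamOp M (weylS Y f) = weylS Y (hamOp M f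
      - ∑ j, (((M *ᵥ (sympJ ι *ᵥ Y)) j : ℝ) : ℂ) • canOp j f
      + ((1 / 2 * ((M *ᵥ (sympJ ι *ᵥ Y)) ⬝ᵥ (sympJ ι *ᵥ Y)) : ℝ) : ℂ) • f) := by
  set c := sympJ ι *ᵥ Y with hc
  have h1 : ∀ j k, canOp j (canOp k (weylS Y f)) = weylS Y (canOp j (canOp k f)
      - (c k : ℂ) • canOp j f - (c j : ℂ) • canOp k f + ((c j : ℂ) * (c k : ℂ)) • f) := by
    intro j k
    rw [canOp_weylS, canOp_weylS, canOp_sub, canOp_smul, ← hc]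
    congr 1
    module
  simp only [hamOp, h1, ← map_smul, ← map_sum]
  congr 1
  simp only [smul_add, smul_sub, Finset.sum_add_distrib, Finset.sum_sub_distrib]
  have e1 : ∑ j, ∑ k, ((1 / 2 : ℂ) * (M j k : ℂ)) • (c k : ℂ) • canOp j f
      = (1 / 2 : ℂ) • ∑ j, (((M *ᵥ c) j : ℝ) : ℂ) • canOp j f := by
    rw [Finset.smul_sum]
    refine Finset.sum_congr rfl fun j _ => ?_
    rw [mulVec, dotProduct]
    push_cast
    rw [Finset.sum_smul, Finset.smul_sum]
    refine Finset.sum_congr rfl fun k _ => ?_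
    module
  have e2 : ∑ j, ∑ k, ((1 / 2 : ℂ) * (M j k : ℂ)) • (c j : ℂ) • canOp k f
      = (1 / 2 : ℂ) • ∑ j, (((M *ᵥ c) j : ℝ) : ℂ) • canOp j f := by
    rw [Finset.sum_comm, ← e1]
    refine Finset.sum_congr rfl fun j _ => Finset.sum_congr rfl fun k _ => ?_
    rw [hM.apply]
  have e3 : ∑ j, ∑ k, ((1 / 2 : ℂ) * (M j k : ℂ)) • ((c j : ℂ) * (c k : ℂ)) • f
      = ((1 / 2 * ((M *ᵥ c) ⬝ᵥ c) : ℝ) : ℂ) • f := by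
    simp only [smul_smul, ← Finset.sum_smul]
    congr 1
    simp only [dotProduct, mulVec]
    push_cast
    simp only [Finset.mul_sum, Finset.sum_mul]
    refine Finset.sum_congr rfl fun j _ => Finset.sum_congr rfl fun k _ => ?_
    ring
  rw [e1, e2, e3]
  module

/-- The Schrödinger evolution of `L²` vectors by a quadratic Hamiltonian. -/
structure IsQuadraticEvolution (M : ℝ → Matrix (PIdx ι) (PIdx ι) ℝ)
    (U : ℝ → (L2 ι →L[ℂ] L2 ι)) : Prop where
  init : U 0 = 1
  schrodinger : ∀ ψ : 𝓢(Conf ι, ℂ), ∃ φ : ℝ → 𝓢(Conf ι, ℂ),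
    ∀ t, U t (ψ.toLp 2 volume) = (φ t).toLp 2 volume ∧
      HasDerivAt (fun s => U s (ψ.toLp 2 volume))
        ((-Complex.I) • (hamOp (M t) (φ t)).toLp 2 volume) t

variable {M : ℝ → Matrix (PIdx ι) (PIdx ι) ℝ} {U : ℝ → (L2 ι →L[ℂ] L2 ι)}

/-- The commutator of the Hamiltonian with W(Y) leaves a linear and a scalar term, and the equation
Ẏ = MJY is exactly the one for which the derivative of W(Y) cancels them. -/
theorem IsQuadraticEvolution.hasDerivAt_inner_weylL2 (hU : IsQuadraticEvolution M U)
    (hM : ∀ t, (M t).IsSymm) {Y : ℝ → Phase ι}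
    (hY : ∀ s, HasDerivAt Y (M s *ᵥ (sympJ ι *ᵥ Y s)) s)
    (hYc : Continuous fun s => M s *ᵥ (sympJ ι *ᵥ Y s)) (χ ψ : 𝓢(Conf ι, ℂ)) (t : ℝ) :
    HasDerivAt (fun s => inner ℂ (U s (χ.toLp 2 volume)) (weylL2 (Y s) (U s (ψ.toLp 2 volume))))
      0 t := by
  obtain ⟨φ, hφ⟩ := hU.schrodinger χ
  obtain ⟨η, hη⟩ := hU.schrodinger ψ
  refine (hasDerivAt_inner_weylL2_apply hY hYc (hφ t).2 (hη t).2 (hφ t).1 (hη t).1).congr_deriv ?_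
  rw [(hφ t).1, (hη t).1]
  simp only [map_smul, inner_smul_left, inner_smul_right, weylL2_toLp]
  rw [inner_hamOp (hM t), hamOp_weylS (hM t)]
  simp only [weylGen, map_add, map_sub, map_smul, toLp_add, toLp_sub, toLp_smul, inner_add_right,
    inner_sub_right, inner_smul_right, map_neg, Complex.conj_I]
  ring

/-- Conjugation by the evolution of a quadratic Hamiltonian acts on Weyl operators by the
transpose of the classical flow. -/
theorem IsQuadraticEvolution.inner_weylL2 (hU : IsQuadraticEvolution M U)
    (hM : ∀ t, (M t).IsSymm) (hMc : Continuous M) {Φ : ℝ → Matrix (PIdx ι) (PIdx ι) ℝ}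
    (hΦ : IsHamiltonianFlow (sympJ ι) M Φ) (t : ℝ) (y : Phase ι) (f g : L2 ι) :
    inner ℂ (U t f) (weylL2 y (U t g)) = inner ℂ f (weylL2 ((Φ t)ᵀ *ᵥ y) g) := by
  have hJ := sympJ_mul_self ι
  have hJt := transpose_sympJ ι
  set J := sympJ ι
  -- Since Φ_s is symplectic, -JΦ_sJ is the inverse transpose of Φ_s. Thus Y_s = Φ_s⁻ᵀ Φ_tᵀ y solves
  -- Ẏ = MJY and joins Φ_tᵀ y at time 0 to y at time t.
  set Y : ℝ → Phase ι := fun s => (-(J * Φ s * J)) *ᵥ ((Φ t)ᵀ *ᵥ y) with hYdef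
  have hJY : ∀ s, J *ᵥ Y s = (Φ s * J) *ᵥ ((Φ t)ᵀ *ᵥ y) := fun s => by
    change J *ᵥ ((-(J * Φ s * J)) *ᵥ _) = _
    rw [mulVec_mulVec, Matrix.mul_assoc J (Φ s), Matrix.mul_neg, ← Matrix.mul_assoc J J, hJ,
      Matrix.neg_mul, Matrix.one_mul, neg_neg]
  have hY : ∀ s, HasDerivAt Y (M s *ᵥ (J *ᵥ Y s)) s := fun s => by
    rw [hJY]
    have h1 := ((HasMatrixDerivAt.const (-J) s).mul (hΦ.hasMatrixDerivAt s)).mul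
      (HasMatrixDerivAt.const J s)
    have h2 := h1.mulVec ((Φ t)ᵀ *ᵥ y)
    simp only [Matrix.zero_mul, Matrix.mul_zero, add_zero, zero_add] at h2
    have e : -J * (J * M s * Φ s) * J = M s * Φ s * J := by
      rw [Matrix.neg_mul, ← Matrix.mul_assoc, ← Matrix.mul_assoc, hJ]
      simp
    rw [e] at h2
    convert h2 using 1
    · ext s : 1
      simp [hYdef]
    · simp only [mulVec_mulVec, Matrix.mul_assoc]
  have hYc : Continuous fun s => M s *ᵥ (J *ᵥ Y s) := by
    simp only [hJY]
    have := hΦ.continuous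
    fun_prop
  have hY0 : Y 0 = (Φ t)ᵀ *ᵥ y := by
    rw [hYdef]
    beta_reduce
    rw [hΦ.1, Matrix.mul_one, hJ, neg_neg, one_mulVec]
  have hYt : Y t = y := by
    rw [hYdef]
    beta_reduce
    rw [mulVec_mulVec, Matrix.neg_mul, Matrix.mul_assoc J, Matrix.mul_assoc J,
      hΦ.mul_mul_transpose hJ hJt hM, hJ, neg_neg, one_mulVec]
  have key : ∀ χ ψ : 𝓢(Conf ι, ℂ),
      inner ℂ (U t (χ.toLp 2 volume)) (weylL2 y (U t (ψ.toLp 2 volume)))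
        = inner ℂ (χ.toLp 2 volume) (weylL2 ((Φ t)ᵀ *ᵥ y) (ψ.toLp 2 volume)) := fun χ ψ => by
    have hd := hU.hasDerivAt_inner_weylL2 hM hY hYc χ ψ
    have := is_const_of_deriv_eq_zero (fun s => (hd s).differentiableAt) (fun s => (hd s).deriv) t 0
    simp only [hU.init, hY0, hYt] at this
    exact this
  refine dense_toLp.induction_on₂ (p := fun f g => inner ℂ (U t f) (weylL2 y (U t g))
    = inner ℂ f (weylL2 ((Φ t)ᵀ *ᵥ y) g)) ?_ key f g
  exact isClosed_eq (by fun_prop) (by fun_prop)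

theorem IsPropagator.isQuadraticEvolution {d N : ℕ} {M : ℝ → Matrix (TIdx d N) (TIdx d N) ℝ}
    {U : ℝ → (L2 (Fin d ⊕ Fin N) →L[ℂ] L2 (Fin d ⊕ Fin N))} (hU : IsPropagator M U) :
    IsQuadraticEvolution (fun t => (M t).submatrix (regroup (Fin d) (Fin N)).symm
      (regroup (Fin d) (Fin N)).symm) U :=
  ⟨hU.init, fun ψ => by simpa only [quantumHam_eq] using hU.schrodinger ψ⟩

end Metaplectic

/-! ## Traces -/

section TraceFormula

variable {H : Type} [NormedAddCommGroup H] [InnerProductSpace ℂ H]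

/-- Cauchy–Schwarz and Bessel. The bound is uniform in the finite set, hence gives absolute
summability over the basis even when the index set is not known to be countable. -/
theorem HilbertBasis.sum_norm_inner_mul_inner_le {I : Type} (b : HilbertBasis I ℂ H) (x y : H)
    (s : Finset I) : ∑ i ∈ s, ‖inner ℂ x (b i) * inner ℂ (b i) y‖ ≤ ‖x‖ * ‖y‖ := by
  have hx := b.orthonormal.sum_inner_products_le (s := s) x
  have hy := b.orthonormal.sum_inner_products_le (s := s) y
  simp only [norm_mul, norm_inner_symm x]
  refine (Real.sum_mul_le_sqrt_mul_sqrt s _ _).trans ?_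
  exact mul_le_mul (Real.sqrt_le_iff.2 ⟨norm_nonneg _, hx⟩) (Real.sqrt_le_iff.2 ⟨norm_nonneg _, hy⟩)
    (Real.sqrt_nonneg _) (norm_nonneg _)

variable [CompleteSpace H]

/-- The trace of `(∑ |α_n⟩⟨β_n|) C` is `∑ ⟨β_n, C α_n⟩`. -/
theorem IsTraceRep.trace_mul {A : H →L[ℂ] H} {α β : ℕ → H} (h : IsTraceRep A α β) (C : H →L[ℂ] H)
    {τ : ℂ} (hτ : HasTrace (A * C) τ) : ∑' n, inner ℂ (β n) (C (α n)) = τ := by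
  obtain ⟨w, b, -⟩ := exists_hilbertBasis ℂ H
  set x : ℕ → H := fun n => ContinuousLinearMap.adjoint C (β n) with hx
  set F : ℕ × w → ℂ := fun p => inner ℂ (x p.1) (b p.2) * inner ℂ (b p.2) (α p.1) with hF
  have hxn : ∀ n, ‖x n‖ * ‖α n‖ ≤ ‖C‖ * (‖α n‖ * ‖β n‖) := fun n => by
    have := (ContinuousLinearMap.adjoint C).le_opNorm (β n)
    rw [LinearIsometryEquiv.norm_map] at this
    nlinarith [norm_nonneg (α n)]
  -- Absolute summability over pairs lets the double series be summed both ways: over the basis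
  -- first it gives ⟨β_n, C α_n⟩ by Parseval, over n first it gives the diagonal elements of AC.
  have hFs : Summable F := by
    refine Summable.of_norm ((summable_prod_of_nonneg fun _ => norm_nonneg _).2 ⟨fun n => ?_, ?_⟩)
    · exact summable_of_sum_le (fun _ => norm_nonneg _)
        (b.sum_norm_inner_mul_inner_le (x n) (α n))
    · refine Summable.of_nonneg_of_le (fun n => tsum_nonneg fun _ => norm_nonneg _) (fun n => ?_)
        (h.1.mul_left ‖C‖)
      refine le_trans ?_ (hxn n)
      exact Real.tsum_le_of_sum_le (fun _ => norm_nonneg _)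
        (b.sum_norm_inner_mul_inner_le (x n) (α n))
  have h1 : ∑' p, F p = ∑' n, inner ℂ (β n) (C (α n)) := by
    rw [hFs.tsum_prod]
    refine tsum_congr fun n => ?_
    refine (b.tsum_inner_mul_inner (x n) (α n)).trans ?_
    rw [hx, ContinuousLinearMap.adjoint_inner_left]
  have h2 : ∑' p, F p = τ := by
    refine ((Equiv.prodComm w ℕ).tsum_eq F).symm.trans
      ((Summable.tsum_prod ((Equiv.prodComm w ℕ).summable_iff.2 hFs)).trans ?_)
    rw [← (hτ.2 w b).tsum_eq]
    refine tsum_congr fun i => ?_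
    have h3 := ((h.2 (C (b i))).mapL (innerSL ℂ (b i))).tsum_eq
    rw [innerSL_apply_apply] at h3
    change _ = inner ℂ (b i) (A (C (b i)))
    rw [← h3]
    refine tsum_congr fun n => ?_
    simp only [innerSL_apply_apply, inner_smul_right]
    rw [← ContinuousLinearMap.adjoint_inner_left]
    rfl
  rw [← h1, h2]

theorem IsTraceRep.conj {A : H →L[ℂ] H} {α β : ℕ → H} (h : IsTraceRep A α β) {V : H →L[ℂ] H}
    (hV : V ∈ unitary (H →L[ℂ] H)) :
    IsTraceRep (V * A * star V) (fun n => V (α n)) (fun n => V (β n)) := by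
  refine ⟨?_, fun ψ => ?_⟩
  · simpa only [ContinuousLinearMap.norm_map_of_mem_unitary hV] using h.1
  · have := (h.2 ((star V) ψ)).mapL V
    simp only [map_smul, ContinuousLinearMap.star_eq_adjoint,
      ContinuousLinearMap.adjoint_inner_right] at this
    exact this

end TraceFormula

/-! ## The characteristic function of the reduced state -/

section Reduced

variable {ι κ : Type}

/-- The phase-space point `(z, u)` of a composite system. -/
abbrev ungroup (X : PIdx ι ⊕ PIdx κ → ℝ) : Phase (ι ⊕ κ) := restrictCLM (regroup ι κ).symm X

theorem sysPart_ungroup (X : PIdx ι ⊕ PIdx κ → ℝ) :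
    sysPart (ungroup X) = restrictCLM Sum.inl X := by
  ext i
  rcases i with i | i <;> rfl

theorem envPart_ungroup (X : PIdx ι ⊕ PIdx κ → ℝ) :
    envPart (ungroup X) = restrictCLM Sum.inr X := by
  ext i
  rcases i with i | i <;> rfl

variable [Fintype ι] [Fintype κ]

theorem submatrix_regroup_mulVec_ungroup (T : Matrix (PIdx ι ⊕ PIdx κ) (PIdx ι ⊕ PIdx κ) ℝ)
    (X : PIdx ι ⊕ PIdx κ → ℝ) :
    (T.submatrix (regroup ι κ).symm (regroup ι κ).symm) *ᵥ ungroup X = ungroup (T *ᵥ X) := by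
  ext i
  exact (regroup ι κ).symm.sum_comp (fun k => T ((regroup ι κ).symm i) k * X k)

/-- Makes the Weyl operators W(y) admissible test operators in the definition of the partial trace.
-/
theorem isTensorOp_weylL2 (y : Phase ι) :
    IsTensorOp (weylL2 y) 1 (weylL2 (ungroup (Sum.elim y 0 : PIdx ι ⊕ PIdx κ → ℝ))) := by
  intro φ η
  rw [weylL2_tensorL2, sysPart_ungroup, envPart_ungroup]
  have h1 : restrictCLM Sum.inl (Sum.elim y 0 : PIdx ι ⊕ PIdx κ → ℝ) = y := rfl
  have h2 : restrictCLM Sum.inr (Sum.elim y 0 : PIdx ι ⊕ PIdx κ → ℝ) = 0 := rfl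
  rw [h1, h2, weylL2_zero]
  rfl

theorem IsPartialTrace.traceChar_eq {A : L2 (ι ⊕ κ) →L[ℂ] L2 (ι ⊕ κ)} {R : L2 ι →L[ℂ] L2 ι}
    (h : IsPartialTrace A R) {α β : ℕ → L2 (ι ⊕ κ)} (hA : IsTraceRep A α β) {α' β' : ℕ → L2 ι}
    (hR : IsTraceRep R α' β') (y : Phase ι) :
    traceChar α' β' y = traceChar α β (ungroup (Sum.elim y 0)) := by
  obtain ⟨τ, h1, h2⟩ := h.2.2 _ _ (isTensorOp_weylL2 (κ := κ) y)
  exact (hR.trace_mul _ h1).trans (hA.trace_mul _ h2).symm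

end Reduced

section ReducedFlow

variable {d N : ℕ}

/-- The Weyl symbol of the reduced state in terms of characteristic functions. -/
theorem hasWeylSymbol_reduced {M : ℝ → Matrix (TIdx d N) (TIdx d N) ℝ} (hM : ∀ t, (M t).IsSymm)
    (hMc : Continuous M) {Φ : ℝ → Matrix (TIdx d N) (TIdx d N) ℝ}
    (hΦ : IsHamiltonianFlow (totalJ d N) M Φ)
    {U : ℝ → (L2 (Fin d ⊕ Fin N) →L[ℂ] L2 (Fin d ⊕ Fin N))} (hU : IsPropagator M U)
    {RS : L2 (Fin d) →L[ℂ] L2 (Fin d)} {RE : L2 (Fin N) →L[ℂ] L2 (Fin N)}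
    {R₀ : L2 (Fin d ⊕ Fin N) →L[ℂ] L2 (Fin d ⊕ Fin N)} (hR₀ : IsTensorOp RS RE R₀)
    {f : 𝓢(Phase (Fin d), ℂ)} {g : 𝓢(Phase (Fin N), ℂ)} (hS : HasWeylSymbol RS (symbolOfChar f))
    (hE : HasWeylSymbol RE (symbolOfChar g)) (hTC : IsTraceClass R₀) {t : ℝ}
    {R : L2 (Fin d) →L[ℂ] L2 (Fin d)} (hR : IsPartialTrace (U t * R₀ * star (U t)) R)
    {F : 𝓢(Phase (Fin d), ℂ)} (hF : ∀ y, F y = f ((Φ t).toBlocks₁₁ᵀ *ᵥ y)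
      * g ((Φ t).toBlocks₁₂ᵀ *ᵥ y)) :
    HasWeylSymbol R (symbolOfChar F) := by
  obtain ⟨α, β, hαβ⟩ := hTC
  obtain ⟨α', β', hαβ'⟩ := hR.2.1
  have h0 : IsTraceRep R₀ α β := hαβ
  have hR' : IsTraceRep R α' β' := hαβ'
  refine hR'.hasWeylSymbol fun y => ?_
  rw [hR.traceChar_eq (h0.conj (hU.mem_unitary t)) hR' y]
  have hΦ' := hΦ.submatrix (regroup (Fin d) (Fin N)).symm
  rw [totalJ_submatrix_regroup] at hΦ'
  have key := fun a b => hU.isQuadraticEvolution.inner_weylL2 (fun t => (hM t).submatrix _)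
    (hMc.matrix_submatrix _ _) hΦ' t (ungroup (Sum.elim y 0)) a b
  have e1 : traceChar (fun n => U t (α n)) (fun n => U t (β n)) (ungroup (Sum.elim y 0))
      = traceChar α β (ungroup ((Φ t)ᵀ *ᵥ (Sum.elim y 0))) := by
    refine tsum_congr fun n => ?_
    rw [key, transpose_submatrix, submatrix_regroup_mulVec_ungroup]
  rw [e1, traceChar_eq_tensorChar hR₀ hS hE h0, tensorChar, sysPart_ungroup, envPart_ungroup, hF]
  have e2 : (Φ t)ᵀ *ᵥ (Sum.elim y 0)
      = Sum.elim ((Φ t).toBlocks₁₁ᵀ *ᵥ y) ((Φ t).toBlocks₁₂ᵀ *ᵥ y) := by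
    conv_lhs => rw [← fromBlocks_toBlocks (Φ t), fromBlocks_transpose, fromBlocks_mulVec]
    simp only [Sum.elim_comp_inl, Sum.elim_comp_inr, mulVec_zero, add_zero]
  rw [e2]
  rfl

end ReducedFlow

/-! ## Schwartz functions along a curve of injective matrices -/

section LinearPullback

variable {κ σ : Type} [Fintype κ]

/-- Multiplication by a matrix as a continuous linear map. -/
def mulVecCLM : Matrix σ κ ℝ →ₗ[ℝ] ((κ → ℝ) →L[ℝ] (σ → ℝ)) where
  toFun A := LinearMap.toContinuousLinearMap A.mulVecLin
  map_add' A B := by ext : 1; exact add_mulVec A B _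
  map_smul' c A := by ext : 1; exact smul_mulVec c A _

theorem mulVecCLM_apply (A : Matrix σ κ ℝ) (y : κ → ℝ) : mulVecCLM A y = A *ᵥ y := rfl

variable [Fintype σ]

theorem continuous_mulVecCLM : Continuous (mulVecCLM : Matrix σ κ ℝ →ₗ[ℝ] _) :=
  LinearMap.continuous_of_finiteDimensional _

theorem norm_mulVec_le (A : Matrix σ κ ℝ) (y : κ → ℝ) : ‖A *ᵥ y‖ ≤ ‖mulVecCLM A‖ * ‖y‖ :=
  (mulVecCLM A).le_opNorm y

/-- A left inverse bounds the argument by its image, which is the properness needed for a pullback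
of a Schwartz function to be Schwartz. -/
theorem norm_le_mulVec [DecidableEq κ] {A : Matrix σ κ ℝ} {B : Matrix κ σ ℝ} (h : B * A = 1)
    (y : κ → ℝ) : ‖y‖ ≤ ‖mulVecCLM B‖ * ‖A *ᵥ y‖ := by
  simpa only [mulVec_mulVec, h, one_mulVec] using norm_mulVec_le B (A *ᵥ y)

/-- The pullback of a Schwartz function by a matrix with a left inverse. -/
def pullbackS [DecidableEq κ] (F : 𝓢(σ → ℝ, ℂ)) {A : Matrix σ κ ℝ} {B : Matrix κ σ ℝ}
    (h : B * A = 1) : 𝓢(κ → ℝ, ℂ) :=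
  SchwartzMap.compCLM ℂ (mulVecCLM A).hasTemperateGrowth (g := mulVecCLM A)
    ⟨1, ‖mulVecCLM B‖, fun y => (norm_le_mulVec h y).trans <| by
      rw [pow_one, mulVecCLM_apply]
      gcongr
      linarith⟩ F

theorem pullbackS_apply [DecidableEq κ] (F : 𝓢(σ → ℝ, ℂ)) {A : Matrix σ κ ℝ} {B : Matrix κ σ ℝ}
    (h : B * A = 1) (y : κ → ℝ) : pullbackS F h y = F (A *ᵥ y) := rfl

theorem SchwartzMap.exists_pow_mul_norm_fderiv_le (F : 𝓢(σ → ℝ, ℂ)) (n : ℕ) :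
    ∃ K, 0 ≤ K ∧ ∀ x, (1 + ‖x‖) ^ n * ‖fderiv ℝ F x‖ ≤ K := by
  have h := SchwartzMap.one_add_le_sup_seminorm_apply (𝕜 := ℝ) (m := (n, 1)) le_rfl le_rfl F
  simp only [norm_iteratedFDeriv_one] at h
  exact ⟨_, le_trans (by positivity) (h 0), h⟩

theorem continuous_cexp_neg_dotProduct (z : κ → ℝ) :
    Continuous fun y : κ → ℝ => Complex.exp (-Complex.I * ((y ⬝ᵥ z : ℝ) : ℂ)) := by
  simp only [dotProduct]
  fun_prop

/-- Differentiation of the Fourier transform of `F ∘ A_s` in `s`. -/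
theorem hasDerivAt_piFT_pullback [DecidableEq κ] (F : 𝓢(σ → ℝ, ℂ)) {A A' : ℝ → Matrix σ κ ℝ}
    {B : ℝ → Matrix κ σ ℝ} (hA : ∀ s, HasMatrixDerivAt A (A' s) s) (hA' : Continuous A')
    (hB : Continuous B) (hBA : ∀ s, B s * A s = 1) (z : κ → ℝ) (t : ℝ) :
    HasDerivAt (fun s => piFT (fun y => F (A s *ᵥ y)) z)
      (piFT (fun y => fderiv ℝ F (A t *ᵥ y) (A' t *ᵥ y)) z) t := by
  obtain ⟨R, hR⟩ : ∃ R : ℝ, ∀ s ∈ Metric.closedBall t 1,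
      ‖mulVecCLM (B s)‖ ≤ R ∧ ‖mulVecCLM (A' s)‖ ≤ R := by
    obtain ⟨R, hR⟩ := (isCompact_closedBall t 1).exists_bound_of_continuousOn
      ((continuous_mulVecCLM.comp hB).prodMk (continuous_mulVecCLM.comp hA')).continuousOn
    exact ⟨R, fun s hs => ⟨(le_max_left _ _).trans (hR s hs), (le_max_right _ _).trans (hR s hs)⟩⟩
  have hR0 : 0 ≤ R := (norm_nonneg _).trans (hR t (Metric.mem_closedBall_self zero_le_one)).1
  set n := (volume : Measure (κ → ℝ)).integrablePower
  -- One power more than integrability requires, because the factor ‖A'_s y‖ grows linearly in y.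
  obtain ⟨K, hK0, hK⟩ := F.exists_pow_mul_norm_fderiv_le (n + 1)
  set bound : (κ → ℝ) → ℝ := fun y => (R * (1 + R) ^ (n + 1) * K) * (1 + ‖y‖) ^ (-(n : ℝ))
    with hbound
  have hbd : ∀ s ∈ Metric.closedBall t 1, ∀ y : κ → ℝ,
      ‖fderiv ℝ F (A s *ᵥ y) (A' s *ᵥ y)‖ ≤ bound y := fun s hs y => by
    obtain ⟨h1, h2⟩ := hR s hs
    have h3 : 1 + ‖y‖ ≤ (1 + R) * (1 + ‖A s *ᵥ y‖) := by
      have := (norm_le_mulVec (hBA s) y).trans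
        (mul_le_mul_of_nonneg_right h1 (norm_nonneg (A s *ᵥ y)))
      nlinarith [norm_nonneg (A s *ᵥ y)]
    have h4 : ‖A' s *ᵥ y‖ ≤ R * (1 + ‖y‖) :=
      (norm_mulVec_le _ _).trans (mul_le_mul h2 (by linarith) (norm_nonneg _) hR0)
    have h5 : (1 + ‖y‖) ^ (n + 1) * ‖fderiv ℝ F (A s *ᵥ y)‖ ≤ (1 + R) ^ (n + 1) * K := by
      calc _ ≤ ((1 + R) * (1 + ‖A s *ᵥ y‖)) ^ (n + 1) * ‖fderiv ℝ F (A s *ᵥ y)‖ := by gcongr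
        _ = (1 + R) ^ (n + 1) * ((1 + ‖A s *ᵥ y‖) ^ (n + 1) * ‖fderiv ℝ F (A s *ᵥ y)‖) := by
          rw [mul_pow, mul_assoc]
        _ ≤ _ := by gcongr; exact hK _
    have hy : 0 < 1 + ‖y‖ := by positivity
    rw [hbound]
    beta_reduce
    rw [Real.rpow_neg hy.le, Real.rpow_natCast, ← div_eq_mul_inv, le_div_iff₀ (by positivity)]
    calc ‖fderiv ℝ F (A s *ᵥ y) (A' s *ᵥ y)‖ * (1 + ‖y‖) ^ n
        ≤ ‖fderiv ℝ F (A s *ᵥ y)‖ * (R * (1 + ‖y‖)) * (1 + ‖y‖) ^ n := by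
          gcongr
          exact ((fderiv ℝ F (A s *ᵥ y)).le_opNorm _).trans (by gcongr)
      _ = R * ((1 + ‖y‖) ^ (n + 1) * ‖fderiv ℝ F (A s *ᵥ y)‖) := by ring
      _ ≤ R * ((1 + R) ^ (n + 1) * K) := by gcongr
      _ = _ := by ring
  have hcont : ∀ s, Continuous fun y : κ → ℝ => F (A s *ᵥ y) := fun s =>
    F.continuous.comp (mulVecCLM (A s)).continuous
  have hphase := continuous_cexp_neg_dotProduct z
  refine (hasDerivAt_integral_of_dominated_loc_of_deriv_le (bound := bound)
    (F := fun s y => Complex.exp (-Complex.I * ((y ⬝ᵥ z : ℝ) : ℂ)) * F (A s *ᵥ y))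
    (F' := fun s y => Complex.exp (-Complex.I * ((y ⬝ᵥ z : ℝ) : ℂ)) *
      fderiv ℝ F (A s *ᵥ y) (A' s *ᵥ y))
    (Metric.ball_mem_nhds t zero_lt_one)
    (.of_forall fun s => (hphase.mul (hcont s)).aestronglyMeasurable) ?_ ?_ ?_ ?_ ?_).2
  · refine (pullbackS F (hBA t)).integrable.bdd_mul (c := 1) hphase.aestronglyMeasurable
      (.of_forall fun y => ?_)
    rw [norm_cexp_neg_I_mul_ofReal]
  · have h1 : Continuous fun y : κ → ℝ => fderiv ℝ F (A t *ᵥ y) :=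
      ((F.smooth 1).continuous_fderiv one_ne_zero).comp (mulVecCLM (A t)).continuous
    exact (hphase.mul (h1.clm_apply (mulVecCLM (A' t)).continuous)).aestronglyMeasurable
  · refine .of_forall fun y s hs => ?_
    rw [norm_mul, norm_cexp_neg_I_mul_ofReal, one_mul]
    exact hbd s (Metric.ball_subset_closedBall hs) y
  · exact (Measure.integrable_pow_neg_integrablePower _).const_mul _
  · refine .of_forall fun y s _ => HasDerivAt.const_mul _ ?_
    exact (F.hasFDerivAt (A s *ᵥ y)).comp_hasDerivAt s ((hA s).mulVec y)

end LinearPullback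

/-! ## The generator in Fourier space -/

section Generator

variable {κ : Type} [Fintype κ]

theorem coe_positionOp (k : κ) (f : 𝓢(κ → ℝ, ℂ)) :
    (fun w : κ → ℝ => (w k : ℂ) * f w) = positionOp k f :=
  funext fun w => (positionOp_apply k f w).symm

variable [DecidableEq κ]

theorem pderivAt_eq (k : κ) (f : 𝓢(κ → ℝ, ℂ)) :
    pderivAt k f = ∂_{(Pi.single k 1 : κ → ℝ)} f := by
  ext z
  rw [SchwartzMap.lineDerivOp_apply_eq_fderiv, pderivAt]

theorem piFTS_lineDeriv (f : 𝓢(κ → ℝ, ℂ)) (k : κ) :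
    piFTS (∂_{(Pi.single k 1 : κ → ℝ)} f) = Complex.I • positionOp k (piFTS f) := by
  rw [positionOp_piFTS, momentumOp, piFTS_smul, smul_smul]
  simp

theorem piFTS_positionOp (f : 𝓢(κ → ℝ, ℂ)) (k : κ) :
    piFTS (positionOp k f) = Complex.I • ∂_{(Pi.single k 1 : κ → ℝ)} (piFTS f) := by
  rw [lineDeriv_piFTS, piFTS_smul, smul_smul]
  simp

/-- The generator `f ↦ -K y · ∇f - i (v·y) f - (y·B y) f`. -/
def charGenerator (K B : Matrix κ κ ℝ) (v : κ → ℝ) (f : 𝓢(κ → ℝ, ℂ)) : 𝓢(κ → ℝ, ℂ) :=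
  ∑ j, ∑ k, (-(K j k : ℂ)) • positionOp k (∂_{(Pi.single j 1 : κ → ℝ)} f)
    + ∑ j, ∑ k, (-(B j k : ℂ)) • positionOp k (positionOp j f)
    + ∑ j, (-Complex.I * (v j : ℂ)) • positionOp j f

theorem charGenerator_apply (K B : Matrix κ κ ℝ) (v : κ → ℝ) (f : 𝓢(κ → ℝ, ℂ)) (y : κ → ℝ) :
    charGenerator K B v f y = -fderiv ℝ f y (K *ᵥ y) - ((y ⬝ᵥ (B *ᵥ y) : ℝ) : ℂ) * f y
      - Complex.I * ((y ⬝ᵥ v : ℝ) : ℂ) * f y := by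
  rw [fderiv_eq_sum_lineDeriv]
  simp only [charGenerator, _root_.add_apply, _root_.sum_apply, _root_.smul_apply, smul_eq_mul,
    positionOp_apply, mulVec, dotProduct]
  push_cast
  simp only [Finset.mul_sum, Finset.sum_mul, sub_eq_add_neg, ← Finset.sum_neg_distrib]
  congr 1
  · congr 1
    · refine Finset.sum_congr rfl fun j _ => Finset.sum_congr rfl fun k _ => ?_
      ring
    · refine Finset.sum_congr rfl fun j _ => Finset.sum_congr rfl fun k _ => ?_
      ring
  · refine Finset.sum_congr rfl fun j _ => ?_
    ring

theorem piFTS_charGenerator (K B : Matrix κ κ ℝ) (v : κ → ℝ) (f : 𝓢(κ → ℝ, ℂ)) (z : κ → ℝ) :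
    piFTS (charGenerator K B v f) z = driftTerm K (piFTS f) z + diffusionTerm B (piFTS f) z
      + transportTerm v (piFTS f) z := by
  simp only [charGenerator, piFTS_add, piFTS_sum, piFTS_smul, piFTS_positionOp, piFTS_lineDeriv,
    LineDeriv.lineDerivOp_smul, smul_smul]
  simp only [driftTerm, diffusionTerm, transportTerm, coe_positionOp, pderivAt_eq,
    _root_.add_apply, _root_.sum_apply, _root_.smul_apply, smul_eq_mul]
  congr 1
  · congr 1
    · refine Finset.sum_congr rfl fun j _ => Finset.sum_congr rfl fun k _ => ?_
      linear_combination (-(K j k : ℂ) * (∂_{(Pi.single k 1 : κ → ℝ)} (positionOp j (piFTS f))) z)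
        * Complex.I_sq
    · refine Finset.sum_congr rfl fun j _ => Finset.sum_congr rfl fun k _ => ?_
      linear_combination (-(B j k : ℂ) * (∂_{(Pi.single k 1 : κ → ℝ)}
        (∂_{(Pi.single j 1 : κ → ℝ)} (piFTS f))) z) * Complex.I_sq
  · refine Finset.sum_congr rfl fun j _ => ?_
    linear_combination (-(v j : ℂ) * (∂_{(Pi.single j 1 : κ → ℝ)} (piFTS f)) z) * Complex.I_sq

theorem driftTerm_add (A B : Matrix κ κ ℝ) (f : (κ → ℝ) → ℂ) (z : κ → ℝ) :
    driftTerm (A + B) f z = driftTerm A f z + driftTerm B f z := by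
  simp only [driftTerm, ← Finset.sum_add_distrib, Matrix.add_apply, Complex.ofReal_add, add_mul]

theorem pderivAt_mul_coord (j k : κ) (f : 𝓢(κ → ℝ, ℂ)) (z : κ → ℝ) :
    pderivAt k (fun w => (w j : ℂ) * f w) z
      = (if j = k then f z else 0) + (z j : ℂ) * pderivAt k f z := by
  have h1 : HasFDerivAt (fun w : κ → ℝ => (w j : ℂ))
      (Complex.ofRealCLM.comp (ContinuousLinearMap.proj j)) z :=
    (Complex.ofRealCLM.comp (ContinuousLinearMap.proj (R := ℝ) (φ := fun _ : κ => ℝ) j)).hasFDerivAt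
  rw [pderivAt, (h1.fun_mul (f.hasFDerivAt z)).fderiv, pderivAt]
  by_cases h : j = k
  · subst h
    simp
    ring
  · simp [h]

theorem quadHam_pderivAt {M : Matrix κ κ ℝ} (hM : M.IsSymm) (k : κ) (z : κ → ℝ) :
    pderivAt k (quadHam M) z = (((M *ᵥ z) k : ℝ) : ℂ) := by
  set e : κ → ℝ := Pi.single k 1 with he
  have h1 : HasDerivAt (fun s : ℝ => z + s • e) e 0 := by
    simpa using ((hasDerivAt_id (0 : ℝ)).smul_const e).const_add z
  have h2 : HasDerivAt (fun s : ℝ => M *ᵥ (z + s • e)) (M *ᵥ e) 0 :=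
    (mulVecCLM M).hasFDerivAt.comp_hasDerivAt 0 h1
  have h3 : HasLineDerivAt ℝ (quadHam M) (((M *ᵥ z) k : ℝ) : ℂ) z e := by
    refine ((hasDerivAt_dotProduct h1 h2).const_mul (1 / 2)).ofReal_comp.congr_deriv ?_
    have hs : z ⬝ᵥ (M *ᵥ e) = e ⬝ᵥ (M *ᵥ z) := by
      rw [dotProduct_mulVec, ← mulVec_transpose, hM.eq, dotProduct_comm]
    rw [zero_smul, add_zero, hs, he, single_one_dotProduct]
    push_cast
    ring
  have h4 : Differentiable ℝ (quadHam M) := by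
    unfold quadHam
    simp only [dotProduct, mulVec]
    fun_prop
  rw [pderivAt, ← (h4 z).lineDeriv_eq_fderiv, h3.lineDeriv]

/-- Splits the divergence-form drift into its zeroth-order part, the trace, and the derivative along
the vector field Aᵀz. Only the latter survives for a Hamiltonian vector field. -/
theorem driftTerm_eq (A : Matrix κ κ ℝ) (f : 𝓢(κ → ℝ, ℂ)) (z : κ → ℝ) :
    driftTerm A f z = (A.trace : ℂ) * f z + ∑ k, (((Aᵀ *ᵥ z) k : ℝ) : ℂ) * pderivAt k f z := by
  simp only [driftTerm, pderivAt_mul_coord, mul_add, Finset.sum_add_distrib]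
  congr 1
  · simp only [mul_ite, mul_zero, Finset.sum_ite_eq, Finset.mem_univ, if_true, trace, diag_apply]
    push_cast
    rw [Finset.sum_mul]
  · rw [Finset.sum_comm]
    refine Finset.sum_congr rfl fun k _ => ?_
    simp only [mulVec, dotProduct, transpose_apply]
    push_cast
    rw [Finset.sum_mul]
    exact Finset.sum_congr rfl fun j _ => by ring

end Generator

/-! ### The Poisson bracket with a quadratic Hamiltonian -/

section Poisson

variable {ι : Type} [Fintype ι] [DecidableEq ι]

/-- The Liouville term is a drift term. -/
theorem poissonBracket_quadHam {M : Matrix (PIdx ι) (PIdx ι) ℝ} (hM : M.IsSymm)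
    (f : 𝓢(Phase ι, ℂ)) (z : Phase ι) :
    poissonBracket (quadHam M) f z = driftTerm (M * sympJ ι) f z := by
  -- The trace of a symmetric matrix times an antisymmetric one is its own negative: Hamiltonian
  -- vector fields have zero divergence.
  have htr : (M * sympJ ι).trace = 0 := by
    have := trace_transpose (M * sympJ ι)
    rw [Matrix.transpose_mul, hM.eq, transpose_sympJ, Matrix.neg_mul, trace_neg, trace_mul_comm]
      at this
    linarith
  rw [driftTerm_eq, htr, Complex.ofReal_zero, zero_mul, zero_add, Matrix.transpose_mul, hM.eq,
    transpose_sympJ, Matrix.neg_mul, neg_mulVec, ← mulVec_mulVec, Fintype.sum_sum_type,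
    ← Finset.sum_add_distrib, poissonBracket]
  refine Finset.sum_congr rfl fun j _ => ?_
  simp only [quadHam_pderivAt hM, Pi.neg_apply, sympJ_mulVec_inl, sympJ_mulVec_inr, neg_neg]
  push_cast
  ring

end Poisson

/-! ## The critical time -/

section CriticalTime

theorem criticalTime_pos {κ : Type} [Fintype κ] [DecidableEq κ] {K : ℝ → Matrix κ κ ℝ}
    (hK : Continuous K) (h0 : K 0 = 1) : 0 < criticalTime K := by
  have h1 : ∀ᶠ t in nhds (0 : ℝ), (K t).det ≠ 0 :=
    hK.matrix_det.continuousAt.eventually_ne (by rw [h0]; simp)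
  obtain ⟨ε, hε, h⟩ := Metric.eventually_nhds_iff.1 h1
  refine lt_of_lt_of_le (EReal.coe_pos.2 hε) (le_sSup fun t ht htε => ?_)
  rw [isUnit_iff_isUnit_det, isUnit_iff_ne_zero]
  refine h ?_
  rw [Real.dist_eq, sub_zero, abs_of_nonneg ht]
  exact EReal.coe_lt_coe_iff.1 htε

theorem isUnit_of_lt_criticalTime {κ : Type} [Fintype κ] [DecidableEq κ] {K : ℝ → Matrix κ κ ℝ}
    {t : ℝ} (ht : 0 ≤ t) (h : (t : EReal) < criticalTime K) : IsUnit (K t) := by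
  obtain ⟨T, hT, htT⟩ := lt_sSup_iff.1 h
  exact hT t ht htT

variable {d N : ℕ} {ΦS : ℝ → Matrix (PIdx (Fin d)) (PIdx (Fin d)) ℝ}
  {ΦE : ℝ → Matrix (PIdx (Fin N)) (PIdx (Fin N)) ℝ} {Φ : ℝ → Matrix (TIdx d N) (TIdx d N) ℝ}

/-- The free flow is block diagonal, so Ψ_ii is Φ_ii up to the invertible factor Φ_S⁻¹. The critical
time therefore controls the invertibility of Φ_ii. -/
theorem interactingFlow_toBlocks₁₁ {t : ℝ} (hS : IsUnit (ΦS t)) (hE : IsUnit (ΦE t)) :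
    (interactingFlow ΦS ΦE Φ t).toBlocks₁₁ = (ΦS t)⁻¹ * (Φ t).toBlocks₁₁ := by
  have h1 := mul_nonsing_inv _ ((isUnit_iff_isUnit_det _).1 hS)
  have h2 := mul_nonsing_inv _ ((isUnit_iff_isUnit_det _).1 hE)
  have hinv : (fromBlocks (ΦS t) 0 0 (ΦE t))⁻¹ = fromBlocks (ΦS t)⁻¹ 0 0 (ΦE t)⁻¹ := by
    refine inv_eq_right_inv ?_
    rw [fromBlocks_multiply, h1, h2]
    simp
  rw [interactingFlow, hinv]
  conv_lhs => rw [← fromBlocks_toBlocks (Φ t), fromBlocks_multiply]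
  rw [toBlocks_fromBlocks₁₁, Matrix.zero_mul, add_zero]

theorem continuous_toBlocks₁₁ {A : ℝ → Matrix (TIdx d N) (TIdx d N) ℝ} (hA : Continuous A) :
    Continuous fun t => (A t).toBlocks₁₁ := hA.matrix_submatrix Sum.inl Sum.inl

variable {MS : ℝ → Matrix (PIdx (Fin d)) (PIdx (Fin d)) ℝ}
  {ME : ℝ → Matrix (PIdx (Fin N)) (PIdx (Fin N)) ℝ} {M : ℝ → Matrix (TIdx d N) (TIdx d N) ℝ}
  {J : Matrix (TIdx d N) (TIdx d N) ℝ}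

theorem criticalTime_interactingFlow_pos (hMS : ∀ t, (MS t).IsSymm) (hME : ∀ t, (ME t).IsSymm)
    (hΦS : IsHamiltonianFlow (sympJ (Fin d)) MS ΦS) (hΦE : IsHamiltonianFlow (sympJ (Fin N)) ME ΦE)
    (hΦ : IsHamiltonianFlow J M Φ) :
    0 < criticalTime (fun t => (interactingFlow ΦS ΦE Φ t).toBlocks₁₁) := by
  have hS := hΦS.isUnit (sympJ_mul_self _) (transpose_sympJ _) hMS
  have hE := hΦE.isUnit (sympJ_mul_self _) (transpose_sympJ _) hME
  have hinv : ∀ t, (ΦS t)⁻¹ = -(sympJ (Fin d) * (ΦS t)ᵀ * sympJ (Fin d)) := fun t =>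
    inv_eq_right_inv (hΦS.mul_eq_one (sympJ_mul_self _) (transpose_sympJ _) hMS t)
  simp only [fun t => interactingFlow_toBlocks₁₁ (Φ := Φ) (hS t) (hE t), hinv]
  have hc := hΦS.continuous
  have hc2 := continuous_toBlocks₁₁ hΦ.continuous
  refine criticalTime_pos (by fun_prop) ?_
  rw [hΦS.1, hΦ.1, transpose_one, Matrix.mul_one, sympJ_mul_self, neg_neg, Matrix.one_mul]
  rw [← fromBlocks_one, toBlocks_fromBlocks₁₁]

theorem isUnit_toBlocks₁₁ (hMS : ∀ t, (MS t).IsSymm) (hME : ∀ t, (ME t).IsSymm)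
    (hΦS : IsHamiltonianFlow (sympJ (Fin d)) MS ΦS) (hΦE : IsHamiltonianFlow (sympJ (Fin N)) ME ΦE)
    {t : ℝ} (ht : 0 ≤ t)
    (htc : (t : EReal) < criticalTime (fun t => (interactingFlow ΦS ΦE Φ t).toBlocks₁₁)) :
    IsUnit (Φ t).toBlocks₁₁ := by
  have hS := hΦS.isUnit (sympJ_mul_self _) (transpose_sympJ _) hMS t
  have hE := hΦE.isUnit (sympJ_mul_self _) (transpose_sympJ _) hME t
  have h := isUnit_of_lt_criticalTime ht htc
  rw [interactingFlow_toBlocks₁₁ hS hE] at h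
  have := hS.mul h
  rwa [← Matrix.mul_assoc, mul_nonsing_inv _ ((isUnit_iff_isUnit_det _).1 hS), Matrix.one_mul]
    at this

end CriticalTime

/-! ## Gaussian states -/

section GaussianState

variable {ι : Type} [Fintype ι] [DecidableEq ι] {Γ : Matrix (PIdx ι) (PIdx ι) ℝ}

/-- Phase space has dimension twice the number of degrees of freedom, so the Gaussian factor
(2π)^{dim/2} is exactly the normalization removed by `symbolOfChar`. -/
theorem symbolOfChar_gaussCharS (hΓ : Γ.PosDef) (m : Phase ι) :
    (symbolOfChar (gaussCharS hΓ m) : Phase ι → ℂ) = gaussianSymbol Γ m := by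
  ext z
  rw [symbolOfChar_apply, piFT_gaussCharS, ← mul_assoc]
  have hc : ((Fintype.card (PIdx ι) : ℂ) / 2) = (Fintype.card ι : ℂ) := by
    rw [Fintype.card_sum]
    push_cast
    ring
  have h : ((2 * Real.pi : ℝ) : ℂ) ^ ((Fintype.card (PIdx ι) : ℂ) / 2) = twoPiPow ι := by
    rw [hc, Complex.cpow_natCast, twoPiPow, Complex.ofReal_pow]
  rw [h, inv_mul_cancel₀ (twoPiPow_ne_zero ι), one_mul]

variable {κ : Type} [Fintype κ]

theorem hasDerivAt_add_smul (z e : κ → ℝ) : HasDerivAt (fun s : ℝ => z + s • e) e 0 := by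
  simpa using ((hasDerivAt_id (0 : ℝ)).smul_const e).const_add z

variable [DecidableEq κ] {Γ : Matrix κ κ ℝ}

/-- The logarithmic derivative of the Gaussian is affine in u. This is the point at which a Gaussian
environment makes the generator a differential operator of order two. -/
theorem hasLineDerivAt_gaussCharS (hΓ : Γ.PosDef) (m u w : κ → ℝ) :
    HasLineDerivAt ℝ (gaussCharS hΓ m)
      (gaussCharS hΓ m u * (Complex.I * ((w ⬝ᵥ m : ℝ) : ℂ) - ((w ⬝ᵥ (Γ *ᵥ u) : ℝ) : ℂ))) u w := by
  have h1 := hasDerivAt_add_smul u w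
  have h2 : HasDerivAt (fun s : ℝ => Γ *ᵥ (u + s • w)) (Γ *ᵥ w) 0 :=
    (mulVecCLM Γ).hasFDerivAt.comp_hasDerivAt 0 h1
  have h3 := ((hasDerivAt_dotProduct h1 (hasDerivAt_const (0 : ℝ) m)).ofReal_comp.const_mul
    Complex.I).fun_add ((hasDerivAt_dotProduct h1 h2).const_mul (1 / 2)).neg.ofReal_comp
  have hs : u ⬝ᵥ (Γ *ᵥ w) = w ⬝ᵥ (Γ *ᵥ u) := by
    have hsymm : Γᵀ = Γ := by
      rw [← conjTranspose_eq_transpose_of_trivial]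
      exact hΓ.isHermitian
    rw [dotProduct_mulVec, ← mulVec_transpose, hsymm, dotProduct_comm]
  refine h3.cexp.congr_deriv ?_
  rw [gaussCharS_apply, gaussExponent]
  simp only [Pi.neg_apply, zero_smul, add_zero, dotProduct_zero, hs]
  push_cast
  ring

end GaussianState

/-! ## The master equation for the characteristic function -/

section MasterChar

variable {d N : ℕ}

theorem totalJ_mul_self (d N : ℕ) : totalJ d N * totalJ d N = -1 := by
  rw [totalJ, fromBlocks_multiply, ← fromBlocks_one, fromBlocks_neg]
  simp [sympJ_mul_self]

theorem transpose_totalJ (d N : ℕ) : (totalJ d N)ᵀ = -totalJ d N := by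
  rw [totalJ, fromBlocks_transpose, fromBlocks_neg]
  simp [transpose_sympJ]

theorem isSymm_totalHessian {MS : Matrix (PIdx (Fin d)) (PIdx (Fin d)) ℝ}
    {ME : Matrix (PIdx (Fin N)) (PIdx (Fin N)) ℝ} (hMS : MS.IsSymm) (hME : ME.IsSymm)
    (G : Matrix (PIdx (Fin d)) (PIdx (Fin N)) ℝ) : (totalHessian MS ME G).IsSymm := by
  rw [totalHessian, Matrix.IsSymm, fromBlocks_transpose, hMS.eq, hME.eq, transpose_transpose]

/-- The matrix of `y ↦ Tᵀ (y, 0)`. -/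
def reducedMatrix (T : Matrix (TIdx d N) (TIdx d N) ℝ) : Matrix (TIdx d N) (PIdx (Fin d)) ℝ :=
  Tᵀ.submatrix id Sum.inl

theorem reducedMatrix_mulVec (T : Matrix (TIdx d N) (TIdx d N) ℝ) (y : Phase (Fin d)) :
    reducedMatrix T *ᵥ y = Sum.elim (T.toBlocks₁₁ᵀ *ᵥ y) (T.toBlocks₁₂ᵀ *ᵥ y) := by
  ext i
  rcases i with i | i <;> rfl

theorem reducedMatrix_mulVec_eq_transpose_mulVec (T : Matrix (TIdx d N) (TIdx d N) ℝ)
    (y : Phase (Fin d)) : reducedMatrix T *ᵥ y = Tᵀ *ᵥ Sum.elim y 0 := by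
  ext i
  simp [reducedMatrix, mulVec, dotProduct, Fintype.sum_sum_type]

/-- Only invertibility of the full Tᵀ is used, not that of its system block; hence the reduced
characteristic function stays Schwartz at all times. -/
theorem leftInverse_reducedMatrix {T B : Matrix (TIdx d N) (TIdx d N) ℝ} (h : B * Tᵀ = 1) :
    B.submatrix Sum.inl id * reducedMatrix T = 1 := by
  rw [reducedMatrix, ← submatrix_mul _ _ _ _ _ Function.bijective_id, h]
  exact submatrix_one _ Sum.inl_injective

theorem hasLineDerivAt_tensorS_inr (f : 𝓢(Phase (Fin d), ℂ)) {g : 𝓢(Phase (Fin N), ℂ)}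
    {a : Phase (Fin d)} {b w : Phase (Fin N)} {c : ℂ} (hg : HasLineDerivAt ℝ g c b w) :
    HasLineDerivAt ℝ (tensorS f g) (f a * c) (Sum.elim a b) (Sum.elim 0 w) := by
  refine (HasDerivAt.const_mul (f a) hg).congr_of_eventuallyEq (.of_forall fun s => ?_)
  beta_reduce
  rw [tensorS_apply]
  congr 2
  ext i
  simp

variable (Φ M : Matrix (TIdx d N) (TIdx d N) ℝ) (MS : Matrix (PIdx (Fin d)) (PIdx (Fin d)) ℝ)
  (ME : Matrix (PIdx (Fin N)) (PIdx (Fin N)) ℝ) (G : Matrix (PIdx (Fin d)) (PIdx (Fin N)) ℝ)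

/-- The algebraic heart of the master equation. With a = M_S J y and w = Gᵀ J y the velocity is
-Φᵀ(a, w). The vector k = A y is chosen so that Φ_iiᵀ k = Φ_eiᵀ w, which lets the reduced matrix
applied to a + k reproduce the whole system component; the mismatch in the environment component is
the transposed Schur complement applied to w. Invertibility of Φ_ii enters through this choice of k.
-/
theorem reducedMatrix_deriv_mulVec (hMS : MS.IsSymm) (hME : ME.IsSymm)
    (hΦ : IsUnit Φ.toBlocks₁₁) (y : Phase (Fin d)) :
    reducedMatrix (totalJ d N * totalHessian MS ME G * Φ) *ᵥ y
      = -(reducedMatrix Φ *ᵥ ((MS * sympJ (Fin d) + driftCoeff Φ G) *ᵥ y))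
        - (Sum.elim 0 ((schurBlock Φ)ᵀ *ᵥ (Gᵀ *ᵥ (sympJ (Fin d) *ᵥ y))) : TIdx d N → ℝ) := by
  set w := Gᵀ *ᵥ (sympJ (Fin d) *ᵥ y) with hw
  set k := driftCoeff Φ G *ᵥ y with hk
  set a := MS *ᵥ (sympJ (Fin d) *ᵥ y) with ha
  have hk' : k = Φ.toBlocks₁₁⁻¹ᵀ *ᵥ (Φ.toBlocks₂₁ᵀ *ᵥ w) := by
    rw [hk, hw, driftCoeff]
    simp only [mulVec_mulVec, Matrix.transpose_neg, Matrix.transpose_mul, transpose_sympJ,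
      Matrix.mul_neg, neg_neg, Matrix.mul_assoc]
  have hdet := (isUnit_iff_isUnit_det _).1 hΦ
  have hΦk : Φ.toBlocks₁₁ᵀ *ᵥ k = Φ.toBlocks₂₁ᵀ *ᵥ w := by
    rw [hk', mulVec_mulVec, ← transpose_mul, nonsing_inv_mul _ hdet, transpose_one, one_mulVec]
  have hS : (schurBlock Φ)ᵀ *ᵥ w = Φ.toBlocks₂₂ᵀ *ᵥ w - Φ.toBlocks₁₂ᵀ *ᵥ k := by
    rw [schurBlock, hk', transpose_sub, sub_mulVec]
    simp only [mulVec_mulVec, Matrix.transpose_mul, Matrix.mul_assoc]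
  have hlhs : reducedMatrix (totalJ d N * totalHessian MS ME G * Φ) *ᵥ y
      = -(Φᵀ *ᵥ Sum.elim a w) := by
    have h1 : totalHessian MS ME G *ᵥ (totalJ d N *ᵥ Sum.elim y 0) = Sum.elim a w := by
      rw [totalHessian, totalJ, fromBlocks_mulVec, fromBlocks_mulVec]
      simp [ha, hw]
    rw [reducedMatrix_mulVec_eq_transpose_mulVec, ← h1, transpose_mul, transpose_mul, (isSymm_totalHessian hMS hME G).eq,
      transpose_totalJ, Matrix.mul_neg, Matrix.mul_neg, neg_mulVec, mulVec_mulVec, mulVec_mulVec,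
      Matrix.mul_assoc]
  have hblocks : Φᵀ *ᵥ Sum.elim a w = Sum.elim (Φ.toBlocks₁₁ᵀ *ᵥ a + Φ.toBlocks₂₁ᵀ *ᵥ w)
      (Φ.toBlocks₁₂ᵀ *ᵥ a + Φ.toBlocks₂₂ᵀ *ᵥ w) := by
    conv_lhs => rw [← fromBlocks_toBlocks Φ, fromBlocks_transpose, fromBlocks_mulVec]
    simp only [Sum.elim_comp_inl, Sum.elim_comp_inr]
  rw [hlhs, hblocks, reducedMatrix_mulVec, add_mulVec, ← mulVec_mulVec, ← hk, ← ha, hS,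
    mulVec_add, mulVec_add, hΦk]
  ext i
  rcases i with i | i
  · simp
  · simp
    ring

variable {Γ : Matrix (PIdx (Fin N)) (PIdx (Fin N)) ℝ}

/-- The time derivative of the characteristic function of the reduced state. -/
theorem fderiv_tensorS_reducedMatrix (hMS : MS.IsSymm) (hME : ME.IsSymm)
    (hΦ : IsUnit Φ.toBlocks₁₁) (hΓ : Γ.PosDef) (m : Phase (Fin N)) (f : 𝓢(Phase (Fin d), ℂ))
    {B : Matrix (PIdx (Fin d)) (TIdx d N) ℝ} (hB : B * reducedMatrix Φ = 1) (y : Phase (Fin d)) :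
    fderiv ℝ (tensorS f (gaussCharS hΓ m)) (reducedMatrix Φ *ᵥ y)
        (reducedMatrix (totalJ d N * totalHessian MS ME G * Φ) *ᵥ y)
      = charGenerator (MS * sympJ (Fin d) + driftCoeff Φ G) (diffusionCoeff Φ G Γ)
        (transportCoeff Φ G m) (pullbackS (tensorS f (gaussCharS hΓ m)) hB) y := by
  set F := tensorS f (gaussCharS hΓ m) with hF
  set w := Gᵀ *ᵥ (sympJ (Fin d) *ᵥ y) with hw
  set K := MS * sympJ (Fin d) + driftCoeff Φ G
  -- The tangential part of the velocity differentiates the pulled-back function itself (chain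
  -- rule), so it closes on the reduced characteristic function.
  have h1 : fderiv ℝ F (reducedMatrix Φ *ᵥ y) (reducedMatrix Φ *ᵥ (K *ᵥ y))
      = fderiv ℝ (pullbackS F hB) y (K *ᵥ y) := by
    have := (F.hasFDerivAt (reducedMatrix Φ *ᵥ y)).comp y (mulVecCLM (reducedMatrix Φ)).hasFDerivAt
    have h := this.fderiv
    change fderiv ℝ (pullbackS F hB) y = _ at h
    rw [h]
    rfl
  -- The remaining direction has no system component, so only the Gaussian factor is differentiated
  -- and the result is again a multiple of the pulled-back function.
  have h2 : fderiv ℝ F (reducedMatrix Φ *ᵥ y) (Sum.elim 0 ((schurBlock Φ)ᵀ *ᵥ w))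
      = pullbackS F hB y * (Complex.I * ((((schurBlock Φ)ᵀ *ᵥ w) ⬝ᵥ m : ℝ) : ℂ)
        - ((((schurBlock Φ)ᵀ *ᵥ w) ⬝ᵥ (Γ *ᵥ (Φ.toBlocks₁₂ᵀ *ᵥ y)) : ℝ) : ℂ)) := by
    rw [pullbackS_apply, ← F.differentiableAt.lineDeriv_eq_fderiv, reducedMatrix_mulVec,
      (hasLineDerivAt_tensorS_inr f (hasLineDerivAt_gaussCharS hΓ m _ _)).lineDeriv, hF,
      tensorS_apply, ← mul_assoc]
    rfl
  have hv : ((schurBlock Φ)ᵀ *ᵥ w) = -((sympJ (Fin d) * G * schurBlock Φ)ᵀ *ᵥ y) := by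
    rw [hw, transpose_mul, transpose_mul, transpose_sympJ]
    simp only [mulVec_mulVec, Matrix.mul_neg, neg_mulVec, neg_neg]
  have h3 : ((schurBlock Φ)ᵀ *ᵥ w) ⬝ᵥ m = y ⬝ᵥ transportCoeff Φ G m := by
    rw [hv, transportCoeff, neg_dotProduct, dotProduct_neg, mulVec_transpose, ← dotProduct_mulVec]
  have h4 : ((schurBlock Φ)ᵀ *ᵥ w) ⬝ᵥ (Γ *ᵥ (Φ.toBlocks₁₂ᵀ *ᵥ y))
      = -(y ⬝ᵥ (diffusionCoeff Φ G Γ *ᵥ y)) := by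
    -- A quadratic form sees only the symmetric part of its matrix, which is why the diffusion
    -- matrix may be symmetrized.
    have h5 : y ⬝ᵥ (diffusionCoeff Φ G Γ *ᵥ y) = y ⬝ᵥ (diffusionL Φ G Γ *ᵥ y) := by
      have h6 : y ⬝ᵥ ((diffusionL Φ G Γ)ᵀ *ᵥ y) = y ⬝ᵥ (diffusionL Φ G Γ *ᵥ y) := by
        rw [mulVec_transpose, dotProduct_comm, ← dotProduct_mulVec]
      rw [diffusionCoeff, smul_mulVec, dotProduct_smul, add_mulVec, dotProduct_add, h6, smul_eq_mul]
      ring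
    rw [h5, hv, neg_dotProduct, mulVec_transpose, ← dotProduct_mulVec, diffusionL]
    simp only [mulVec_mulVec, Matrix.mul_assoc]
  rw [reducedMatrix_deriv_mulVec Φ MS ME G hMS hME hΦ, map_sub, map_neg, h1, h2, h3, h4,
    charGenerator_apply]
  push_cast
  ring

end MasterChar

/-! ### From characteristic functions back to Weyl symbols -/

theorem charGenerator_smul {κ : Type} [Fintype κ] [DecidableEq κ] (K B : Matrix κ κ ℝ) (v : κ → ℝ)
    (c : ℂ) (f : 𝓢(κ → ℝ, ℂ)) : charGenerator K B v (c • f) = c • charGenerator K B v f := by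
  ext y
  have h : fderiv ℝ (⇑(c • f)) y = c • fderiv ℝ f y := fderiv_const_smul f.differentiableAt c
  simp only [charGenerator_apply, h, _root_.smul_apply, smul_eq_mul]
  ring

theorem symbolOfChar_charGenerator {ι : Type} [Fintype ι] [DecidableEq ι]
    (K B : Matrix (PIdx ι) (PIdx ι) ℝ) (v : Phase ι) (f : 𝓢(Phase ι, ℂ)) (z : Phase ι) :
    symbolOfChar (charGenerator K B v f) z = driftTerm K (symbolOfChar f) z
      + diffusionTerm B (symbolOfChar f) z + transportTerm v (symbolOfChar f) z := by
  simp only [symbolOfChar, ← piFTS_smul]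
  rw [← charGenerator_smul, piFTS_charGenerator]

theorem hasDerivAt_symbolOfChar {ι σ : Type} [Fintype ι] [DecidableEq ι] [Fintype σ]
    (F : 𝓢(σ → ℝ, ℂ)) {A A' : ℝ → Matrix σ (PIdx ι) ℝ} {B : ℝ → Matrix (PIdx ι) σ ℝ}
    (hA : ∀ s, HasMatrixDerivAt A (A' s) s) (hA' : Continuous A') (hB : Continuous B)
    (hBA : ∀ s, B s * A s = 1) {t : ℝ} {f' : 𝓢(Phase ι, ℂ)}
    (hf' : ∀ y, fderiv ℝ F (A t *ᵥ y) (A' t *ᵥ y) = f' y) (z : Phase ι) :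
    HasDerivAt (fun s => symbolOfChar (pullbackS F (hBA s)) z) (symbolOfChar f' z) t := by
  have hd := (hasDerivAt_piFT_pullback F hA hA' hB hBA z t).const_mul (twoPiPow ι)⁻¹
  simp only [hf'] at hd
  simp only [symbolOfChar_apply]
  exact hd

end

/-! ### The master equation for the reduced Weyl symbol -/

theorem mainTheorem5 (d N : ℕ)
    -- the (possibly time-dependent) quadratic Hamiltonians `H_S`, `H_E` and the coupling `z·G u`
    (MS : ℝ → Matrix (PIdx (Fin d)) (PIdx (Fin d)) ℝ)
    (ME : ℝ → Matrix (PIdx (Fin N)) (PIdx (Fin N)) ℝ)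
    (G : ℝ → Matrix (PIdx (Fin d)) (PIdx (Fin N)) ℝ)
    (hMS : Continuous MS) (hME : Continuous ME) (hG : Continuous G)
    (hMSsymm : ∀ t, (MS t).IsSymm) (hMEsymm : ∀ t, (ME t).IsSymm)
    -- the classical flows of `H_S`, `H_E` and `H`
    (ΦS : ℝ → Matrix (PIdx (Fin d)) (PIdx (Fin d)) ℝ)
    (ΦE : ℝ → Matrix (PIdx (Fin N)) (PIdx (Fin N)) ℝ)
    (Φ : ℝ → Matrix (TIdx d N) (TIdx d N) ℝ)
    (hΦS : IsHamiltonianFlow (sympJ (Fin d)) MS ΦS)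
    (hΦE : IsHamiltonianFlow (sympJ (Fin N)) ME ΦE)
    (hΦ : IsHamiltonianFlow (totalJ d N) (fun t => totalHessian (MS t) (ME t) (G t)) Φ)
    -- the quantum propagator of the total system
    (U : ℝ → (L2 (Fin d ⊕ Fin N) →L[ℂ] L2 (Fin d ⊕ Fin N)))
    (hU : IsPropagator (fun t => totalHessian (MS t) (ME t) (G t)) U)
    -- the environment is initially Gaussian with mean `m` and covariance `Γ`
    (Γ : Matrix (PIdx (Fin N)) (PIdx (Fin N)) ℝ) (hΓ : Γ.PosDef) (m : Phase (Fin N))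
    (RE : L2 (Fin N) →L[ℂ] L2 (Fin N)) (hRE : HasWeylSymbol RE (gaussianSymbol Γ m))
    -- the system is initially in a state with Schwartz Weyl symbol
    (ρ₀ : 𝓢(Phase (Fin d), ℂ))
    (RS : L2 (Fin d) →L[ℂ] L2 (Fin d)) (hRS : HasWeylSymbol RS ρ₀)
    -- the total state is initially the product, and `R t` is the reduced state at time `t`
    (R₀ : L2 (Fin d ⊕ Fin N) →L[ℂ] L2 (Fin d ⊕ Fin N)) (hR₀ : IsTensorOp RS RE R₀)
    (R : ℝ → (L2 (Fin d) →L[ℂ] L2 (Fin d)))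
    (hR : ∀ t, IsPartialTrace (U t * R₀ * star (U t)) (R t)) :
    0 < criticalTime (fun t => (interactingFlow ΦS ΦE Φ t).toBlocks₁₁) ∧
    ∃ ρ : ℝ → 𝓢(Phase (Fin d), ℂ),
      (∀ t, HasWeylSymbol (R t) (ρ t)) ∧ ρ 0 = ρ₀ ∧
      ∀ t : ℝ, 0 ≤ t →
        (t : EReal) < criticalTime (fun t => (interactingFlow ΦS ΦE Φ t).toBlocks₁₁) →
        IsUnit (Φ t).toBlocks₁₁ ∧
        ∀ z : Phase (Fin d),
          HasDerivAt (fun s => ρ s z)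
            (poissonBracket (quadHam (MS t)) (ρ t) z
              + driftTerm (driftCoeff (Φ t) (G t)) (ρ t) z
              + diffusionTerm (diffusionCoeff (Φ t) (G t) Γ) (ρ t) z
              + transportTerm (transportCoeff (Φ t) (G t) m) (ρ t) z) t := by
  classical
  set H : ℝ → Matrix (TIdx d N) (TIdx d N) ℝ := fun t => totalHessian (MS t) (ME t) (G t) with hH
  have hHsymm : ∀ t, (H t).IsSymm := fun t => isSymm_totalHessian (hMSsymm t) (hMEsymm t) (G t)
  have hHc : Continuous H := hMS.matrix_fromBlocks hG hG.matrix_transpose hME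
  have hJ := totalJ_mul_self d N
  have hJt := transpose_totalJ d N
  obtain ⟨f, hf⟩ := symbolOfChar_surjective ρ₀
  set g := gaussCharS hΓ m with hg
  have hS : HasWeylSymbol RS (symbolOfChar f) := by rwa [hf]
  have hE : HasWeylSymbol RE (symbolOfChar g) := by rwa [hg, symbolOfChar_gaussCharS]
  -- The partial trace at time 0, where U is the identity, already contains that the initial product
  -- operator is trace class.
  have hTC : IsTraceClass R₀ := by
    have := (hR 0).1
    rwa [hU.init, star_one, one_mul, mul_one] at this
  -- Symplecticity provides an inverse of Φᵀ that is polynomial in Φ, so the left inverses B below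
  -- are defined for all times and visibly continuous.
  have hinv : ∀ t, -(totalJ d N * Φ t * totalJ d N) * (Φ t)ᵀ = 1 := fun t => by
    rw [Matrix.neg_mul, Matrix.mul_assoc (totalJ d N), Matrix.mul_assoc (totalJ d N),
      hΦ.mul_mul_transpose hJ hJt hHsymm, hJ, neg_neg]
  set B : ℝ → Matrix (PIdx (Fin d)) (TIdx d N) ℝ := fun t =>
    (-(totalJ d N * Φ t * totalJ d N)).submatrix Sum.inl id with hB
  have hBA : ∀ t, B t * reducedMatrix (Φ t) = 1 := fun t => leftInverse_reducedMatrix (hinv t)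
  have hΦc := hΦ.continuous
  have hBc : Continuous B :=
    Continuous.matrix_submatrix (A := fun t => -(totalJ d N * Φ t * totalJ d N)) (by fun_prop) _ _
  set F : ℝ → 𝓢(Phase (Fin d), ℂ) := fun t => pullbackS (tensorS f g) (hBA t) with hF
  have hFy : ∀ t y, F t y = f ((Φ t).toBlocks₁₁ᵀ *ᵥ y) * g ((Φ t).toBlocks₁₂ᵀ *ᵥ y) :=
    fun t y => by
      rw [hF]
      beta_reduce
      rw [pullbackS_apply, reducedMatrix_mulVec, tensorS_apply]
      rfl
  refine ⟨criticalTime_interactingFlow_pos hMSsymm hMEsymm hΦS hΦE hΦ,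
    fun t => symbolOfChar (F t),
    fun t => hasWeylSymbol_reduced hHsymm hHc hΦ hU hR₀ hS hE hTC (hR t) (hFy t), ?_,
    fun t ht htc => ?_⟩
  · change symbolOfChar (F 0) = ρ₀
    rw [← hf]
    -- At time 0 the Gaussian factor is evaluated at the origin, where a characteristic function
    -- normalized to unit trace equals 1.
    refine congrArg symbolOfChar (SchwartzMap.ext fun y => ?_)
    have h1 : (1 : Matrix (TIdx d N) (TIdx d N) ℝ).toBlocks₁₁ = 1 := by
      rw [← fromBlocks_one, toBlocks_fromBlocks₁₁]
    have h2 : (1 : Matrix (TIdx d N) (TIdx d N) ℝ).toBlocks₁₂ = 0 := by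
      rw [← fromBlocks_one, toBlocks_fromBlocks₁₂]
    rw [hFy, hΦ.1, h1, h2, transpose_one, one_mulVec, transpose_zero, zero_mulVec, hg,
      gaussCharS_apply]
    simp [gaussExponent]
  · have hu := isUnit_toBlocks₁₁ hMSsymm hMEsymm hΦS hΦE ht htc
    refine ⟨hu, fun z => ?_⟩
    have hval := fun y => fderiv_tensorS_reducedMatrix (Φ t) (MS t) (ME t) (G t) (hMSsymm t)
      (hMEsymm t) hu hΓ m f (hBA t) y
    -- The Liouville term and the coupling drift combine into the single drift matrix M_S J_S + A
    -- occurring in the generator of the characteristic function.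
    rw [poissonBracket_quadHam (hMSsymm t), ← driftTerm_add, ← symbolOfChar_charGenerator]
    exact hasDerivAt_symbolOfChar (tensorS f g)
      (A' := fun s => reducedMatrix (totalJ d N * H s * Φ s)) (fun s i j => hΦ.2 s (Sum.inl j) i)
      (Continuous.matrix_submatrix (A := fun s => (totalJ d N * H s * Φ s)ᵀ) (by fun_prop) _ _)
      hBc hBA hval z
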